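/- **Setting.** Let $M$ be a smooth manifold with boundary $\Sigma=\partial M$, $d=\dim M\ge 3$, with a conformal structure $c$ of any signature, and let $\sigma\in\Gamma\mathcal E[1]$ be a smooth density, $\sigma\ge 0$, with zero locus exactly $\Sigma$, whose scale tractor $I=\frac1d D\sigma$ ($D$ the tractor-D operator) has $I^2$ nowhere zero. Let $\mathcal E^\Phi$ be a tractor bundle (a tensor power of the standard tractor bundle, or a tensor part of one, with the tractor connection). For each integer $h_0\ge 1$ let $w_0$ be the weight with $h_0=d+2w_0$, and on weighted tractor fields put $x=\sigma$, $y=-\frac1{I^2}\,I\cdot D$, and $\colon z^k\colon=x^ky^k$ (extended linearly to power series in $z$). Set $$K^{h}(z)=\sum_{m\ge0}\frac{(-z)^m}{m!\,(m+1-h)_m},\qquad (k)_m=k(k-1)\cdots(k-m+1),\qquad \bar h_0=2-h_0,$$ $$F_{h_0-2}(z)=\sum_{k=0}^{h_0-2}\frac{z^k}{k!\,(h_0-2)_k}\quad(h_0\ge2),\qquad H(z)=\sum_{k\ge0}\gamma_kz^k,\qquad \gamma_0=\frac{h_0+1}{h_0^2},$$ $$\gamma_k=-\frac1{(k+1)(h_0+k)}\Big[\gamma_{k-1}+\frac{(-1)^{k+1}(h_0+2k+1)}{(k+1)!\,(h_0+k)_{k+1}}\Big]\quad(k\ge1).$$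 Let $\tau\in\Gamma\mathcal E[1]$ be a smooth positive scale on $M$ (up to the boundary), and let $(\log\tau\,y^{m})_{\rm W}=\frac12(\log\tau\,y^{m}+y^{m}\log\tau)$, where $y$ acts on log densities through the weight operator. A formal series $$f=\sum_{k\ge0}\sigma^kf_k+\sigma^{h_0-1}(\log\sigma-\log\tau)\sum_{j\ge0}\sigma^j\bar f_j ,$$ with $f_k\in\Gamma\mathcal E^\Phi[w_0-k]$ and $\bar f_j\in\Gamma\mathcal E^\Phi[-d-w_0+1-j]$ smooth up to the boundary, is an *infinite order solution* if for every $\ell\ge0$ the sum of its terms of order at most $\ell$ in $\sigma$ satisfies, off $\Sigma$, $I\cdot D f=O(\sigma^\ell)$ when $\ell<h_0-1$ and $I\cdot Df=O(\sigma^\ell)+O(\sigma^\ell\log\sigma)$ when $\ell\ge h_0-1$. Here $O(\sigma^\ell)$ means $\sigma^\ell$ times a section smooth up to the boundary, and $O(\sigma^\ell\log\sigma)$ means $\sigma^\ell\log\sigma$ times such a section. Two formal series are *equal* if for every $N$ their sums of terms of order at most $N$ differ by $O(\sigma^{N+1})+O(\sigma^{N+1}\log\sigma)$. **Theorem.** (1)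 Let $h_0\ge 2$ be an integer. For all $f_0\in\Gamma\mathcal E^\Phi[w_0]$ and all $\tau$, the formal series $\mathcal Of_0$, where $$\mathcal O=\colon F_{h_0-2}(z)\colon-\frac{\colon z^{h_0}H(z)\colon}{(h_0-1)!(h_0-2)!}-\frac{x^{h_0-1}\log x\,\colon K^{\bar h_0}(z)\colon\,y^{h_0-1}-x^{h_0-1}\,\colon K^{\bar h_0}(z)\colon\,(\log\tau\,y^{h_0-1})_{\rm W}}{(h_0-1)!(h_0-2)!},$$ is of the above form with leading coefficient the given $f_0$ and is an infinite order solution. It has no free term of order $h_0-1$: the coefficient of $x^{h_0-1}$ in $\mathcal O f_0$ is $$-\frac{1}{(h_0-1)!(h_0-2)!}\big(\log x\,y^{h_0-1}-(\log\tau\,y^{h_0-1})_{\rm W}\big)f_0,\qquad\text{and}\qquad \bar f_0=-\frac{1}{(h_0-1)!(h_0-2)!}\,y^{h_0-1}f_0 .$$ (2) Let $h_0=1$, so $w_0=\frac{1-d}2$. For all $\bar f_0\in\Gamma\mathcal E^\Phi[\frac{1-d}2]$ and all $\tau$, the formal series $\overline{\mathcal O}\bar f_0$, where $$\overline{\mathcal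 O}=\log x\,\colon J_0(2\sqrt z)\colon-\colon J_0(2\sqrt z)\colon\log\tau+\colon zH(z)\colon,\qquad J_0(2\sqrt z)=\sum_{m\ge0}\frac{(-z)^m}{(m!)^2},$$ is of the above form (with $h_0=1$), has $f_0=0$ and leading logarithmic coefficient the given $\bar f_0$, and is an infinite order solution. (3) In both cases the solution depends, as a formal series, only on $f_0|_\Sigma$ (respectively $\bar f_0|_\Sigma$) and $\tau|_\Sigma$: if $f_0,f_0'$ agree on $\Sigma$ and $\tau,\tau'$ agree on $\Sigma$, the two formal series are equal. Hence $\mathcal O$ and $\overline{\mathcal O}$ are well defined on data given along $\Sigma$. -/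

import Mathlib

open Bundle
open scoped Manifold ContDiff

/-!
# Degenerate Laplacian on conformally compact manifolds, and formal solutions with log terms

A conformal structure `c` is handled through an arbitrary metric `g ∈ c` (a *scale*).  The scale
trivialises the density bundles, so that a section of `𝓔^Φ[w]` *is* a section of the tractor
bundle `𝓔^Φ` together with the number `w`; the trivialisations given by `g` and by `e^{2Υ} g`
differ by the factor `e^{wΥ}`.  All operators are given by their expressions in the scale `g`.
-/

namespace TractorCalculus

noncomputable section

section Geometry

variable {E : Type*} [NormedAddCommGroup E] [NormedSpace ℝ E] [FiniteDimensional ℝ E]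
  {H : Type*} [TopologicalSpace H] {I : ModelWithCorners ℝ E H}
  {M : Type*} [TopologicalSpace M] [ChartedSpace H M] [IsManifold I ∞ M]

variable (I M) in
/-- A smooth pseudo-Riemannian metric, of any signature. -/
structure PseudoMetric where
  toFun : ∀ x : M, TangentSpace I x →L[ℝ] TangentSpace I x →L[ℝ] ℝ
  symm : ∀ (x : M) (v w : TangentSpace I x), toFun x v w = toFun x w v
  nondegenerate : ∀ (x : M) (v : TangentSpace I x), (∀ w, toFun x v w = 0) → v = 0
  contMDiff : ContMDiff I (I.prod 𝓘(ℝ, E →L[ℝ] E →L[ℝ] ℝ)) ∞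
    (fun x => TotalSpace.mk' (E →L[ℝ] E →L[ℝ] ℝ) x (toFun x))

/-- A basis of the tangent space at `x`. -/
def tangentBasis (x : M) : Module.Basis (Fin (Module.finrank ℝ E)) ℝ (TangentSpace I x) :=
  Module.finBasis ℝ E

/-- A local vector field, smooth near `x`, with value `v` at `x`. -/
abbrev ext {x : M} (v : TangentSpace I x) : ∀ y : M, TangentSpace I y :=
  FiberBundle.extend E v

/-- Linear map out of a tangent space with prescribed values on `tangentBasis`. -/
def ofBasis {W : Type*} [AddCommGroup W] [Module ℝ W] [TopologicalSpace W]
    [IsTopologicalAddGroup W] [ContinuousSMul ℝ W] (x : M)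
    (φ : Fin (Module.finrank ℝ E) → W) : TangentSpace I x →L[ℝ] W :=
  ((Module.finBasis ℝ E).constr ℝ φ : E →ₗ[ℝ] W).toContinuousLinearMap

/-- Raising an index: the inverse of `v ↦ g(v, ·)`. -/
def sharp (g : PseudoMetric I M) (x : M) : (TangentSpace I x →L[ℝ] ℝ) →L[ℝ] TangentSpace I x :=
  (g.toFun x).inverse

/-- The `g`-dual basis of `tangentBasis`: `g(dualVec i, b j) = δᵢⱼ`. -/
def dualVec (g : PseudoMetric I M) (x : M) (i : Fin (Module.finrank ℝ E)) : TangentSpace I x :=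
  sharp g x (ofBasis x (fun j => if j = i then (1 : ℝ) else 0))

/-- The trace `g^{ab} β_{ab}` of a bilinear form. -/
def metricTrace {W : Type*} [AddCommGroup W] (g : PseudoMetric I M) (x : M)
    (β : TangentSpace I x → TangentSpace I x → W) : W :=
  ∑ i, β (tangentBasis x i) (dualVec g x i)

/-- Koszul's expression for `g(∇_X Y, Z)`. -/
def koszul (g : PseudoMetric I M) (X Y Z : ∀ x : M, TangentSpace I x) (x : M) : ℝ :=
  (1 / 2) *
    (mvfderiv I (fun y => g.toFun y (Y y) (Z y)) x (X x)
      + mvfderiv I (fun y => g.toFun y (X y) (Z y)) x (Y x)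
      - mvfderiv I (fun y => g.toFun y (X y) (Y y)) x (Z x)
      + g.toFun x (VectorField.mlieBracket I X Y x) (Z x)
      - g.toFun x (VectorField.mlieBracket I X Z x) (Y x)
      - g.toFun x (VectorField.mlieBracket I Y Z x) (X x))

/-- The Levi-Civita connection: `leviCivita g Y x v` is `∇_v Y` at `x`. -/
def leviCivita (g : PseudoMetric I M) (Y : ∀ x : M, TangentSpace I x) (x : M) :
    TangentSpace I x →L[ℝ] TangentSpace I x :=
  ofBasis x fun i =>
    ∑ j, koszul g (ext (tangentBasis x i)) Y (ext (tangentBasis x j)) x • dualVec g x j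

/-- `R(X,Y)Z = ∇_X ∇_Y Z - ∇_Y ∇_X Z - ∇_{[X,Y]} Z`. -/
def curvature (g : PseudoMetric I M) (X Y Z : ∀ x : M, TangentSpace I x) (x : M) :
    TangentSpace I x :=
  leviCivita g (fun y => leviCivita g Z y (Y y)) x (X x)
    - leviCivita g (fun y => leviCivita g Z y (X y)) x (Y x)
    - leviCivita g Z x (VectorField.mlieBracket I X Y x)

/-- `Ric(v,w)`, the trace of `u ↦ R(u,v)w`. -/
def ricci (g : PseudoMetric I M) (x : M) (v w : TangentSpace I x) : ℝ :=
  ∑ i, (tangentBasis x).coord i (curvature g (ext (tangentBasis x i)) (ext v) (ext w) x)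

/-- The dimension `d`, as a real number. -/
def dimR (_ : PseudoMetric I M) : ℝ := Module.finrank ℝ E

/-- `J`, the trace of the Schouten tensor: `Sc = 2(d-1)J`. -/
def schoutenTrace (g : PseudoMetric I M) (x : M) : ℝ :=
  metricTrace g x (ricci g x) / (2 * (dimR g - 1))

/-- The Schouten tensor: `Ric = (d-2)P + J g`. -/
def schouten (g : PseudoMetric I M) (x : M) (v w : TangentSpace I x) : ℝ :=
  (ricci g x v w - schoutenTrace g x * g.toFun x v w) / (dimR g - 2)

/-! ### Weighted fields and the tractor D-operator -/

section Fields

variable {V : M → Type*} [∀ x, AddCommGroup (V x)] [∀ x, Module ℝ (V x)]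
  [∀ x, TopologicalSpace (V x)]

/-- The second covariant derivative `∇²_{v,w} s`, for `∇` coupled to the Levi-Civita connection. -/
def hessian (g : PseudoMetric I M) (cov : (∀ x, V x) → ∀ x, TangentSpace I x →L[ℝ] V x)
    (s : ∀ x, V x) (x : M) (v w : TangentSpace I x) : V x :=
  cov (fun y => cov s y (ext w y)) x v - cov s x (leviCivita g (ext w) x v)

/-- The coupled Laplacian `Δ = g^{ab} ∇_a ∇_b`. -/
def laplacian (g : PseudoMetric I M) (cov : (∀ x, V x) → ∀ x, TangentSpace I x →L[ℝ] V x)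
    (s : ∀ x, V x) (x : M) : V x :=
  metricTrace g x (hessian g cov s x)

/-- The tractor D-operator in the scale `g`,
`((d + 2𝐰 - 2)𝐰 s, (d + 2𝐰 - 2)∇ s, -(Δ + J𝐰) s)`.
The weight operator `𝐰` is the fibrewise endomorphism `W`. It is `w • id` on `𝓔^Φ[w]`; the form
used here also covers log densities, where `𝐰` is not diagonal. -/
def thomasD (g : PseudoMetric I M) (cov : (∀ x, V x) → ∀ x, TangentSpace I x →L[ℝ] V x)
    (W : ∀ x, V x →ₗ[ℝ] V x) (s : ∀ x, V x) (x : M) :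
    V x × (TangentSpace I x →L[ℝ] V x) × V x :=
  let s' : ∀ y, V y := fun y => (dimR g - 2) • s y + (2 : ℝ) • W y (s y)
  (W x (s' x), cov s' x, -(laplacian g cov s x + schoutenTrace g x • W x (s x)))

/-- The weight operator on `𝓔^Φ[w]`. -/
def weight (w : ℝ) (x : M) : V x →ₗ[ℝ] V x := w • LinearMap.id

/-- The exterior derivative of functions, as a connection on the trivial bundle. -/
def scalarCov (f : M → ℝ) (x : M) : TangentSpace I x →L[ℝ] ℝ := mvfderiv I f x

/-- The scale tractor `I = (1/d) D σ` of a density `σ` of weight one. -/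
def scaleTractor (g : PseudoMetric I M) (σ : M → ℝ) (x : M) :
    ℝ × (TangentSpace I x →L[ℝ] ℝ) × ℝ :=
  (dimR g)⁻¹ • thomasD (V := fun _ : M => ℝ) g scalarCov (weight 1) σ x

/-- `I² = h(I, I)`, with `h` the tractor metric `g⁻¹(μ,μ) + 2σρ`. -/
def scaleNormSq (g : PseudoMetric I M) (σ : M → ℝ) (x : M) : ℝ :=
  (scaleTractor g σ x).2.1 (sharp g x (scaleTractor g σ x).2.1)
    + 2 * (scaleTractor g σ x).1 * (scaleTractor g σ x).2.2

/-- The degenerate Laplacian `I · D`: the contraction of `I` and `D` by the tractor metric. -/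
def IdotD (g : PseudoMetric I M) (σ : M → ℝ)
    (cov : (∀ x, V x) → ∀ x, TangentSpace I x →L[ℝ] V x)
    (W : ∀ x, V x →ₗ[ℝ] V x) (s : ∀ x, V x) (x : M) : V x :=
  (scaleTractor g σ x).1 • (thomasD g cov W s x).2.2
    + (thomasD g cov W s x).2.1 (sharp g x (scaleTractor g σ x).2.1)
    + (scaleTractor g σ x).2.2 • (thomasD g cov W s x).1

/-- `y = -(1/I²) I · D`, an operator lowering the weight by one. -/
def yOp (g : PseudoMetric I M) (σ : M → ℝ)
    (cov : (∀ x, V x) → ∀ x, TangentSpace I x →L[ℝ] V x)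
    (W : ∀ x, V x →ₗ[ℝ] V x) (s : ∀ x, V x) (x : M) : V x :=
  -((scaleNormSq g σ x)⁻¹ • IdotD g σ cov W s x)

/-- The power `y^k` on fields with weight operator `W`; each factor lowers the weight by one. -/
def yPow (g : PseudoMetric I M) (σ : M → ℝ)
    (cov : (∀ x, V x) → ∀ x, TangentSpace I x →L[ℝ] V x)
    (W : ∀ x, V x →ₗ[ℝ] V x) : ℕ → (∀ x, V x) → ∀ x, V x
  | 0, s => s
  | k + 1, s => yOp g σ cov (fun x => W x - (k : ℝ) • LinearMap.id) (yPow g σ cov W k s)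

/-- Normal ordering: for `P = ∑ pₖ zᵏ` the expression `:P: s = ∑ xᵏ (pₖ yᵏ s)`, recorded by its
coefficient sequence with respect to the powers `xᵏ = σᵏ`. -/
def normalOrder (g : PseudoMetric I M) (σ : M → ℝ)
    (cov : (∀ x, V x) → ∀ x, TangentSpace I x →L[ℝ] V x)
    (W : ∀ x, V x →ₗ[ℝ] V x) (P : PowerSeries ℝ) (s : ∀ x, V x) : ℕ → ∀ x, V x :=
  fun k => PowerSeries.coeff k P • yPow g σ cov W k s

/-- Multiplication of a formal series in `x` by `x^m`. -/
def shift (m : ℕ) (a : ℕ → ∀ x, V x) : ℕ → ∀ x, V x :=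
  fun k => if m ≤ k then a (k - m) else 0

/-! ### Log densities

In the scale `g` a section of the ray bundle of metrics is `t² g`, and a density of weight `w`
is `t^w a`.  A section of the tensor product of `𝓔^Φ[w]` with log densities is
`t^w (a + b log t)`; it is recorded by the pair `(a, b)`.  The weight operator is `t ∂/∂t`, so that
`𝐰 (a, b) = (w a + b, w b)`, and `∇` acts on `a` and `b` separately.  A positive density `τ` of
weight one has `log τ = log τ_g + log t`. -/

/-- The weight operator `t ∂/∂t` on pairs `(a, b)` of weight `w`. -/
def logWeight (w : ℝ) (x : M) : (V x × V x) →ₗ[ℝ] (V x × V x) :=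
  (w • LinearMap.fst ℝ (V x) (V x) + LinearMap.snd ℝ (V x) (V x)).prod
    (w • LinearMap.snd ℝ (V x) (V x))

/-- The connection on pairs. -/
def logCov (cov : (∀ x, V x) → ∀ x, TangentSpace I x →L[ℝ] V x) (u : ∀ x, V x × V x) (x : M) :
    TangentSpace I x →L[ℝ] V x × V x :=
  (cov (fun y => (u y).1) x).prod (cov (fun y => (u y).2) x)

/-- A density seen as a pair. -/
def ofDensity (s : ∀ x, V x) : ∀ x, V x × V x := fun x => (s x, 0)

/-- Multiplication of a density by the log density `log τ`. -/
def logMul (τ : M → ℝ) (s : ∀ x, V x) : ∀ x, V x × V x :=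
  fun x => (Real.log (τ x) • s x, s x)

/-- A formal series `∑ xᵏ regₖ + log x ∑ xᵏ logxₖ`, with `x = σ`. -/
structure LogSeries (V : M → Type*) where
  reg : ℕ → ∀ x, V x × V x
  logx : ℕ → ∀ x, V x

/-! ### The solution operators -/

/-- The Weyl average `½ (log τ y^m + y^m log τ)` on densities of weight `w`. -/
def weylAverage (g : PseudoMetric I M) (σ : M → ℝ)
    (cov : (∀ x, V x) → ∀ x, TangentSpace I x →L[ℝ] V x) (w : ℝ) (τ : M → ℝ) (m : ℕ)
    (s : ∀ x, V x) : ∀ x, V x × V x :=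
  (1 / 2 : ℝ) • (logMul τ (yPow g σ cov (weight w) m s)
    + yPow g σ (logCov cov) (logWeight w) m (logMul τ s))

end Fields

/-- `K^h(z) = ∑ (-z)^m / (m! (m+1-h)_m)`, with `(k)_m = k(k-1)⋯(k-m+1)`. -/
def seriesK (h : ℝ) : PowerSeries ℝ :=
  PowerSeries.mk fun m =>
    (-1) ^ m / ((m.factorial : ℝ) * (descPochhammer ℝ m).eval ((m : ℝ) + 1 - h))

/-- The Taylor series of `J₀(2√z)`. -/
def seriesJ0 : PowerSeries ℝ :=
  PowerSeries.mk fun m => (-1) ^ m / (m.factorial : ℝ) ^ 2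

/-- The polynomial `F_{h-2}(z) = ∑_{k ≤ h-2} z^k / (k! (h-2)(h-3)⋯(h-1-k))`, for `h ≥ 2`. -/
def polyF (h : ℕ) : Polynomial ℝ :=
  ∑ k ∈ Finset.range (h - 1),
    Polynomial.monomial k (1 / ((k.factorial : ℝ) * ((h - 2).descFactorial k : ℝ)))

/-- The coefficients `γ_k` of `H(z)`, where `h` is the parameter `h₀`. -/
def gammaH (h : ℕ) : ℕ → ℝ
  | 0 => ((h : ℝ) + 1) / (h : ℝ) ^ 2
  | k + 1 => -(1 / (((k : ℝ) + 2) * ((h : ℝ) + k + 1))) *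
      (gammaH h k + (-1) ^ (k + 2) * ((h : ℝ) + 2 * k + 3)
        / (((k + 2).factorial : ℝ) * (descPochhammer ℝ (k + 2)).eval ((h : ℝ) + k + 1)))

/-- The power series `H(z) = ∑ γ_k z^k`. -/
def seriesH (h : ℕ) : PowerSeries ℝ := PowerSeries.mk (gammaH h)

section Solutions

variable {V : M → Type*} [∀ x, AddCommGroup (V x)] [∀ x, Module ℝ (V x)]
  [∀ x, TopologicalSpace (V x)]

/-- The weight `w₀` with `h₀ = d + 2 w₀`. -/
def weightOf (g : PseudoMetric I M) (h : ℕ) : ℝ := ((h : ℝ) - dimR g) / 2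

/-- The solution operator for integral `h ≥ 2`: with `c = 1 / ((h-1)! (h-2)!)`,
`𝒪 = :F: - c :z^h H: - c (x^{h-1} log x :K: y^{h-1} - x^{h-1} :K: (log τ y^{h-1})_W)`,
where `K = K^{2-h}`. -/
def solO (g : PseudoMetric I M) (σ : M → ℝ)
    (cov : (∀ x, V x) → ∀ x, TangentSpace I x →L[ℝ] V x) (h : ℕ) (τ : M → ℝ)
    (f₀ : ∀ x, V x) : LogSeries V :=
  let w₀ := weightOf g h
  let w₁ := w₀ - ((h - 1 : ℕ) : ℝ)
  let c : ℝ := 1 / (((h - 1).factorial : ℝ) * ((h - 2).factorial : ℝ))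
  { reg := fun k =>
      ofDensity (normalOrder g σ cov (weight w₀) (polyF h : PowerSeries ℝ) f₀ k)
        - c • ofDensity (normalOrder g σ cov (weight w₀)
            (PowerSeries.X ^ h * seriesH h) f₀ k)
        + c • shift (h - 1) (normalOrder g σ (logCov cov) (logWeight w₁) (seriesK (2 - (h : ℝ)))
            (weylAverage g σ cov w₀ τ (h - 1) f₀)) k
    logx := fun k =>
      -(c • shift (h - 1) (normalOrder g σ cov (weight w₁) (seriesK (2 - (h : ℝ)))
            (yPow g σ cov (weight w₀) (h - 1) f₀)) k) }

/-- The solution operator for `h₀ = 1`, that is, on weight `(1-d)/2`: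
`log x :J₀(2√z): - :J₀(2√z): log τ + :z H(z):`. -/
def solObar (g : PseudoMetric I M) (σ : M → ℝ)
    (cov : (∀ x, V x) → ∀ x, TangentSpace I x →L[ℝ] V x) (τ : M → ℝ)
    (f₀ : ∀ x, V x) : LogSeries V :=
  let w₀ := weightOf g 1
  { reg := fun k =>
      -normalOrder g σ (logCov cov) (logWeight w₀) seriesJ0 (logMul τ f₀) k
        + ofDensity (normalOrder g σ cov (weight w₀) (PowerSeries.X * seriesH 1) f₀ k)
    logx := normalOrder g σ cov (weight w₀) seriesJ0 f₀ }

/-- `u` is the formal series `∑ xᵏ fₖ + x^{h-1} (log x - log τ) ∑ xʲ f̄ⱼ`, whose coefficients are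
densities. -/
def LogSeries.HasForm (u : LogSeries V) (h : ℕ) (τ : M → ℝ) (f fbar : ℕ → ∀ x, V x) : Prop :=
  (∀ k, u.reg k = ofDensity (f k) - logMul τ (shift (h - 1) fbar k)) ∧
    ∀ k, u.logx k = shift (h - 1) fbar k

/-- The terms of order at most `ℓ` of `∑ σᵏ fₖ + σ^{h-1} (log σ - log τ) ∑ σʲ f̄ⱼ`. -/
def truncation (σ : M → ℝ) (h : ℕ) (τ : M → ℝ) (f fbar : ℕ → ∀ x, V x) (ℓ : ℕ) :
    ∀ x, V x :=
  fun x => ∑ k ∈ Finset.range (ℓ + 1), σ x ^ k •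
    (f k x + (Real.log (σ x) - Real.log (τ x)) • shift (h - 1) fbar k x)

/-- The terms of order at most `N` of a formal series, as a section in the scale `g` (`t = 1`). -/
def LogSeries.partialSum (σ : M → ℝ) (u : LogSeries V) (N : ℕ) : ∀ x, V x :=
  fun x => ∑ k ∈ Finset.range (N + 1), σ x ^ k •
    ((u.reg k x).1 + Real.log (σ x) • u.logx k x)

variable (F : Type*) [NormedAddCommGroup F] [NormedSpace ℝ F]
  [TopologicalSpace (TotalSpace F V)] [FiberBundle F V]

variable (I) in
/-- Smoothness (up to the boundary) of a section. -/
def SmoothSection (s : ∀ x, V x) : Prop :=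
  ContMDiff I (I.prod 𝓘(ℝ, F)) ∞ (fun x => TotalSpace.mk' F x (s x))

/-- The log-type problem, solved to infinite order: with smooth coefficients `fₖ`, `f̄ⱼ`, for every
`ℓ` the truncation at order `ℓ` satisfies `I·D f = O(σ^ℓ)` when `ℓ < h-1`, and
`I·D f = O(σ^ℓ) + O(σ^ℓ log σ)` when `ℓ ≥ h-1`, off the zero locus of `σ`.  Here `O(σ^ℓ)`
stands for `σ^ℓ` times a section that is smooth up to the boundary. -/
def IsInfiniteOrderSolution (g : PseudoMetric I M) (σ : M → ℝ)
    (cov : (∀ x, V x) → ∀ x, TangentSpace I x →L[ℝ] V x) (h : ℕ) (τ : M → ℝ)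
    (f fbar : ℕ → ∀ x, V x) : Prop :=
  (∀ k, SmoothSection I F (f k)) ∧ (∀ j, SmoothSection I F (fbar j)) ∧
    ∀ ℓ : ℕ, ∃ p q : ∀ x, V x, SmoothSection I F p ∧ SmoothSection I F q ∧
      (ℓ < h - 1 → q = 0) ∧
      ∀ x, 0 < σ x →
        IdotD g σ cov (weight (weightOf g h)) (truncation σ h τ f fbar ℓ) x
          = σ x ^ ℓ • p x + (σ x ^ ℓ * Real.log (σ x)) • q x

variable (I) in
/-- Equality of formal series: the partial sums agree to all orders along the zero locus of `σ`,
up to terms `O(σ^{N+1}) + O(σ^{N+1} log σ)`. -/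
def FormallyEqual (σ : M → ℝ) (u v : LogSeries V) : Prop :=
  ∀ N : ℕ, ∃ p q : ∀ x, V x, SmoothSection I F p ∧ SmoothSection I F q ∧
    ∀ x, 0 < σ x →
      u.partialSum σ N x - v.partialSum σ N x
        = σ x ^ (N + 1) • p x + (σ x ^ (N + 1) * Real.log (σ x)) • q x

end Solutions

/-! ### Tractor bundles -/

variable (I) in
/-- The fibre of the standard tractor bundle in the scale `g`: triples `(σ, μᵃ, ρ)`, the middle slot
being identified with a one-form by the metric. -/
abbrev TractorFibre (x : M) : Type _ := ℝ × TangentSpace I x × ℝ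

/-- The normal tractor connection,
`∇_v (σ, μ, ρ) = (∇_v σ - g(v,μ), ∇_v μ + ρ v + σ P(v), ∇_v ρ - P(v,μ))`. -/
def tractorCov (g : PseudoMetric I M) (t : ∀ x : M, TractorFibre I x) (x : M)
    (v : TangentSpace I x) : TractorFibre I x :=
  ( mvfderiv I (fun y => (t y).1) x v - g.toFun x v (t x).2.1,
    leviCivita g (fun y => (t y).2.1) x v + (t x).2.2 • v
      + (t x).1 • ∑ j, schouten g x v (tangentBasis x j) • dualVec g x j,
    mvfderiv I (fun y => (t y).2.2) x v - schouten g x v (t x).2.1 )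

/-- Smoothness of a section of the standard tractor bundle. -/
def SmoothTractor (t : ∀ x : M, TractorFibre I x) : Prop :=
  ContMDiff I 𝓘(ℝ, ℝ) ∞ (fun x => (t x).1) ∧
    SmoothSection I E (fun x => (t x).2.1) ∧
    ContMDiff I 𝓘(ℝ, ℝ) ∞ (fun x => (t x).2.2)

/-- A vector bundle with connection is a *tractor bundle* if it is, for some `k`, (a tensor part of)
the `k`-th tensor power of the standard tractor bundle with the tractor connection: it embeds
smoothly and parallelly into the bundle of complex valued `k`-linear forms on standard tractors
(the standard tractor bundle is self-dual by the tractor metric). -/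
def IsTractorBundle (F : Type*) [NormedAddCommGroup F] [NormedSpace ℝ F]
    {V : M → Type*} [TopologicalSpace (TotalSpace F V)]
    [∀ x, AddCommGroup (V x)] [∀ x, Module ℝ (V x)] [∀ x, TopologicalSpace (V x)]
    [FiberBundle F V] (g : PseudoMetric I M)
    (cov : (∀ x, V x) → ∀ x, TangentSpace I x →L[ℝ] V x) : Prop :=
  ∃ (k : ℕ) (ι : ∀ x, V x →ₗ[ℝ] MultilinearMap ℝ (fun _ : Fin k => TractorFibre I x) ℂ),
    (∀ x, Function.Injective (ι x)) ∧
    ∀ (s : ∀ x, V x) (t : Fin k → ∀ x : M, TractorFibre I x),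
      SmoothSection I F s → (∀ i, SmoothTractor (t i)) →
        ContMDiff I 𝓘(ℝ, ℂ) ∞ (fun x => ι x (s x) (fun i => t i x)) ∧
        ∀ (x : M) (v : TangentSpace I x),
          mvfderiv I (fun y => ι y (s y) (fun i => t i y)) x v
            = ι x (cov s x v) (fun i => t i x)
              + ∑ i, ι x (s x) (Function.update (fun j => t j x) i (tractorCov g (t i) x v))

end Geometry

end

end TractorCalculus

/-! Put `m = h₀ - 1`, so that `d + 2w₀ = m + 1`. Up to the factor `-I²`, `I·D` is `y`, and `[y, x] =
-(d + 2w)` because `Δσ` is absorbed in `I²`. Hence `y xⁿ a = xⁿ y a - p(n) xⁿ⁻¹ a` for `a` of weight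
`w₀ - n`, with `p(n) = n(m - n)`: solving `y f = 0` order by order is the Frobenius method with
indicial polynomial `p`. The recursion breaks down at `n = m`, and a logarithm is needed from there
on. If `Lₙ` and `Pₙ` are the factors of `yⁿ f₀` in the logarithmic and regular parts, the equations
are `p(n) Lₙ = Lₙ₋₁` and `p(n) Pₙ + p'(n) Lₙ = Pₙ₋₁` (`LogRecurrence`). The series `F`, `K`, `J₀`
and `H` solve them (`logRecurrence_of_gamma`).

The auxiliary scale is handled by log densities. Their weight operator has a nilpotent part, so `y`
acts on pairs through `Y` and its weight derivative `N`. Moving `y` past `log σ` produces `-N` and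
`-m/σ`: the first cancels the `N` from the pairs, the second cancels the defect of the telescoping
sum, by `p'(n) + 2n = m`. What remains of the truncation at order `n` is exactly `σⁿ` and `σⁿ log σ`
times smooth sections (`IdotD_truncation`).

For the dependence on boundary values, let `f₀` change by `x v`. Moving `x` out through the powers
of `y` shows that the coefficients change by `x cₖ - cₖ₋₁`, with `cₖ` built from `v`, so partial
sums differ by `x^(N+1) c_N` (`LogRecurrence.regCoeff_X`, `formallyEqual_of_telescope`). The Weyl
average supplies the right correction at the critical order: it takes half of the commutator on log
densities (`algWeyl_X`). A change of `τ` telescopes in the same way. Sections that agree on `Σ` do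
differ by a smooth multiple of `σ`: on `Σ` one has `I² = |dσ|²`, so `dσ ≠ 0` there, and Hadamard's
lemma in half-ball charts applies (`exists_section_quotient`).

The algebra needs operators on smooth sections, whereas the metric quantities are defined point by
point with arbitrary bases and extensions. The differential geometry serves to show that these
choices do not matter and that the results are smooth. -/

namespace TractorCalculus

open scoped Topology

noncomputable section

set_option linter.unusedSectionVars false

/-! ### Linear algebra of a metric at one point -/

section Pointwise

variable {E : Type*} [NormedAddCommGroup E] [NormedSpace ℝ E] [FiniteDimensional ℝ E]
  {H : Type*} [TopologicalSpace H] {I : ModelWithCorners ℝ E H}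
  {M : Type*} [TopologicalSpace M] [ChartedSpace H M] [IsManifold I ∞ M]

/-- Ensures that the `inverse` in `sharp` is a genuine inverse and not its default value. -/
lemma isInvertible_of_nondegenerate (B : E →L[ℝ] E →L[ℝ] ℝ)
    (hB : ∀ v, (∀ w, B v w = 0) → v = 0) : B.IsInvertible := by
  have hinj : Function.Injective (B : E →ₗ[ℝ] E →L[ℝ] ℝ) := by
    rw [← LinearMap.ker_eq_bot, LinearMap.ker_eq_bot']
    intro v hv
    exact hB v fun w => by
      have := congrArg (fun φ : E →L[ℝ] ℝ => φ w) hv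
      simpa using this
  have hdim : Module.finrank ℝ E = Module.finrank ℝ (E →L[ℝ] ℝ) := by
    rw [← LinearEquiv.finrank_eq (LinearMap.toContinuousLinearMap (𝕜 := ℝ) (E := E) (F' := ℝ))]
    exact (Subspace.dual_finrank_eq (K := ℝ) (V := E)).symm
  let e : E ≃ₗ[ℝ] (E →L[ℝ] ℝ) := LinearEquiv.ofInjectiveOfFinrankEq _ hinj hdim
  refine ⟨e.toContinuousLinearEquiv, ?_⟩
  ext v w
  rfl

@[simp] lemma toFun_sharp (g : PseudoMetric I M) (x : M) (α : TangentSpace I x →L[ℝ] ℝ) :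
    g.toFun x (sharp g x α) = α := by
  have h : ContinuousLinearMap.IsInvertible (M := TangentSpace I x)
      (M₂ := TangentSpace I x →L[ℝ] ℝ) (g.toFun x) :=
    isInvertible_of_nondegenerate (E := E) (g.toFun x) (g.nondegenerate x)
  exact h.self_apply_inverse α

lemma metric_ext (g : PseudoMetric I M) (x : M) {v v' : TangentSpace I x}
    (h : ∀ w, g.toFun x v w = g.toFun x v' w) : v = v' := by
  rw [← sub_eq_zero]
  refine g.nondegenerate x _ fun w => ?_
  simp [h w]

lemma metric_ext_basis (g : PseudoMetric I M) (x : M) {ι : Type*}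
    (b : Module.Basis ι ℝ (TangentSpace I x)) {v v' : TangentSpace I x}
    (h : ∀ j, g.toFun x v (b j) = g.toFun x v' (b j)) : v = v' := by
  refine metric_ext g x fun w => ?_
  have : (g.toFun x v : TangentSpace I x →ₗ[ℝ] ℝ) = (g.toFun x v' : TangentSpace I x →ₗ[ℝ] ℝ) :=
    b.ext fun j => by simpa using h j
  exact congrArg (fun φ : TangentSpace I x →ₗ[ℝ] ℝ => φ w) this

lemma ofBasis_apply {W : Type*} [AddCommGroup W] [Module ℝ W] [TopologicalSpace W]
    [IsTopologicalAddGroup W] [ContinuousSMul ℝ W] (x : M)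
    (φ : Fin (Module.finrank ℝ E) → W) (v : TangentSpace I x) :
    ofBasis x φ v = ∑ i, (tangentBasis x).repr v i • φ i := by
  exact Module.Basis.constr_apply_fintype (S := ℝ) (Module.finBasis ℝ E) φ v

@[simp] lemma metric_dualVec (g : PseudoMetric I M) (x : M) (i j : Fin (Module.finrank ℝ E)) :
    g.toFun x (dualVec g x i) (tangentBasis x j) = if j = i then 1 else 0 := by
  rw [dualVec, toFun_sharp, ofBasis_apply]
  simp [Finsupp.single_apply]

lemma sum_metric_smul_dualVec (g : PseudoMetric I M) (x : M) (v : TangentSpace I x) :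
    ∑ i, g.toFun x (tangentBasis x i) v • dualVec g x i = v := by
  refine metric_ext_basis g x (tangentBasis x) fun j => ?_
  simp [g.symm x v]

lemma sum_metric_dualVec_smul (g : PseudoMetric I M) (x : M) (v : TangentSpace I x) :
    ∑ i, g.toFun x (dualVec g x i) v • tangentBasis x i = v := by
  have h : ∀ i, g.toFun x (dualVec g x i) v = (tangentBasis x).repr v i := fun i => by
    conv_lhs => rw [← (tangentBasis x).sum_repr v, map_sum]
    simp only [map_smul, metric_dualVec, smul_eq_mul, mul_ite, mul_one, mul_zero]
    simp
  simp_rw [h]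
  exact (tangentBasis x).sum_repr v

/-- The Gram matrix of a family of vectors. -/
def gram (g : PseudoMetric I M) (x : M) {ι : Type*} (c : ι → TangentSpace I x) : Matrix ι ι ℝ :=
  Matrix.of fun i j => g.toFun x (c i) (c j)

lemma isUnit_det_gram (g : PseudoMetric I M) (x : M) {ι : Type*} [Fintype ι] [DecidableEq ι]
    (c : Module.Basis ι ℝ (TangentSpace I x)) : IsUnit (gram g x c).det := by
  rw [isUnit_iff_ne_zero]
  intro h0
  obtain ⟨v, hv, hvG⟩ := Matrix.exists_vecMul_eq_zero_iff.mpr h0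
  apply hv
  have h : ∑ i, v i • c i = 0 := by
    refine metric_ext_basis g x c fun j => ?_
    have := congrFun hvG j
    simpa [Matrix.vecMul, dotProduct, gram] using this
  exact funext fun i => Fintype.linearIndependent_iff.mp c.linearIndependent v h i

/-- `tangentBasis` is not a smooth frame, so smoothness has to be read off in other bases. The
inverse Gram matrix gives expansions valid in all of them. -/
lemma sum_gram_inv (g : PseudoMetric I M) (x : M) {ι : Type*} [Fintype ι] [DecidableEq ι]
    (c : Module.Basis ι ℝ (TangentSpace I x)) (v : TangentSpace I x) :
    ∑ i, ∑ j, ((gram g x c)⁻¹ i j * g.toFun x v (c i)) • c j = v := by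
  refine metric_ext_basis g x c fun k => ?_
  have h : ∀ i, ∑ j, (gram g x c)⁻¹ i j * gram g x c j k = if i = k then 1 else 0 := fun i => by
    rw [← Matrix.mul_apply, Matrix.nonsing_inv_mul _ (isUnit_det_gram g x c), Matrix.one_apply]
  simp only [map_sum, map_smul, sum_apply, smul_apply,
    smul_eq_mul]
  calc _ = ∑ i, g.toFun x v (c i) * ∑ j, (gram g x c)⁻¹ i j * gram g x c j k := by
        refine Finset.sum_congr rfl fun i _ => ?_
        rw [Finset.mul_sum]
        refine Finset.sum_congr rfl fun j _ => ?_
        simp only [gram, Matrix.of_apply]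
        ring
    _ = _ := by simp [h]

lemma gram_inv_symm (g : PseudoMetric I M) (x : M) {ι : Type*} [Fintype ι] [DecidableEq ι]
    (c : ι → TangentSpace I x) (i j : ι) : (gram g x c)⁻¹ i j = (gram g x c)⁻¹ j i := by
  have h : (gram g x c).transpose = gram g x c := by
    ext i j
    simp [gram, g.symm x]
  conv_lhs => rw [← h, ← Matrix.transpose_nonsing_inv]
  rfl

variable {W : Type*} [AddCommGroup W] [Module ℝ W]

/-- The trace of a bilinear form in an arbitrary basis. -/
lemma metricTrace_eq_sum (g : PseudoMetric I M) (x : M) {ι : Type*} [Fintype ι] [DecidableEq ι]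
    (c : Module.Basis ι ℝ (TangentSpace I x))
    (β : TangentSpace I x →ₗ[ℝ] TangentSpace I x →ₗ[ℝ] W) :
    metricTrace g x (fun v w => β v w)
      = ∑ i, ∑ j, (gram g x c)⁻¹ i j • β (c i) (c j) := by
  -- Only the first argument is expanded in `c`; the sum over `k` then reassembles the second one by
  -- `sum_metric_smul_dualVec`.
  have h1 : ∀ k, β (tangentBasis x k) (dualVec g x k)
      = ∑ i, ∑ j, (gram g x c)⁻¹ i j •
          β (c j) (g.toFun x (tangentBasis x k) (c i) • dualVec g x k) := fun k => by
    conv_lhs => rw [← sum_gram_inv g x c (tangentBasis x k)]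
    simp [LinearMap.sum_apply, mul_smul]
  calc metricTrace g x (fun v w => β v w)
      = ∑ i, ∑ j, (gram g x c)⁻¹ i j •
          β (c j) (∑ k, g.toFun x (tangentBasis x k) (c i) • dualVec g x k) := by
        rw [metricTrace, Finset.sum_congr rfl fun k _ => h1 k, Finset.sum_comm]
        refine Finset.sum_congr rfl fun i _ => ?_
        rw [Finset.sum_comm]
        refine Finset.sum_congr rfl fun j _ => ?_
        rw [map_sum, Finset.smul_sum]
    _ = ∑ i, ∑ j, (gram g x c)⁻¹ j i • β (c j) (c i) := by
        simp_rw [sum_metric_smul_dualVec, gram_inv_symm g x c]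
    _ = _ := Finset.sum_comm

lemma metricTrace_tensor (g : PseudoMetric I M) (x : M) (α : TangentSpace I x →L[ℝ] ℝ)
    (ψ : TangentSpace I x →ₗ[ℝ] W) :
    metricTrace g x (fun v w => α v • ψ w) = ψ (sharp g x α) := by
  rw [metricTrace]
  simp_rw [← map_smul]
  rw [← map_sum]
  congr 1
  conv_rhs => rw [← sum_metric_smul_dualVec g x (sharp g x α)]
  refine Finset.sum_congr rfl fun i _ => ?_
  rw [g.symm, toFun_sharp]

lemma metricTrace_tensor' (g : PseudoMetric I M) (x : M) (α : TangentSpace I x →L[ℝ] ℝ)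
    (ψ : TangentSpace I x →ₗ[ℝ] W) :
    metricTrace g x (fun v w => α w • ψ v) = ψ (sharp g x α) := by
  rw [metricTrace]
  simp_rw [← map_smul]
  rw [← map_sum]
  congr 1
  conv_rhs => rw [← sum_metric_dualVec_smul g x (sharp g x α)]
  refine Finset.sum_congr rfl fun i _ => ?_
  rw [g.symm, toFun_sharp]

end Pointwise

/-! ### Differentials, brackets and the Levi-Civita connection -/

section Differential

variable {E : Type*} [NormedAddCommGroup E] [NormedSpace ℝ E] [FiniteDimensional ℝ E]
  {H : Type*} [TopologicalSpace H] {I : ModelWithCorners ℝ E H}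
  {M : Type*} [TopologicalSpace M] [ChartedSpace H M] [IsManifold I ∞ M]

variable (I M) in
lemma isManifold_one : IsManifold I 1 M := IsManifold.of_le (n := ∞) (by simp)

variable (I M) in
lemma isManifold_minSmoothness : IsManifold I (minSmoothness ℝ 3) M := IsManifold.of_le (n := ∞) (by
  rw [minSmoothness_of_isRCLikeNormedField]
  exact WithTop.coe_le_coe.mpr le_top)

attribute [local instance] isManifold_one isManifold_minSmoothness

lemma contMDiffAt_mvfderiv {f : M → ℝ} {x : M} (hf : CMDiffAt ∞ f x) :
    ContMDiffAt I (I.prod 𝓘(ℝ, E →L[ℝ] ℝ)) ∞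
      (fun y => TotalSpace.mk' (E →L[ℝ] ℝ)
        (E := fun y : M => TangentSpace I y →L[ℝ] Bundle.Trivial M ℝ y) y (mvfderiv I f y)) x := by
  rw [contMDiffAt_hom_bundle]
  refine ⟨contMDiffAt_id, ?_⟩
  have h := hf.mfderiv_const (m := ∞) (by simp)
  refine h.congr_of_eventuallyEq ?_
  filter_upwards with y
  ext v
  simp [ContinuousLinearMap.inCoordinates, inTangentCoordinates, mvfderiv]
  rfl

lemma contMDiffAt_mvfderiv_apply {f : M → ℝ} {X : ∀ x : M, TangentSpace I x} {x : M}
    (hf : CMDiffAt ∞ f x) (hX : CMDiffAt ∞ (T% X) x) :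
    CMDiffAt ∞ (fun y => mvfderiv I f y (X y)) x := by
  have := (contMDiffAt_mvfderiv hf).clm_bundle_apply (F₁ := E) hX
  simp only [contMDiffAt_totalSpace] at this
  exact this.2

lemma mdifferentiableAt_mvfderiv_apply {f : M → ℝ} {X : ∀ x : M, TangentSpace I x} {x : M}
    (hf : CMDiffAt ∞ f x) (hX : MDiffAt (T% X) x) :
    MDiffAt (fun y => mvfderiv I f y (X y)) x := by
  have := ((contMDiffAt_mvfderiv hf).mdifferentiableAt (by simp)).clm_bundle_apply (F₁ := E) hX
  simp only [mdifferentiableAt_totalSpace] at this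
  exact this.2

lemma contMDiffAt_metric (g : PseudoMetric I M) {X Y : ∀ x : M, TangentSpace I x} {x : M}
    (hX : CMDiffAt ∞ (T% X) x) (hY : CMDiffAt ∞ (T% Y) x) :
    CMDiffAt ∞ (fun y => g.toFun y (X y) (Y y)) x := by
  have : ContMDiffAt I (I.prod 𝓘(ℝ)) ∞
      (fun m ↦ TotalSpace.mk' ℝ (E := Bundle.Trivial M ℝ) m (g.toFun m (X m) (Y m))) x := by
    apply ContMDiffAt.clm_bundle_apply₂ (F₁ := E) (F₂ := E)
    · exact g.contMDiff.contMDiffAt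
    · exact hX
    · exact hY
  simp only [contMDiffAt_totalSpace] at this
  exact this.2

lemma mdifferentiableAt_metric (g : PseudoMetric I M) {X Y : ∀ x : M, TangentSpace I x} {x : M}
    (hX : MDiffAt (T% X) x) (hY : MDiffAt (T% Y) x) :
    MDiffAt (fun y => g.toFun y (X y) (Y y)) x := by
  have : MDifferentiableAt I (I.prod 𝓘(ℝ))
      (fun m ↦ TotalSpace.mk' ℝ (E := Bundle.Trivial M ℝ) m (g.toFun m (X m) (Y m))) x := by
    apply MDifferentiableAt.clm_bundle_apply₂ (F₁ := E) (F₂ := E)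
    · exact g.contMDiff.contMDiffAt.mdifferentiableAt (by simp)
    · exact hX
    · exact hY
  simp only [mdifferentiableAt_totalSpace] at this
  exact this.2

lemma contMDiffAt_mlieBracket {X Y : ∀ x : M, TangentSpace I x} {x : M}
    (hX : CMDiffAt ∞ (T% X) x) (hY : CMDiffAt ∞ (T% Y) x) :
    CMDiffAt ∞ (T% (VectorField.mlieBracket I X Y)) x := by
  have : IsManifold I (((⊤ : ℕ∞) : WithTop ℕ∞) + 1) M := inferInstanceAs (IsManifold I ∞ M)
  refine ContMDiffAt.mlieBracket_vectorField (n := ⊤) (m := ⊤) hX hY ?_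
  rw [minSmoothness_of_isRCLikeNormedField]
  exact le_rfl

/-! ### Koszul's expression and the Levi-Civita connection -/

/-- The derivatives of the factor `f` coming from the metric terms cancel those coming from the
brackets `[fX, Y]` and `[fX, Z]`. -/
lemma koszul_tensorial_left (g : PseudoMetric I M) {Y Z : ∀ x : M, TangentSpace I x} {x : M}
    (hY : MDiffAt (T% Y) x) (hZ : MDiffAt (T% Z) x) :
    TensorialAt I E (fun X => koszul g X Y Z x) x where
  smul {f X} hf hX := by
    have h1 : (fun y => g.toFun y ((f • X) y) (Z y)) = f • fun y => g.toFun y (X y) (Z y) := by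
      ext y; simp
    have h2 : (fun y => g.toFun y ((f • X) y) (Y y)) = f • fun y => g.toFun y (X y) (Y y) := by
      ext y; simp
    simp only [koszul, h1, h2, mvfderiv_smul hf (mdifferentiableAt_metric g hX hZ),
      mvfderiv_smul hf (mdifferentiableAt_metric g hX hY),
      VectorField.mlieBracket_smul_left hf hX]
    simp
    ring
  add {X X'} hX hX' := by
    have h1 : (fun y => g.toFun y ((X + X') y) (Z y))
        = (fun y => g.toFun y (X y) (Z y)) + fun y => g.toFun y (X' y) (Z y) := by
      ext y; simp
    have h2 : (fun y => g.toFun y ((X + X') y) (Y y))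
        = (fun y => g.toFun y (X y) (Y y)) + fun y => g.toFun y (X' y) (Y y) := by
      ext y; simp
    simp only [koszul, h1, h2,
      mvfderiv_add (mdifferentiableAt_metric g hX hZ) (mdifferentiableAt_metric g hX' hZ),
      mvfderiv_add (mdifferentiableAt_metric g hX hY) (mdifferentiableAt_metric g hX' hY),
      VectorField.mlieBracket_add_left hX hX']
    simp
    ring

lemma koszul_tensorial_right (g : PseudoMetric I M) {X Y : ∀ x : M, TangentSpace I x} {x : M}
    (hX : MDiffAt (T% X) x) (hY : MDiffAt (T% Y) x) :
    TensorialAt I E (fun Z => koszul g X Y Z x) x where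
  smul {f Z} hf hZ := by
    have h1 : (fun y => g.toFun y (Y y) ((f • Z) y)) = f • fun y => g.toFun y (Y y) (Z y) := by
      ext y; simp
    have h2 : (fun y => g.toFun y (X y) ((f • Z) y)) = f • fun y => g.toFun y (X y) (Z y) := by
      ext y; simp
    simp only [koszul, h1, h2, mvfderiv_smul hf (mdifferentiableAt_metric g hX hZ),
      mvfderiv_smul hf (mdifferentiableAt_metric g hY hZ),
      VectorField.mlieBracket_smul_right hf hZ]
    simp
    rw [g.symm x (Z x) (Y x), g.symm x (Z x) (X x)]
    ring
  add {Z Z'} hZ hZ' := by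
    have h1 : (fun y => g.toFun y (Y y) ((Z + Z') y))
        = (fun y => g.toFun y (Y y) (Z y)) + fun y => g.toFun y (Y y) (Z' y) := by
      ext y; simp
    have h2 : (fun y => g.toFun y (X y) ((Z + Z') y))
        = (fun y => g.toFun y (X y) (Z y)) + fun y => g.toFun y (X y) (Z' y) := by
      ext y; simp
    simp only [koszul, h1, h2,
      mvfderiv_add (mdifferentiableAt_metric g hX hZ) (mdifferentiableAt_metric g hX hZ'),
      mvfderiv_add (mdifferentiableAt_metric g hY hZ) (mdifferentiableAt_metric g hY hZ'),
      VectorField.mlieBracket_add_right hZ hZ']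
    simp
    ring

lemma koszul_add (g : PseudoMetric I M) {X Y Y' Z : ∀ x : M, TangentSpace I x} {x : M}
    (hX : MDiffAt (T% X) x) (hY : MDiffAt (T% Y) x) (hY' : MDiffAt (T% Y') x)
    (hZ : MDiffAt (T% Z) x) :
    koszul g X (Y + Y') Z x = koszul g X Y Z x + koszul g X Y' Z x := by
  have h1 : (fun y => g.toFun y ((Y + Y') y) (Z y))
      = (fun y => g.toFun y (Y y) (Z y)) + fun y => g.toFun y (Y' y) (Z y) := by
    ext y; simp
  have h2 : (fun y => g.toFun y (X y) ((Y + Y') y))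
      = (fun y => g.toFun y (X y) (Y y)) + fun y => g.toFun y (X y) (Y' y) := by
    ext y; simp
  simp only [koszul, h1, h2,
    mvfderiv_add (mdifferentiableAt_metric g hY hZ) (mdifferentiableAt_metric g hY' hZ),
    mvfderiv_add (mdifferentiableAt_metric g hX hY) (mdifferentiableAt_metric g hX hY'),
    VectorField.mlieBracket_add_right hY hY', VectorField.mlieBracket_add_left hY hY']
  simp
  ring

lemma koszul_leibniz (g : PseudoMetric I M) {X Y Z : ∀ x : M, TangentSpace I x} {f : M → ℝ} {x : M}
    (hf : MDiffAt f x) (hX : MDiffAt (T% X) x) (hY : MDiffAt (T% Y) x) (hZ : MDiffAt (T% Z) x) :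
    koszul g X (f • Y) Z x
      = f x * koszul g X Y Z x + mvfderiv I f x (X x) * g.toFun x (Y x) (Z x) := by
  have h1 : (fun y => g.toFun y ((f • Y) y) (Z y)) = f • fun y => g.toFun y (Y y) (Z y) := by
    ext y; simp
  have h2 : (fun y => g.toFun y (X y) ((f • Y) y)) = f • fun y => g.toFun y (X y) (Y y) := by
    ext y; simp
  simp only [koszul, h1, h2, mvfderiv_smul hf (mdifferentiableAt_metric g hY hZ),
    mvfderiv_smul hf (mdifferentiableAt_metric g hX hY),
    VectorField.mlieBracket_smul_right hf hY, VectorField.mlieBracket_smul_left hf hY]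
  simp
  rw [g.symm x (Y x) (X x)]
  ring

lemma mdifferentiableAt_ext {x : M} (v : TangentSpace I x) : MDiffAt (T% (ext v)) x :=
  FiberBundle.mdifferentiableAt_extend I E v

/-- The defining property of the Levi-Civita connection. -/
lemma metric_leviCivita (g : PseudoMetric I M) {X Y Z : ∀ x : M, TangentSpace I x} {x : M}
    (hX : MDiffAt (T% X) x) (hY : MDiffAt (T% Y) x) (hZ : MDiffAt (T% Z) x) :
    g.toFun x (leviCivita g Y x (X x)) (Z x) = koszul g X Y Z x := by
  -- Tensoriality turns Koszul's expression into a bilinear form at `x`, so the particular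
  -- extensions used in `leviCivita` do not matter.
  let B := TensorialAt.mkHom₂ (I := I) (F := E) (F' := E) (fun X Z => koszul g X Y Z x) x
    (fun Z hZ => koszul_tensorial_left g hY hZ) (fun X hX => koszul_tensorial_right g hX hY)
  have hB : B (X x) (Z x) = koszul g X Y Z x :=
    TensorialAt.mkHom₂_apply (fun Z hZ => koszul_tensorial_left g hY hZ)
      (fun X hX => koszul_tensorial_right g hX hY) hX hZ
  rw [← hB]
  have key : g.toFun x (leviCivita g Y x (X x)) = B (X x) := by
    have : leviCivita g Y x (X x) = sharp g x (B (X x)) := by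
      refine metric_ext_basis g x (tangentBasis x) fun k => ?_
      rw [toFun_sharp, leviCivita, ofBasis_apply]
      conv_rhs => rw [← (tangentBasis x).sum_repr (X x), map_sum]
      simp only [map_sum, map_smul, sum_apply, smul_apply, metric_dualVec, smul_eq_mul, mul_ite,
        mul_one, mul_zero, Finset.sum_ite_eq, Finset.mem_univ, if_true]
      rfl
    rw [this, toFun_sharp]
  rw [key]

lemma leviCivita_isCovariantDerivativeOn (g : PseudoMetric I M) :
    IsCovariantDerivativeOn E (leviCivita g) Set.univ where
  add {Y Y' x} hY hY' _ := by
    ext v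
    refine metric_ext g x fun w => ?_
    have hv := FiberBundle.extend_apply_self (F := E) v
    have hw := FiberBundle.extend_apply_self (F := E) w
    rw [← hv, ← hw]
    have hV := mdifferentiableAt_ext v
    have hW := mdifferentiableAt_ext w
    rw [metric_leviCivita g hV (mdifferentiableAt_add_section hY hY') hW, koszul_add g hV hY hY' hW,
      add_apply, map_add, add_apply, metric_leviCivita g hV hY hW, metric_leviCivita g hV hY' hW]
  leibniz {Y f x} hY hf _ := by
    ext v
    refine metric_ext g x fun w => ?_
    have hv := FiberBundle.extend_apply_self (F := E) v
    have hw := FiberBundle.extend_apply_self (F := E) w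
    rw [← hv, ← hw]
    have hV := mdifferentiableAt_ext v
    have hW := mdifferentiableAt_ext w
    rw [metric_leviCivita g hV (hf.smul_section hY) hW, koszul_leibniz g hf hV hY hW]
    rw [add_apply, map_add, add_apply, smul_apply, map_smul, smul_apply,
      metric_leviCivita g hV hY hW, ContinuousLinearMap.smulRight_apply, map_smul, smul_apply]
    rfl

end Differential

attribute [local instance] isManifold_one isManifold_minSmoothness

/-! ### Global extensions, frames and smoothness of traces -/

section Frames

variable {E : Type*} [NormedAddCommGroup E] [NormedSpace ℝ E] [FiniteDimensional ℝ E]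
  {H : Type*} [TopologicalSpace H] {I : ModelWithCorners ℝ E H}
  {M : Type*} [TopologicalSpace M] [ChartedSpace H M] [IsManifold I ∞ M] [T2Space M]

/-- Local sections extend, after cutting off, to global ones with the same germ. -/
lemma exists_global_eventuallyEq {F : Type*} [NormedAddCommGroup F] [NormedSpace ℝ F]
    {V : M → Type*} [TopologicalSpace (TotalSpace F V)]
    [∀ x, AddCommGroup (V x)] [∀ x, Module ℝ (V x)] [∀ x, TopologicalSpace (V x)]
    [FiberBundle F V] [VectorBundle ℝ F V] {x : M} {u : Set M} (hu : u ∈ 𝓝 x) {s : ∀ y, V y}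
    (hs : CMDiff[u] ∞ (T% s)) :
    ∃ s' : ∀ y, V y, CMDiff ∞ (T% s') ∧ ∀ᶠ y in 𝓝 x, s' y = s y := by
  obtain ⟨χ, -, hχ⟩ := (SmoothBumpFunction.nhds_basis_tsupport (I := I) x).mem_iff.mp
    (interior_mem_nhds.mpr hu)
  refine ⟨(χ : M → ℝ) • s, ?_, ?_⟩
  · exact ContMDiffOn.smul_section_of_tsupport χ.contMDiff.contMDiffOn isOpen_interior hχ
      (hs.mono interior_subset)
  · filter_upwards [χ.eventuallyEq_one] with y hy
    simp [hy]

lemma exists_global_eventuallyEq_ext {x : M} (v : TangentSpace I x) :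
    ∃ X : ∀ y : M, TangentSpace I y, CMDiff ∞ (T% X) ∧ X =ᶠ[𝓝 x] ext v := by
  obtain ⟨u, hu, h⟩ := FiberBundle.exists_contMDiffOn_extend (k := ∞) I E v
  exact exists_global_eventuallyEq hu h

lemma exists_global_extension {x : M} (v : TangentSpace I x) :
    ∃ X : ∀ y : M, TangentSpace I y, CMDiff ∞ (T% X) ∧ X x = v := by
  obtain ⟨X, hX, h⟩ := exists_global_eventuallyEq_ext v
  exact ⟨X, hX, by rw [h.self_of_nhds]; exact FiberBundle.extend_apply_self (F := E) v⟩

/-- Global smooth vector fields which form a frame near a given point. -/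
lemma exists_global_frame (x : M) :
    ∃ e : Fin (Module.finrank ℝ E) → ∀ y : M, TangentSpace I y, (∀ i, CMDiff ∞ (T% (e i))) ∧
      ∀ᶠ y in 𝓝 x, ∃ b : Module.Basis (Fin (Module.finrank ℝ E)) ℝ (TangentSpace I y),
        ∀ i, b i = e i y := by
  let t := trivializationAt E (TangentSpace I : M → Type _) x
  have hx : x ∈ t.baseSet := FiberBundle.mem_baseSet_trivializationAt E (TangentSpace I) x
  let b := Module.finBasis ℝ E
  have h := fun i => exists_global_eventuallyEq (t.open_baseSet.mem_nhds hx)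
    (Trivialization.contMDiffOn_localFrame_baseSet (I := I) ∞ t b i)
  choose e he heq using h
  refine ⟨e, he, ?_⟩
  filter_upwards [Filter.eventually_all.mpr heq, t.open_baseSet.mem_nhds hx] with y hy hyt
  refine ⟨t.basisAt b hyt, fun i => ?_⟩
  rw [hy i, t.localFrame_apply_of_mem_baseSet b hyt]

/-- Operations on global smooth vector fields which are linear over smooth functions are
pointwise. -/
lemma pointwise_of_smooth_linear {A : Type*} [AddCommGroup A] [Module ℝ A]
    (Φ : (∀ y : M, TangentSpace I y) → A) (x : M)
    (hsmul : ∀ (f : M → ℝ) (X : ∀ y : M, TangentSpace I y), CMDiff ∞ f → CMDiff ∞ (T% X) → Φ (f • X) = f x • Φ X)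
    (hadd : ∀ X X' : ∀ y : M, TangentSpace I y, CMDiff ∞ (T% X) → CMDiff ∞ (T% X') → Φ (X + X') = Φ X + Φ X')
    {X X' : ∀ y : M, TangentSpace I y} (hX : CMDiff ∞ (T% X)) (hX' : CMDiff ∞ (T% X'))
    (h : X x = X' x) : Φ X = Φ X' := by
  let t := trivializationAt E (TangentSpace I : M → Type _) x
  have hx : x ∈ t.baseSet := FiberBundle.mem_baseSet_trivializationAt E (TangentSpace I) x
  let b := Module.finBasis ℝ E
  obtain ⟨χ, -, hχ⟩ := (SmoothBumpFunction.nhds_basis_tsupport (I := I) x).mem_iff.mp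
    (t.open_baseSet.mem_nhds hx)
  let e : Fin (Module.finrank ℝ E) → ∀ y : M, TangentSpace I y := fun i =>
    (χ : M → ℝ) • t.localFrame b i
  have he : ∀ i, CMDiff ∞ (T% (e i)) := fun i =>
    ContMDiffOn.smul_section_of_tsupport χ.contMDiff.contMDiffOn t.open_baseSet hχ
      (Trivialization.contMDiffOn_localFrame_baseSet (I := I) ∞ t b i)
  let c : (∀ y : M, TangentSpace I y) → Fin (Module.finrank ℝ E) → M → ℝ := fun X i y =>
    χ y • t.localFrameCoeff I b i y (X y)
  have hc : ∀ X : ∀ y : M, TangentSpace I y, CMDiff ∞ (T% X) → ∀ i, CMDiff ∞ (c X i) := fun X hX i => by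
    intro y
    by_cases hy : y ∈ t.baseSet
    · exact χ.contMDiffAt.smul (contMDiffAt_localFrameCoeff b hy (hX y) i)
    · have : ∀ᶠ z in 𝓝 y, c X i z = 0 := by
        have h1 : (tsupport χ)ᶜ ∈ 𝓝 y :=
          (isClosed_tsupport _).isOpen_compl.mem_nhds fun h => hy (hχ h)
        filter_upwards [h1] with z hz
        simp [c, image_eq_zero_of_notMem_tsupport hz]
      exact (contMDiffAt_const (c := (0 : ℝ))).congr_of_eventuallyEq this
  -- One factor `χ` globalises the coefficients and the other the frame fields, so `χ² X` is a
  -- combination of global smooth objects, while `χ x = 1` leaves the value of `Φ` unchanged.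
  have hexp : ∀ X : ∀ y : M, TangentSpace I y,
      (χ : M → ℝ) • (χ : M → ℝ) • X = ∑ i, c X i • e i := fun X => by
    ext y
    by_cases hy : y ∈ t.baseSet
    · have := Trivialization.eq_sum_localFrameCoeff_smul (I := I) (e := t) (b := b) (s := X) hy
      rw [Finset.sum_apply]
      simp only [Pi.smul_apply', c, e]
      conv_lhs => rw [this, Finset.smul_sum, Finset.smul_sum]
      refine Finset.sum_congr rfl fun i _ => ?_
      simp only [smul_smul, smul_eq_mul]
      congr 1
      ring
    · have h0 : χ y = 0 := image_eq_zero_of_notMem_tsupport fun h => hy (hχ h)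
      rw [Finset.sum_apply]
      simp [c, e, h0]
  have hsum : ∀ (s : Finset (Fin (Module.finrank ℝ E))) (X : ∀ y : M, TangentSpace I y),
      CMDiff ∞ (T% X) → CMDiff ∞ (T% (∑ i ∈ s, c X i • e i)) ∧
        Φ (∑ i ∈ s, c X i • e i) = ∑ i ∈ s, c X i x • Φ (e i) := fun s X hX => by
    classical
    induction s using Finset.induction_on with
    | empty =>
      have h0 : CMDiff ∞ (T% (0 : ∀ y : M, TangentSpace I y)) :=
        Bundle.contMDiff_zeroSection ℝ (TangentSpace I : M → Type _)
      refine ⟨by simpa using h0, ?_⟩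
      have := hsmul (fun _ => 0) 0 contMDiff_const h0
      simp only [Finset.sum_empty]
      rw [smul_zero, zero_smul] at this
      exact this
    | insert a s ha ih =>
      have h1 := (hc X hX a).smul_section (he a)
      rw [Finset.sum_insert ha, Finset.sum_insert ha, hadd _ _ h1 ih.1, ih.2,
        hsmul _ _ (hc X hX a) (he a)]
      exact ⟨h1.add_section ih.1, rfl⟩
  have hval : ∀ X : ∀ y : M, TangentSpace I y, CMDiff ∞ (T% X) →
      Φ X = ∑ i, c X i x • Φ (e i) := fun X hX => by
    rw [← (hsum Finset.univ X hX).2, ← hexp,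
      hsmul _ _ χ.contMDiff (χ.contMDiff.smul_section hX), hsmul _ _ χ.contMDiff hX, χ.eq_one,
      one_smul, one_smul]
  rw [hval X hX, hval X' hX']
  simp only [c, h]

lemma contMDiffAt_det {ι : Type*}  [Fintype ι] [DecidableEq ι] {A : M → Matrix ι ι ℝ} {x : M}
    (hA : ∀ i j, CMDiffAt ∞ (fun y => A y i j) x) : CMDiffAt ∞ (fun y => (A y).det) x := by
  simp only [Matrix.det_apply']
  refine ContMDiffAt.sum fun σ _ => ?_
  refine ContMDiffAt.mul contMDiffAt_const ?_
  exact contMDiffAt_finsetProd fun i _ => hA _ _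

lemma contMDiffAt_matrix_inv {ι : Type*} [Fintype ι] [DecidableEq ι] {A : M → Matrix ι ι ℝ} {x : M}
    (hA : ∀ i j, CMDiffAt ∞ (fun y => A y i j) x) (hx : (A x).det ≠ 0) (i j : ι) :
    CMDiffAt ∞ (fun y => (A y)⁻¹ i j) x := by
  simp only [Matrix.inv_def, Ring.inverse_eq_inv', Matrix.smul_apply, smul_eq_mul,
    Matrix.adjugate_apply]
  refine ContMDiffAt.mul ((contMDiffAt_det hA).inv₀ hx) (contMDiffAt_det fun k l => ?_)
  by_cases hk : k = j
  · subst hk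
    simp only [Matrix.updateRow_self]
    exact contMDiffAt_const
  · simp only [Matrix.updateRow_ne hk]
    exact hA k l

variable (g : PseudoMetric I M)

lemma contMDiffAt_gram_inv {e : Fin (Module.finrank ℝ E) → ∀ y : M, TangentSpace I y} {x : M}
    (he : ∀ i, CMDiff ∞ (T% (e i)))
    (hb : ∀ᶠ y in 𝓝 x, ∃ b : Module.Basis (Fin (Module.finrank ℝ E)) ℝ (TangentSpace I y),
        ∀ i, b i = e i y) (i j : Fin (Module.finrank ℝ E)) :
    CMDiffAt ∞ (fun y => (gram g y fun i => e i y)⁻¹ i j) x := by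
  obtain ⟨b, hb⟩ := hb.self_of_nhds
  refine contMDiffAt_matrix_inv (fun i j => contMDiffAt_metric g (he i x) (he j x)) ?_ i j
  have := (isUnit_det_gram g x b).ne_zero
  rwa [show (⇑b) = fun i => e i x from funext hb] at this

/-- A vector field is smooth when its products with smooth vector fields are. -/
lemma contMDiff_of_metric {Z : ∀ y : M, TangentSpace I y}
    (h : ∀ X : ∀ y : M, TangentSpace I y, CMDiff ∞ (T% X) →
      CMDiff ∞ fun y => g.toFun y (Z y) (X y)) : CMDiff ∞ (T% Z) := by
  intro x
  obtain ⟨e, he, hb⟩ := exists_global_frame (I := I) x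
  have : CMDiffAt ∞ (T% (fun y => ∑ i, ∑ j,
      ((gram g y fun i => e i y)⁻¹ i j * g.toFun y (Z y) (e i y)) • e j y)) x := by
    refine ContMDiffAt.sum_section fun i _ => ContMDiffAt.sum_section fun j _ => ?_
    exact ((contMDiffAt_gram_inv g he hb i j).mul (h (e i) (he i) x)).smul_section (he j x)
  refine this.congr_of_eventuallyEq ?_
  filter_upwards [hb] with y ⟨b, hb⟩
  have := sum_gram_inv g y b (Z y)
  rw [show (⇑b) = fun i => e i y from funext hb] at this
  rw [this]

/-- The trace is rewritten near each point in a smooth frame, where its coefficients are entries of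
an inverse Gram matrix, hence smooth. -/
lemma contMDiff_metricTrace {F : Type*} [NormedAddCommGroup F] [NormedSpace ℝ F]
    {V : M → Type*} [TopologicalSpace (TotalSpace F V)]
    [∀ x, AddCommGroup (V x)] [∀ x, Module ℝ (V x)] [∀ x, TopologicalSpace (V x)]
    [FiberBundle F V] [VectorBundle ℝ F V]
    (β : ∀ y : M, TangentSpace I y →ₗ[ℝ] TangentSpace I y →ₗ[ℝ] V y)
    (h : ∀ X Y : ∀ y : M, TangentSpace I y, CMDiff ∞ (T% X) → CMDiff ∞ (T% Y) →
      CMDiff ∞ (T% fun y => β y (X y) (Y y))) :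
    CMDiff ∞ (T% fun y => metricTrace g y fun v w => β y v w) := by
  intro x
  obtain ⟨e, he, hb⟩ := exists_global_frame (I := I) x
  have : CMDiffAt ∞ (T% (fun y => ∑ i, ∑ j,
      ((gram g y fun i => e i y)⁻¹ i j) • β y (e i y) (e j y))) x := by
    refine ContMDiffAt.sum_section fun i _ => ContMDiffAt.sum_section fun j _ => ?_
    exact (contMDiffAt_gram_inv g he hb i j).smul_section (h _ _ (he i) (he j) x)
  refine this.congr_of_eventuallyEq ?_
  filter_upwards [hb] with y ⟨b, hb⟩
  have := metricTrace_eq_sum g y b (β y)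
  rw [show (⇑b) = fun i => e i y from funext hb] at this
  rw [this]

lemma contMDiff_trivial_iff {f : M → ℝ} :
    ContMDiff I (I.prod 𝓘(ℝ)) ∞ (fun y => TotalSpace.mk' ℝ (E := Bundle.Trivial M ℝ) y (f y)) ↔
      CMDiff ∞ f := by
  constructor
  · intro h x
    have := h x
    simp only [contMDiffAt_totalSpace] at this
    exact this.2
  · intro h x
    simp only [contMDiffAt_totalSpace]
    exact ⟨contMDiffAt_id, h x⟩

end Frames

/-! ### Curvature is a tensor; smoothness of the Schouten trace -/

section Curvature

variable {E : Type*} [NormedAddCommGroup E] [NormedSpace ℝ E] [FiniteDimensional ℝ E]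
  {H : Type*} [TopologicalSpace H] {I : ModelWithCorners ℝ E H}
  {M : Type*} [TopologicalSpace M] [ChartedSpace H M] [IsManifold I ∞ M] [T2Space M]
  (g : PseudoMetric I M)

lemma contMDiff_mvfderiv_apply {f : M → ℝ} {X : ∀ x : M, TangentSpace I x}
    (hf : CMDiff ∞ f) (hX : CMDiff ∞ (T% X)) : CMDiff ∞ (fun y => mvfderiv I f y (X y)) :=
  fun x => contMDiffAt_mvfderiv_apply (hf x) (hX x)

lemma contMDiff_metric {X Y : ∀ x : M, TangentSpace I x}
    (hX : CMDiff ∞ (T% X)) (hY : CMDiff ∞ (T% Y)) :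
    CMDiff ∞ (fun y => g.toFun y (X y) (Y y)) :=
  fun x => contMDiffAt_metric g (hX x) (hY x)

lemma contMDiff_mlieBracket {X Y : ∀ x : M, TangentSpace I x}
    (hX : CMDiff ∞ (T% X)) (hY : CMDiff ∞ (T% Y)) :
    CMDiff ∞ (T% (VectorField.mlieBracket I X Y)) :=
  fun x => contMDiffAt_mlieBracket (hX x) (hY x)

lemma mdifferentiableAt_of_smooth {F : Type*} [NormedAddCommGroup F] [NormedSpace ℝ F]
    {V : M → Type*} [TopologicalSpace (TotalSpace F V)]
    [∀ x, AddCommGroup (V x)] [∀ x, Module ℝ (V x)] [∀ x, TopologicalSpace (V x)]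
    [FiberBundle F V] {s : ∀ x, V x} (hs : CMDiff ∞ (T% s)) (x : M) : MDiffAt (T% s) x :=
  (hs x).mdifferentiableAt (by simp)

lemma contMDiff_koszul {X Y Z : ∀ x : M, TangentSpace I x}
    (hX : CMDiff ∞ (T% X)) (hY : CMDiff ∞ (T% Y)) (hZ : CMDiff ∞ (T% Z)) :
    CMDiff ∞ (koszul g X Y Z) := by
  refine contMDiff_const.mul ?_
  refine ((((ContMDiff.add ?_ ?_).sub ?_).add ?_).sub ?_).sub ?_
  · exact contMDiff_mvfderiv_apply (contMDiff_metric g hY hZ) hX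
  · exact contMDiff_mvfderiv_apply (contMDiff_metric g hX hZ) hY
  · exact contMDiff_mvfderiv_apply (contMDiff_metric g hX hY) hZ
  · exact contMDiff_metric g (contMDiff_mlieBracket hX hY) hZ
  · exact contMDiff_metric g (contMDiff_mlieBracket hX hZ) hY
  · exact contMDiff_metric g (contMDiff_mlieBracket hY hZ) hX

lemma contMDiff_leviCivita {X Y : ∀ x : M, TangentSpace I x}
    (hX : CMDiff ∞ (T% X)) (hY : CMDiff ∞ (T% Y)) :
    CMDiff ∞ (T% fun y => leviCivita g Y y (X y)) := by
  refine contMDiff_of_metric g fun Z hZ => ?_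
  refine (contMDiff_koszul g hX hY hZ).congr fun y => ?_
  exact metric_leviCivita g (mdifferentiableAt_of_smooth hX y) (mdifferentiableAt_of_smooth hY y)
    (mdifferentiableAt_of_smooth hZ y)

/-- The Lie bracket acts on functions as the commutator. -/
lemma mvfderiv_mlieBracket {X Y : ∀ x : M, TangentSpace I x} {f : M → ℝ} (x : M)
    (hX : CMDiff ∞ (T% X)) (hY : CMDiff ∞ (T% Y)) (hf : CMDiff ∞ f) :
    mvfderiv I f x (VectorField.mlieBracket I X Y x)
      = mvfderiv I (fun y => mvfderiv I f y (Y y)) x (X x)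
        - mvfderiv I (fun y => mvfderiv I f y (X y)) x (Y x) := by
  set D : ℝ := mvfderiv I (fun y => mvfderiv I f y (Y y)) x (X x)
        - mvfderiv I (fun y => mvfderiv I f y (X y)) x (Y x)
        - mvfderiv I f x (VectorField.mlieBracket I X Y x) with hD
  have hdf : ∀ y, MDiffAt f y := fun y => (hf y).mdifferentiableAt (by simp)
  -- Compare the Jacobi identity for `f • Z` with `f` times the one for `Z`: all terms cancel except
  -- the defect `D` times `Z`.
  have key : ∀ v : TangentSpace I x, D • v = 0 := fun v => by
    obtain ⟨Z, hZ, rfl⟩ := exists_global_extension v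
    have hdX := mdifferentiableAt_of_smooth hX
    have hdY := mdifferentiableAt_of_smooth hY
    have hdZ := mdifferentiableAt_of_smooth hZ
    have expand : ∀ W : ∀ x : M, TangentSpace I x,
        VectorField.mlieBracket I W (f • Z)
          = (fun y => mvfderiv I f y (W y)) • Z + f • VectorField.mlieBracket I W Z := fun W => by
      ext y
      rw [VectorField.mlieBracket_smul_right (hdf y) (hdZ y)]
      rfl
    have expand2 : ∀ U W : ∀ x : M, TangentSpace I x, CMDiff ∞ (T% W) →
        VectorField.mlieBracket I U (VectorField.mlieBracket I W (f • Z)) x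
          = mvfderiv I (fun y => mvfderiv I f y (W y)) x (U x) • Z x
            + mvfderiv I f x (W x) • VectorField.mlieBracket I U Z x
            + (mvfderiv I f x (U x) • VectorField.mlieBracket I W Z x
              + f x • VectorField.mlieBracket I U (VectorField.mlieBracket I W Z) x) :=
      fun U W hW => by
        have h1 : CMDiff ∞ (fun y => mvfderiv I f y (W y)) := contMDiff_mvfderiv_apply hf hW
        have hd1 : MDiffAt (fun y => mvfderiv I f y (W y)) x := (h1 x).mdifferentiableAt (by simp)
        have hd2 := mdifferentiableAt_of_smooth (contMDiff_mlieBracket hW hZ) x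
        rw [expand W, VectorField.mlieBracket_add_right (hd1.smul_section (hdZ x))
          ((hdf x).smul_section hd2), VectorField.mlieBracket_smul_right hd1 (hdZ x),
          VectorField.mlieBracket_smul_right (hdf x) hd2]
    have two : minSmoothness ℝ 2 ≤ (∞ : WithTop ℕ∞) := by
      rw [minSmoothness_of_isRCLikeNormedField]
      exact WithTop.coe_le_coe.mpr le_top
    have jac := fun (W : ∀ x : M, TangentSpace I x) (hW : CMDiff ∞ (T% W)) =>
      VectorField.leibniz_identity_mlieBracket_apply ((hX x).of_le two) ((hY x).of_le two)
        ((hW x).of_le two)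
    have j1 := jac (f • Z) (hf.smul_section hZ)
    have j2 := jac Z hZ
    rw [expand2 X Y hY, expand2 Y X hX, expand (VectorField.mlieBracket I X Y), j2] at j1
    simp only [Pi.add_apply, Pi.smul_apply'] at j1
    rw [hD, sub_smul, sub_smul]
    rw [← sub_eq_zero] at j1
    rw [← j1]
    module
  have h0 : D = 0 := by
    by_contra hne
    -- `D ≠ 0` would make the tangent space trivial, and then all three terms of `D` vanish.
    have hall : ∀ v : TangentSpace I x, v = 0 := fun v =>
      (smul_eq_zero.mp (key v)).resolve_left hne
    apply hne
    rw [hD, hall (X x), hall (Y x), hall (VectorField.mlieBracket I X Y x)]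
    simp
  rw [hD] at h0
  linarith

/-- Locality is needed because `ext v` is smooth only near `x`, while smoothness statements are made
for global fields. -/
lemma koszul_congr {X X' Y Y' Z Z' : ∀ x : M, TangentSpace I x} {x : M} (hX : X =ᶠ[𝓝 x] X')
    (hY : Y =ᶠ[𝓝 x] Y') (hZ : Z =ᶠ[𝓝 x] Z') : koszul g X Y Z x = koszul g X' Y' Z' x := by
  have hd : ∀ {A A' B B' : ∀ x : M, TangentSpace I x}, A =ᶠ[𝓝 x] A' → B =ᶠ[𝓝 x] B' →
      mvfderiv I (fun y => g.toFun y (A y) (B y)) x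
        = mvfderiv I (fun y => g.toFun y (A' y) (B' y)) x := fun {A A' B B'} hA hB => by
    have : (fun y => g.toFun y (A y) (B y)) =ᶠ[𝓝 x] fun y => g.toFun y (A' y) (B' y) := by
      filter_upwards [hA, hB] with y h1 h2
      rw [h1, h2]
    ext v
    simp only [mvfderiv]
    rw [this.mfderiv_eq]
    simp only [ContinuousLinearMap.comp_apply]
    rfl
  simp only [koszul, hd hY hZ, hd hX hZ, hd hX hY, hX.mlieBracket_vectorField_eq hY,
    hX.mlieBracket_vectorField_eq hZ, hY.mlieBracket_vectorField_eq hZ, hX.self_of_nhds,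
    hY.self_of_nhds, hZ.self_of_nhds]

lemma leviCivita_congr {Y Y' : ∀ x : M, TangentSpace I x} {x : M} (hY : Y =ᶠ[𝓝 x] Y') :
    leviCivita g Y x = leviCivita g Y' x := by
  simp only [leviCivita]
  congr 1
  ext i
  refine Finset.sum_congr rfl fun j _ => ?_
  exact congrArg (· • dualVec g x j)
    (koszul_congr g (Filter.EventuallyEq.refl _ _) hY (Filter.EventuallyEq.refl _ _))

lemma curvature_congr {X X' Y Y' Z Z' : ∀ x : M, TangentSpace I x} {x : M} (hX : X =ᶠ[𝓝 x] X')
    (hY : Y =ᶠ[𝓝 x] Y') (hZ : Z =ᶠ[𝓝 x] Z') :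
    curvature g X Y Z x = curvature g X' Y' Z' x := by
  have h : ∀ {A A' : ∀ x : M, TangentSpace I x}, A =ᶠ[𝓝 x] A' →
      (fun y => leviCivita g Z y (A y)) =ᶠ[𝓝 x] fun y => leviCivita g Z' y (A' y) :=
    fun {A A'} hA => by
      filter_upwards [hA, hZ.eventuallyEq_nhds] with y h1 h2
      rw [h1, leviCivita_congr g h2]
  simp only [curvature, leviCivita_congr g (h hY), leviCivita_congr g (h hX), leviCivita_congr g hZ,
    hX.self_of_nhds, hY.self_of_nhds, hX.mlieBracket_vectorField_eq hY]

lemma leviCivita_add {Y Y' : ∀ x : M, TangentSpace I x} {x : M}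
    (hY : MDiffAt (T% Y) x) (hY' : MDiffAt (T% Y') x) :
    leviCivita g (Y + Y') x = leviCivita g Y x + leviCivita g Y' x :=
  (leviCivita_isCovariantDerivativeOn g).add hY hY'

lemma leviCivita_smul {Y : ∀ x : M, TangentSpace I x} {f : M → ℝ} {x : M}
    (hf : MDiffAt f x) (hY : MDiffAt (T% Y) x) :
    leviCivita g (f • Y) x = f x • leviCivita g Y x + (mvfderiv I f x).smulRight (Y x) :=
  (leviCivita_isCovariantDerivativeOn g).leibniz hY hf

lemma curvature_swap (X Y Z : ∀ x : M, TangentSpace I x) (x : M) :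
    curvature g X Y Z x = -curvature g Y X Z x := by
  simp only [curvature, VectorField.mlieBracket_swap_apply (V := X) (W := Y), map_neg]
  abel

variable {X Y Z : ∀ x : M, TangentSpace I x} {f : M → ℝ} (x : M)

lemma curvature_smul_left (hf : CMDiff ∞ f) (hX : CMDiff ∞ (T% X)) (hZ : CMDiff ∞ (T% Z)) :
    curvature g (f • X) Y Z x = f x • curvature g X Y Z x := by
  have h1 : (fun y => leviCivita g Z y ((f • X) y)) = f • fun y => leviCivita g Z y (X y) := by
    ext y; simp
  have hdf : MDiffAt f x := (hf x).mdifferentiableAt (by simp)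
  simp only [curvature, h1]
  rw [leviCivita_smul g hdf (mdifferentiableAt_of_smooth (contMDiff_leviCivita g hX hZ) x),
    VectorField.mlieBracket_smul_left hdf (mdifferentiableAt_of_smooth hX x)]
  simp only [Pi.smul_apply', map_smul, add_apply, smul_apply, ContinuousLinearMap.smulRight_apply,
    map_add]
  module

lemma curvature_add_left {X' : ∀ x : M, TangentSpace I x} (hX : CMDiff ∞ (T% X))
    (hX' : CMDiff ∞ (T% X')) (hZ : CMDiff ∞ (T% Z)) :
    curvature g (X + X') Y Z x = curvature g X Y Z x + curvature g X' Y Z x := by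
  have h1 : (fun y => leviCivita g Z y ((X + X') y))
      = (fun y => leviCivita g Z y (X y)) + fun y => leviCivita g Z y (X' y) := by
    ext y; simp
  simp only [curvature, h1]
  rw [leviCivita_add g (mdifferentiableAt_of_smooth (contMDiff_leviCivita g hX hZ) x)
      (mdifferentiableAt_of_smooth (contMDiff_leviCivita g hX' hZ) x),
    VectorField.mlieBracket_add_left (mdifferentiableAt_of_smooth hX x)
      (mdifferentiableAt_of_smooth hX' x)]
  simp only [Pi.add_apply, map_add, add_apply]
  abel

/-- First derivatives of `f` cancel by antisymmetry in `X` and `Y`; the second derivatives leave the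
commutator on `f`, cancelled by the bracket term through `mvfderiv_mlieBracket`. -/
lemma curvature_smul_right (hf : CMDiff ∞ f) (hX : CMDiff ∞ (T% X)) (hY : CMDiff ∞ (T% Y))
    (hZ : CMDiff ∞ (T% Z)) :
    curvature g X Y (f • Z) x = f x • curvature g X Y Z x := by
  have hdf : ∀ y, MDiffAt f y := fun y => (hf y).mdifferentiableAt (by simp)
  have hdZ := mdifferentiableAt_of_smooth hZ
  have h1 : ∀ W : ∀ x : M, TangentSpace I x, (fun y => leviCivita g (f • Z) y (W y))
      = f • (fun y => leviCivita g Z y (W y)) + (fun y => mvfderiv I f y (W y)) • Z := fun W => by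
    ext y
    rw [leviCivita_smul g (hdf y) (hdZ y)]
    rfl
  have h2 : ∀ U W : ∀ x : M, TangentSpace I x, CMDiff ∞ (T% W) →
      leviCivita g (fun y => leviCivita g (f • Z) y (W y)) x (U x)
        = f x • leviCivita g (fun y => leviCivita g Z y (W y)) x (U x)
          + mvfderiv I f x (U x) • leviCivita g Z x (W x)
          + (mvfderiv I f x (W x) • leviCivita g Z x (U x)
            + mvfderiv I (fun y => mvfderiv I f y (W y)) x (U x) • Z x) := fun U W hW => by
    have hd1 := mdifferentiableAt_of_smooth (contMDiff_leviCivita g hW hZ) x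
    have hd2 : MDiffAt (fun y => mvfderiv I f y (W y)) x :=
      (contMDiff_mvfderiv_apply hf hW x).mdifferentiableAt (by simp)
    rw [h1 W, leviCivita_add g ((hdf x).smul_section hd1) (hd2.smul_section (hdZ x)),
      leviCivita_smul g (hdf x) hd1, leviCivita_smul g hd2 (hdZ x)]
    rfl
  simp only [curvature]
  rw [h2 X Y hY, h2 Y X hX, leviCivita_smul g (hdf x) (hdZ x)]
  simp only [add_apply, smul_apply, ContinuousLinearMap.smulRight_apply]
  rw [mvfderiv_mlieBracket x hX hY hf]
  module

lemma curvature_add_right {Z' : ∀ x : M, TangentSpace I x} (hX : CMDiff ∞ (T% X))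
    (hY : CMDiff ∞ (T% Y)) (hZ : CMDiff ∞ (T% Z)) (hZ' : CMDiff ∞ (T% Z')) :
    curvature g X Y (Z + Z') x = curvature g X Y Z x + curvature g X Y Z' x := by
  have hdZ := mdifferentiableAt_of_smooth hZ
  have hdZ' := mdifferentiableAt_of_smooth hZ'
  have h1 : ∀ W : ∀ x : M, TangentSpace I x, (fun y => leviCivita g (Z + Z') y (W y))
      = (fun y => leviCivita g Z y (W y)) + fun y => leviCivita g Z' y (W y) := fun W => by
    ext y
    rw [leviCivita_add g (hdZ y) (hdZ' y)]
    rfl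
  simp only [curvature, h1]
  rw [leviCivita_add g (mdifferentiableAt_of_smooth (contMDiff_leviCivita g hY hZ) x)
      (mdifferentiableAt_of_smooth (contMDiff_leviCivita g hY hZ') x),
    leviCivita_add g (mdifferentiableAt_of_smooth (contMDiff_leviCivita g hX hZ) x)
      (mdifferentiableAt_of_smooth (contMDiff_leviCivita g hX hZ') x),
    leviCivita_add g (hdZ x) (hdZ' x)]
  simp only [add_apply]
  abel

lemma contMDiff_curvature (hX : CMDiff ∞ (T% X)) (hY : CMDiff ∞ (T% Y)) (hZ : CMDiff ∞ (T% Z)) :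
    CMDiff ∞ (T% (curvature g X Y Z)) := by
  refine ContMDiff.sub_section (ContMDiff.sub_section ?_ ?_) ?_
  · exact contMDiff_leviCivita g hX (contMDiff_leviCivita g hY hZ)
  · exact contMDiff_leviCivita g hY (contMDiff_leviCivita g hX hZ)
  · exact contMDiff_leviCivita g (contMDiff_mlieBracket hX hY) hZ

/-- The value of the curvature on vectors, computed with arbitrary smooth extensions. -/
lemma curvature_ext (hX : CMDiff ∞ (T% X)) (hY : CMDiff ∞ (T% Y)) (hZ : CMDiff ∞ (T% Z)) :
    curvature g (ext (X x)) (ext (Y x)) (ext (Z x)) x = curvature g X Y Z x := by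
  obtain ⟨X', hX', hXe⟩ := exists_global_eventuallyEq_ext (X x)
  obtain ⟨Y', hY', hYe⟩ := exists_global_eventuallyEq_ext (Y x)
  obtain ⟨Z', hZ', hZe⟩ := exists_global_eventuallyEq_ext (Z x)
  rw [← curvature_congr g hXe hYe hZe]
  have ev : ∀ {A B : ∀ x : M, TangentSpace I x}, A =ᶠ[𝓝 x] ext (B x) → A x = B x :=
    fun {A B} h => by
      rw [h.self_of_nhds]; exact FiberBundle.extend_apply_self (F := E) (B x)
  -- One argument is exchanged at a time, each step by `pointwise_of_smooth_linear`; the second slot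
  -- is reduced to the first by antisymmetry.
  calc curvature g X' Y' Z' x = curvature g X Y' Z' x :=
        pointwise_of_smooth_linear (fun X => curvature g X Y' Z' x) x
          (fun f X hf hX => curvature_smul_left g x hf hX hZ')
          (fun A B hA hB => curvature_add_left g x hA hB hZ') hX' hX (ev hXe)
    _ = curvature g X Y Z' x := by
        rw [curvature_swap g X Y', curvature_swap g X Y]
        congr 1
        exact pointwise_of_smooth_linear (fun Y => curvature g Y X Z' x) x
          (fun f Y hf hY => curvature_smul_left g x hf hY hZ')
          (fun A B hA hB => curvature_add_left g x hA hB hZ') hY' hY (ev hYe)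
    _ = curvature g X Y Z x :=
        pointwise_of_smooth_linear (fun Z => curvature g X Y Z x) x
          (fun f Z hf hZ => curvature_smul_right g x hf hX hY hZ)
          (fun A B hA hB => curvature_add_right g x hX hY hA hB) hZ' hZ (ev hZe)

/-- The curvature tensor at a point. -/
def curvatureAt (u v w : TangentSpace I x) : TangentSpace I x :=
  curvature g (ext u) (ext v) (ext w) x

lemma curvatureAt_add (u u' v w : TangentSpace I x) :
    curvatureAt g x (u + u') v w = curvatureAt g x u v w + curvatureAt g x u' v w ∧
    curvatureAt g x v (u + u') w = curvatureAt g x v u w + curvatureAt g x v u' w ∧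
    curvatureAt g x v w (u + u') = curvatureAt g x v w u + curvatureAt g x v w u' := by
  obtain ⟨U, hU, rfl⟩ := exists_global_extension u
  obtain ⟨U', hU', rfl⟩ := exists_global_extension u'
  obtain ⟨V, hV, rfl⟩ := exists_global_extension v
  obtain ⟨W, hW, rfl⟩ := exists_global_extension w
  have h := hU.add_section hU'
  rw [show U x + U' x = (U + U') x from rfl]
  simp only [curvatureAt, curvature_ext g x h hV hW, curvature_ext g x hU hV hW,
    curvature_ext g x hU' hV hW, curvature_ext g x hV h hW, curvature_ext g x hV hU hW,
    curvature_ext g x hV hU' hW, curvature_ext g x hV hW h, curvature_ext g x hV hW hU,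
    curvature_ext g x hV hW hU']
  refine ⟨curvature_add_left g x hU hU' hW, ?_, curvature_add_right g x hV hW hU hU'⟩
  rw [curvature_swap, curvature_add_left g x hU hU' hW, curvature_swap g V U,
    curvature_swap g V U']
  abel

lemma curvatureAt_smul (c : ℝ) (u v w : TangentSpace I x) :
    curvatureAt g x (c • u) v w = c • curvatureAt g x u v w ∧
    curvatureAt g x v (c • u) w = c • curvatureAt g x v u w ∧
    curvatureAt g x v w (c • u) = c • curvatureAt g x v w u := by
  obtain ⟨U, hU, rfl⟩ := exists_global_extension u
  obtain ⟨V, hV, rfl⟩ := exists_global_extension v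
  obtain ⟨W, hW, rfl⟩ := exists_global_extension w
  have hc : CMDiff ∞ (fun _ : M => c) := contMDiff_const
  have h := hc.smul_section hU
  rw [show c • U x = ((fun _ : M => c) • U) x from rfl]
  simp only [curvatureAt, curvature_ext g x h hV hW, curvature_ext g x hU hV hW,
    curvature_ext g x hV h hW, curvature_ext g x hV hU hW,
    curvature_ext g x hV hW h, curvature_ext g x hV hW hU]
  refine ⟨curvature_smul_left g x hc hU hW, ?_, curvature_smul_right g x hc hV hW hU⟩
  rw [curvature_swap, curvature_smul_left g x hc hU hW, curvature_swap g V U, smul_neg]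

/-- The bilinear form `u, u' ↦ g(R(u,v)w, u')`, whose trace is `Ric(v,w)`. -/
def curvatureForm (v w : TangentSpace I x) :
    TangentSpace I x →ₗ[ℝ] TangentSpace I x →ₗ[ℝ] ℝ :=
  LinearMap.mk₂ ℝ (fun u u' => g.toFun x (curvatureAt g x u v w) u')
    (fun u u' z => by simp [(curvatureAt_add g x u u' v w).1])
    (fun c u z => by simp [(curvatureAt_smul g x c u v w).1])
    (fun u z z' => by simp) (fun c u z => by simp)

/-- Recasts a trace over the non-smooth basis `tangentBasis` so that `contMDiff_scalar_metricTrace`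
applies. -/
lemma ricci_eq_metricTrace (v w : TangentSpace I x) :
    ricci g x v w = metricTrace g x fun u u' => curvatureForm g x v w u u' := by
  have hc : ∀ (i) (u : TangentSpace I x),
      (tangentBasis x).coord i u = g.toFun x u (dualVec g x i) := fun i u => by
    rw [g.symm]
    conv_rhs => rw [← (tangentBasis x).sum_repr u, map_sum]
    simp only [map_smul, metric_dualVec, smul_eq_mul, mul_ite, mul_one, mul_zero]
    simp
  rw [ricci, metricTrace]
  exact Finset.sum_congr rfl fun i _ => hc i _

lemma ricci_add_left (u u' v : TangentSpace I x) :
    ricci g x (u + u') v = ricci g x u v + ricci g x u' v := by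
  simp only [ricci, ← Finset.sum_add_distrib, ← map_add]
  exact Finset.sum_congr rfl fun i _ => congrArg _ (curvatureAt_add g x u u' _ v).2.1

lemma ricci_add_right (u u' v : TangentSpace I x) :
    ricci g x v (u + u') = ricci g x v u + ricci g x v u' := by
  simp only [ricci, ← Finset.sum_add_distrib, ← map_add]
  exact Finset.sum_congr rfl fun i _ => congrArg _ (curvatureAt_add g x u u' _ v).2.2

lemma ricci_smul_left (c : ℝ) (u v : TangentSpace I x) :
    ricci g x (c • u) v = c • ricci g x u v := by
  simp only [ricci, Finset.smul_sum, ← map_smul]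
  exact Finset.sum_congr rfl fun i _ => congrArg _ (curvatureAt_smul g x c u _ v).2.1

lemma ricci_smul_right (c : ℝ) (u v : TangentSpace I x) :
    ricci g x v (c • u) = c • ricci g x v u := by
  simp only [ricci, Finset.smul_sum, ← map_smul]
  exact Finset.sum_congr rfl fun i _ => congrArg _ (curvatureAt_smul g x c u _ v).2.2

/-- The Ricci curvature as a bilinear form. -/
def ricciForm : TangentSpace I x →ₗ[ℝ] TangentSpace I x →ₗ[ℝ] ℝ :=
  LinearMap.mk₂ ℝ (ricci g x) (fun u u' v => ricci_add_left g x u u' v)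
    (fun c u v => ricci_smul_left g x c u v) (fun v u u' => ricci_add_right g x u u' v)
    (fun c v u => ricci_smul_right g x c u v)

lemma contMDiff_scalar_metricTrace
    (β : ∀ y : M, TangentSpace I y →ₗ[ℝ] TangentSpace I y →ₗ[ℝ] ℝ)
    (h : ∀ X Y : ∀ y : M, TangentSpace I y, CMDiff ∞ (T% X) → CMDiff ∞ (T% Y) →
      CMDiff ∞ fun y => β y (X y) (Y y)) :
    CMDiff ∞ fun y => metricTrace g y fun v w => β y v w :=
  contMDiff_trivial_iff.mp (contMDiff_metricTrace (F := ℝ) (V := Bundle.Trivial M ℝ) g β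
    fun X Y hX hY => contMDiff_trivial_iff.mpr (h X Y hX hY))

lemma contMDiff_ricci (hX : CMDiff ∞ (T% X)) (hY : CMDiff ∞ (T% Y)) :
    CMDiff ∞ fun y => ricci g y (X y) (Y y) := by
  simp_rw [ricci_eq_metricTrace]
  refine contMDiff_scalar_metricTrace g (fun y => curvatureForm g y (X y) (Y y))
    fun U U' hU hU' => ?_
  refine (contMDiff_metric g (contMDiff_curvature g hU hX hY) hU').congr fun y => ?_
  simp only [curvatureForm, LinearMap.mk₂_apply, curvatureAt, curvature_ext g y hU hX hY]

lemma contMDiff_schoutenTrace : CMDiff ∞ (schoutenTrace g) := by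
  have h : CMDiff ∞ fun y => metricTrace g y (ricci g y) :=
    contMDiff_scalar_metricTrace g (ricciForm g) fun X Y hX hY => contMDiff_ricci g hX hY
  have h2 := h.mul (contMDiff_const (c := (2 * (dimR g - 1))⁻¹) (I := I) (M := M))
  exact h2.congr fun y => div_eq_mul_inv _ _

end Curvature

/-! ### Smooth connections, Hessians and product rules for the Laplacian -/

section Laplacian

variable {E : Type*} [NormedAddCommGroup E] [NormedSpace ℝ E] [FiniteDimensional ℝ E]
  {H : Type*} [TopologicalSpace H] {I : ModelWithCorners ℝ E H}
  {M : Type*} [TopologicalSpace M] [ChartedSpace H M] [IsManifold I ∞ M] [T2Space M]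
  (g : PseudoMetric I M)
  {F : Type*} [NormedAddCommGroup F] [NormedSpace ℝ F]
  {V : M → Type*} [TopologicalSpace (TotalSpace F V)]
  [∀ x, AddCommGroup (V x)] [∀ x, Module ℝ (V x)] [∀ x, TopologicalSpace (V x)]
  [∀ x, IsTopologicalAddGroup (V x)] [∀ x, ContinuousSMul ℝ (V x)]
  [FiberBundle F V] [VectorBundle ℝ F V]

variable (F) in
/-- A connection which maps smooth sections to smooth sections. -/
structure IsSmoothConnection (cov : (∀ x, V x) → ∀ x, TangentSpace I x →L[ℝ] V x) : Prop where
  isCov : IsCovariantDerivativeOn F cov Set.univ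
  smooth : ∀ s : ∀ x, V x, CMDiff ∞ (T% s) →
    ContMDiff I (I.prod 𝓘(ℝ, E →L[ℝ] F)) ∞
      (fun x => TotalSpace.mk' (E →L[ℝ] F) (E := fun x => TangentSpace I x →L[ℝ] V x) x (cov s x))

variable {cov : (∀ x, V x) → ∀ x, TangentSpace I x →L[ℝ] V x}

lemma mdifferentiableAt_trivial_iff {f : M → ℝ} {x : M} :
    MDifferentiableAt I (I.prod 𝓘(ℝ))
      (fun y => TotalSpace.mk' ℝ (E := Bundle.Trivial M ℝ) y (f y)) x ↔ MDiffAt f x := by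
  constructor
  · intro h
    simp only [mdifferentiableAt_totalSpace] at h
    exact h.2
  · intro h
    simp only [mdifferentiableAt_totalSpace]
    exact ⟨mdifferentiableAt_id, h⟩

lemma isSmoothConnection_scalarCov :
    IsSmoothConnection (I := I) (M := M) ℝ (V := Bundle.Trivial M ℝ) scalarCov where
  isCov :=
    { add := fun {s s' x} hs hs' _ => by
        exact mvfderiv_add (mdifferentiableAt_trivial_iff.mp hs) (mdifferentiableAt_trivial_iff.mp hs')
      leibniz := fun {s f x} hs hf _ => by
        exact mvfderiv_smul hf (mdifferentiableAt_trivial_iff.mp hs) }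
  smooth s hs := fun x => contMDiffAt_mvfderiv (contMDiff_trivial_iff.mp hs x)

namespace IsSmoothConnection

variable (hcov : IsSmoothConnection F cov)
include hcov

lemma contMDiff_apply {s : ∀ x, V x} (hs : CMDiff ∞ (T% s)) {X : ∀ x : M, TangentSpace I x}
    (hX : CMDiff ∞ (T% X)) : CMDiff ∞ (T% fun y => cov s y (X y)) :=
  fun x => (hcov.smooth s hs x).clm_bundle_apply (F₁ := E) (hX x)

lemma mdifferentiableAt_apply {s : ∀ x, V x} (hs : CMDiff ∞ (T% s))
    {X : ∀ x : M, TangentSpace I x} {x : M} (hX : MDiffAt (T% X) x) :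
    MDiffAt (T% fun y => cov s y (X y)) x :=
  ((hcov.smooth s hs x).mdifferentiableAt (by simp)).clm_bundle_apply (F₁ := E) hX

lemma add {s s' : ∀ x, V x} {x : M} (hs : MDiffAt (T% s) x) (hs' : MDiffAt (T% s') x) :
    cov (s + s') x = cov s x + cov s' x := hcov.isCov.add hs hs'

lemma leibniz {s : ∀ x, V x} {f : M → ℝ} {x : M} (hf : MDiffAt f x) (hs : MDiffAt (T% s) x) :
    cov (f • s) x = f x • cov s x + (mvfderiv I f x).smulRight (s x) := hcov.isCov.leibniz hs hf

lemma const_smul {s : ∀ x, V x} {x : M} (c : ℝ) (hs : MDiffAt (T% s) x) :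
    cov (c • s) x = c • cov s x := hcov.isCov.smul_const c hs

/-- Both terms produce the same summand `df(v) ∇_W s` when `W` is multiplied by `f`, and they enter
with opposite signs. -/
lemma hessian_tensorial {s : ∀ x, V x} (hs : CMDiff ∞ (T% s)) (x : M) (v : TangentSpace I x) :
    TensorialAt I E (fun W : ∀ x : M, TangentSpace I x =>
      cov (fun y => cov s y (W y)) x v - cov s x (leviCivita g W x v)) x where
  smul {f W} hf hW := by
    have h : (fun y => cov s y ((f • W) y)) = f • fun y => cov s y (W y) := by
      ext y; simp
    rw [h, hcov.leibniz hf (hcov.mdifferentiableAt_apply hs hW), leviCivita_smul g hf hW]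
    simp only [add_apply, smul_apply, ContinuousLinearMap.smulRight_apply, map_add, map_smul]
    module
  add {W W'} hW hW' := by
    have h : (fun y => cov s y ((W + W') y))
        = (fun y => cov s y (W y)) + fun y => cov s y (W' y) := by
      ext y; simp
    rw [h, hcov.add (hcov.mdifferentiableAt_apply hs hW) (hcov.mdifferentiableAt_apply hs hW'),
      leviCivita_add g hW hW']
    simp only [add_apply, map_add]
    module

lemma hessian_eq {s : ∀ x, V x} (hs : CMDiff ∞ (T% s)) {x : M} (v : TangentSpace I x)
    {W : ∀ x : M, TangentSpace I x} (hW : MDiffAt (T% W) x) :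
    hessian g cov s x v (W x)
      = cov (fun y => cov s y (W y)) x v - cov s x (leviCivita g W x v) :=
  (hcov.hessian_tensorial g hs x v).pointwise (mdifferentiableAt_ext _) hW
    (FiberBundle.extend_apply_self (F := E) _)

/-- The Hessian as a bilinear form. -/
def hessianForm {s : ∀ x, V x} (hs : CMDiff ∞ (T% s)) (x : M) :
    TangentSpace I x →ₗ[ℝ] TangentSpace I x →ₗ[ℝ] V x :=
  LinearMap.mk₂ ℝ (hessian g cov s x)
    (fun v v' w => by simp only [hessian, map_add]; abel)
    (fun c v w => by simp only [hessian, map_smul, smul_sub])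
    (fun v w w' => by
      obtain ⟨W, hW, rfl⟩ := exists_global_extension w
      obtain ⟨W', hW', rfl⟩ := exists_global_extension w'
      have hd := mdifferentiableAt_of_smooth hW x
      have hd' := mdifferentiableAt_of_smooth hW' x
      rw [show W x + W' x = (W + W') x from rfl,
        hcov.hessian_eq g hs v (mdifferentiableAt_add_section hd hd'), hcov.hessian_eq g hs v hd,
        hcov.hessian_eq g hs v hd']
      exact (hcov.hessian_tensorial g hs x v).add hd hd')
    (fun c v w => by
      obtain ⟨W, hW, rfl⟩ := exists_global_extension w
      have hd := mdifferentiableAt_of_smooth hW x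
      have hc : MDiffAt (fun _ : M => c) x := mdifferentiableAt_const
      rw [show c • W x = ((fun _ : M => c) • W) x from rfl,
        hcov.hessian_eq g hs v (hc.smul_section hd), hcov.hessian_eq g hs v hd]
      exact (hcov.hessian_tensorial g hs x v).smul hc hd)

/-- By `hessian_eq` the pointwise extensions in `hessian` may be replaced by one smooth vector
field, after which every term is visibly smooth. -/
lemma contMDiff_laplacian {s : ∀ x, V x} (hs : CMDiff ∞ (T% s)) :
    CMDiff ∞ (T% (laplacian g cov s)) := by
  refine contMDiff_metricTrace g (fun y => hcov.hessianForm g hs y) fun X Y hX hY => ?_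
  have h : (fun y => hcov.hessianForm g hs y (X y) (Y y))
      = (fun y => cov (fun y => cov s y (Y y)) y (X y))
        - fun y => cov s y (leviCivita g Y y (X y)) := by
    ext y
    exact hcov.hessian_eq g hs (X y) (mdifferentiableAt_of_smooth hY y)
  have h' := (hcov.contMDiff_apply (hcov.contMDiff_apply hs hY) hX).sub_section
    (hcov.contMDiff_apply hs (contMDiff_leviCivita g hX hY))
  exact h'.congr fun y => congrArg (TotalSpace.mk' F y) (congrFun h y)

lemma hessian_add {s s' : ∀ x, V x} (hs : CMDiff ∞ (T% s)) (hs' : CMDiff ∞ (T% s')) (x : M)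
    (v w : TangentSpace I x) :
    hessian g cov (s + s') x v w = hessian g cov s x v w + hessian g cov s' x v w := by
  have h : (fun y => cov (s + s') y (ext w y))
      = (fun y => cov s y (ext w y)) + fun y => cov s' y (ext w y) := by
    ext y
    rw [hcov.add (mdifferentiableAt_of_smooth hs y) (mdifferentiableAt_of_smooth hs' y)]
    rfl
  have hw := mdifferentiableAt_ext w
  simp only [hessian]
  rw [h, hcov.add (hcov.mdifferentiableAt_apply hs hw) (hcov.mdifferentiableAt_apply hs' hw),
    hcov.add (mdifferentiableAt_of_smooth hs x) (mdifferentiableAt_of_smooth hs' x)]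
  simp only [add_apply]
  abel

lemma hessian_smul {s : ∀ x, V x} {φ : M → ℝ} (hφ : CMDiff ∞ φ) (hs : CMDiff ∞ (T% s)) (x : M)
    (v w : TangentSpace I x) :
    hessian g cov (φ • s) x v w = φ x • hessian g cov s x v w + mvfderiv I φ x v • cov s x w
      + mvfderiv I φ x w • cov s x v
      + hessian (V := Bundle.Trivial M ℝ) g scalarCov φ x v w • s x := by
  have hdφ : ∀ y, MDiffAt φ y := fun y => (hφ y).mdifferentiableAt (by simp)
  have hds := mdifferentiableAt_of_smooth hs
  have h : (fun y => cov (φ • s) y (ext w y))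
      = φ • (fun y => cov s y (ext w y)) + (fun y => mvfderiv I φ y (ext w y)) • s := by
    ext y
    rw [hcov.leibniz (hdφ y) (hds y)]
    rfl
  have hw := mdifferentiableAt_ext w
  have h1 := hcov.mdifferentiableAt_apply hs hw
  have h2 : MDiffAt (fun y => mvfderiv I φ y (ext w y)) x :=
    mdifferentiableAt_mvfderiv_apply (hφ x) hw
  have hev : ext w x = w := FiberBundle.extend_apply_self (F := E) w
  simp only [hessian]
  rw [h, hcov.add ((hdφ x).smul_section h1) (h2.smul_section (hds x)),
    hcov.leibniz (hdφ x) h1, hcov.leibniz h2 (hds x), hcov.leibniz (hdφ x) (hds x)]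
  simp only [add_apply, smul_apply, ContinuousLinearMap.smulRight_apply, hev, scalarCov]
  module

lemma laplacian_add {s s' : ∀ x, V x} (hs : CMDiff ∞ (T% s)) (hs' : CMDiff ∞ (T% s')) (x : M) :
    laplacian g cov (s + s') x = laplacian g cov s x + laplacian g cov s' x := by
  simp only [laplacian, metricTrace, hcov.hessian_add g hs hs', Finset.sum_add_distrib]

/-- The product rule for the Laplacian. -/
lemma laplacian_smul {s : ∀ x, V x} {φ : M → ℝ} (hφ : CMDiff ∞ φ) (hs : CMDiff ∞ (T% s)) (x : M) :
    laplacian g cov (φ • s) x = φ x • laplacian g cov s x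
      + (2 : ℝ) • cov s x (sharp g x (mvfderiv I φ x))
      + laplacian (V := Bundle.Trivial M ℝ) g scalarCov φ x • s x := by
  have h1 := metricTrace_tensor g x (mvfderiv I φ x) (cov s x : TangentSpace I x →ₗ[ℝ] V x)
  have h2 := metricTrace_tensor' g x (mvfderiv I φ x) (cov s x : TangentSpace I x →ₗ[ℝ] V x)
  simp only [metricTrace, ContinuousLinearMap.coe_coe] at h1 h2
  simp only [laplacian, metricTrace, hcov.hessian_smul g hφ hs, Finset.sum_add_distrib]
  rw [h1, h2, ← Finset.smul_sum, ← Finset.sum_smul]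
  module

end IsSmoothConnection

lemma contMDiff_scalar_laplacian {φ : M → ℝ} (hφ : CMDiff ∞ φ) :
    ContMDiff I 𝓘(ℝ, ℝ) ∞
      (fun y => (laplacian (V := Bundle.Trivial M ℝ) g scalarCov φ y : ℝ)) :=
  contMDiff_trivial_iff.mp (isSmoothConnection_scalarCov.contMDiff_laplacian g
    (contMDiff_trivial_iff.mpr hφ))

lemma contMDiff_sharp_mvfderiv {φ : M → ℝ} (hφ : CMDiff ∞ φ) :
    CMDiff ∞ (T% fun y => sharp g y (mvfderiv I φ y)) := by
  refine contMDiff_of_metric g fun X hX => ?_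
  refine (contMDiff_mvfderiv_apply hφ hX).congr fun y => ?_
  rw [toFun_sharp]

lemma mvfderiv_congr_germ {f f' : M → ℝ} {x : M} (h : f =ᶠ[𝓝 x] f') :
    mvfderiv I f x = mvfderiv I f' x := by
  ext v
  have h0 := h.eq_of_nhds
  simp only [mvfderiv]
  rw [h.mfderiv_eq]
  simp only [ContinuousLinearMap.comp_apply]
  rfl

lemma mvfderiv_log {σ L : M → ℝ} (hσ : CMDiff ∞ σ) {x : M} (hx : 0 < σ x)
    (hL : L =ᶠ[𝓝 x] fun y => Real.log (σ y)) :
    mvfderiv I L x = (σ x)⁻¹ • mvfderiv I σ x := by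
  have h1 : mvfderiv I L x = mvfderiv I (Real.log ∘ σ) x := mvfderiv_congr_germ hL
  have hd : MDiffAt Real.log (σ x) :=
    (Real.differentiableAt_log hx.ne').mdifferentiableAt
  have h2 : mfderiv 𝓘(ℝ, ℝ) 𝓘(ℝ, ℝ) Real.log (σ x) =
    ContinuousLinearMap.smulRight (1 : ℝ →L[ℝ] ℝ) (σ x)⁻¹ := by
    rw [mfderiv_eq_fderiv]
    exact ((Real.hasDerivAt_log hx.ne').hasFDerivAt).fderiv
  rw [h1]
  ext v
  simp only [mvfderiv]
  rw [mfderiv_comp x hd ((hσ x).mdifferentiableAt (by simp)), h2]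
  simp only [ContinuousLinearMap.comp_apply, smul_apply, smul_eq_mul]
  rw [mul_comm]
  rfl

lemma hessian_log {σ L : M → ℝ} (hσ : CMDiff ∞ σ) (hLs : CMDiff ∞ L) {x : M} (hx : 0 < σ x)
    (hL : L =ᶠ[𝓝 x] fun y => Real.log (σ y)) (v w : TangentSpace I x) :
    (hessian (V := Bundle.Trivial M ℝ) g scalarCov L x v w : ℝ)
      = (σ x)⁻¹ * (hessian (V := Bundle.Trivial M ℝ) g scalarCov σ x v w : ℝ)
        - ((σ x)⁻¹) ^ 2 * (mvfderiv I σ x v * mvfderiv I σ x w) := by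
  have hw := mdifferentiableAt_ext w
  have hev : ext w x = w := FiberBundle.extend_apply_self (F := E) w
  have hdL : MDiffAt (fun y => mvfderiv I L y (ext w y)) x :=
    mdifferentiableAt_mvfderiv_apply (hLs x) hw
  -- The relation `dσ = σ dL` near `x` is differentiated and solved for the second derivative of
  -- `L`, which avoids differentiating `1/σ`.
  have hpos : ∀ᶠ y in 𝓝 x, 0 < σ y := hσ.continuous.continuousAt.eventually (lt_mem_nhds hx)
  have hg : (fun y => mvfderiv I σ y (ext w y))
      =ᶠ[𝓝 x] σ • fun y => mvfderiv I L y (ext w y) := by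
    filter_upwards [hpos, hL.eventually_nhds] with y hy hy'
    rw [Pi.smul_apply', mvfderiv_log hσ hy hy', smul_apply, smul_eq_mul, smul_eq_mul,
      mul_inv_cancel_left₀ hy.ne']
  have h3 : mvfderiv I (fun y => mvfderiv I σ y (ext w y)) x v
      = σ x * mvfderiv I (fun y => mvfderiv I L y (ext w y)) x v
        + mvfderiv I σ x v * ((σ x)⁻¹ * mvfderiv I σ x w) := by
    rw [mvfderiv_congr_germ hg, mvfderiv_smul ((hσ x).mdifferentiableAt (by simp)) hdL]
    simp only [add_apply, smul_apply, ContinuousLinearMap.smulRight_apply, hev, smul_eq_mul,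
      mvfderiv_log hσ hx hL]
  simp only [hessian, scalarCov]
  rw [h3, mvfderiv_log hσ hx hL]
  simp only [smul_apply, smul_eq_mul]
  field_simp
  ring

lemma laplacian_log {σ L : M → ℝ} (hσ : CMDiff ∞ σ) (hLs : CMDiff ∞ L) {x : M} (hx : 0 < σ x)
    (hL : L =ᶠ[𝓝 x] fun y => Real.log (σ y)) :
    (laplacian (V := Bundle.Trivial M ℝ) g scalarCov L x : ℝ)
      = (σ x)⁻¹ * (laplacian (V := Bundle.Trivial M ℝ) g scalarCov σ x : ℝ)
        - ((σ x)⁻¹) ^ 2 * mvfderiv I σ x (sharp g x (mvfderiv I σ x)) := by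
  have h1 := metricTrace_tensor g x (mvfderiv I σ x) (mvfderiv I σ x : TangentSpace I x →ₗ[ℝ] ℝ)
  simp only [metricTrace, ContinuousLinearMap.coe_coe, smul_eq_mul] at h1
  rw [← h1]
  simp only [laplacian, metricTrace, Finset.mul_sum, ← Finset.sum_sub_distrib]
  exact Finset.sum_congr rfl fun i _ => hessian_log g hσ hLs hx hL _ _

end Laplacian

/-! ### The slots of the scale tractor -/

section ScaleTractor

variable {E : Type*} [NormedAddCommGroup E] [NormedSpace ℝ E] [FiniteDimensional ℝ E]
  {H : Type*} [TopologicalSpace H] {I : ModelWithCorners ℝ E H}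
  {M : Type*} [TopologicalSpace M] [ChartedSpace H M] [IsManifold I ∞ M] [T2Space M]
  (g : PseudoMetric I M) {σ : M → ℝ}

lemma scaleTractor_fst (hd : dimR g ≠ 0) (x : M) : (scaleTractor g σ x).1 = σ x := by
  have h : (scaleTractor g σ x).1
      = (dimR g)⁻¹ * (1 * ((dimR g - 2) * σ x + 2 * (1 * σ x))) := rfl
  rw [h]
  field_simp
  ring

lemma scaleTractor_snd (hd : dimR g ≠ 0) {x : M} (hσ : MDiffAt σ x) :
    (scaleTractor g σ x).2.1 = mvfderiv I σ x := by
  have h : (scaleTractor g σ x).2.1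
      = (dimR g)⁻¹ • mvfderiv I (fun y => (dimR g - 2) * σ y + 2 * (1 * σ y)) x := rfl
  have h' : (fun y => (dimR g - 2) * σ y + 2 * (1 * σ y)) = dimR g • σ := by
    ext y; simp only [Pi.smul_apply, smul_eq_mul]; ring
  have h2 : mvfderiv I (dimR g • σ) x = dimR g • mvfderiv I σ x := by
    ext v
    exact congrArg (fun f => f v) (const_smul_mfderiv hσ (dimR g))
  rw [h, h', h2, smul_smul, inv_mul_cancel₀ hd, one_smul]

lemma scaleTractor_trd (x : M) : (scaleTractor g σ x).2.2 = -((dimR g)⁻¹ *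
    ((laplacian (V := Bundle.Trivial M ℝ) g scalarCov σ x : ℝ) + schoutenTrace g x * σ x)) := by
  have h : (scaleTractor g σ x).2.2 = (dimR g)⁻¹ *
    (-((laplacian (V := Bundle.Trivial M ℝ) g scalarCov σ x : ℝ)
      + schoutenTrace g x * (1 * σ x))) := rfl
  rw [h]; ring

lemma scaleNormSq_eq (hd : dimR g ≠ 0) {x : M} (hσ : MDiffAt σ x) :
    scaleNormSq g σ x = mvfderiv I σ x (sharp g x (mvfderiv I σ x))
      + 2 * σ x * (scaleTractor g σ x).2.2 := by
  rw [scaleNormSq, scaleTractor_fst g hd, scaleTractor_snd g hd hσ]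

lemma contMDiff_scaleTractor_trd (hσ : CMDiff ∞ σ) :
    CMDiff ∞ (fun x => (scaleTractor g σ x).2.2) := by
  refine ContMDiff.congr (f := fun x => -((dimR g)⁻¹ *
    ((laplacian (V := Bundle.Trivial M ℝ) g scalarCov σ x : ℝ) + schoutenTrace g x * σ x))) ?_
    fun x => scaleTractor_trd g x
  exact (contMDiff_const.mul ((contMDiff_scalar_laplacian g hσ).add
    ((contMDiff_schoutenTrace g).mul hσ))).neg

lemma contMDiff_scaleNormSq (hd : dimR g ≠ 0) (hσ : CMDiff ∞ σ) :
    CMDiff ∞ (scaleNormSq g σ) := by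
  refine ContMDiff.congr (f := fun x => mvfderiv I σ x (sharp g x (mvfderiv I σ x))
      + 2 * σ x * (scaleTractor g σ x).2.2) ?_
    fun x => scaleNormSq_eq g hd ((hσ x).mdifferentiableAt (by simp))
  exact (contMDiff_mvfderiv_apply hσ (contMDiff_sharp_mvfderiv g hσ)).add
    ((contMDiff_const.mul hσ).mul (contMDiff_scaleTractor_trd g hσ))

end ScaleTractor

/-! ### The degenerate Laplacian and its commutators with `σ` and `log σ` -/

section DegenerateLaplacian

variable {E : Type*} [NormedAddCommGroup E] [NormedSpace ℝ E] [FiniteDimensional ℝ E]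
  {H : Type*} [TopologicalSpace H] {I : ModelWithCorners ℝ E H}
  {M : Type*} [TopologicalSpace M] [ChartedSpace H M] [IsManifold I ∞ M] [T2Space M]
  (g : PseudoMetric I M) {σ : M → ℝ}
  {F : Type*} [NormedAddCommGroup F] [NormedSpace ℝ F]
  {V : M → Type*} [TopologicalSpace (TotalSpace F V)]
  [∀ x, AddCommGroup (V x)] [∀ x, Module ℝ (V x)] [∀ x, TopologicalSpace (V x)]
  [∀ x, IsTopologicalAddGroup (V x)] [∀ x, ContinuousSMul ℝ (V x)]
  [FiberBundle F V] [VectorBundle ℝ F V]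
  {cov : (∀ x, V x) → ∀ x, TangentSpace I x →L[ℝ] V x}

lemma logWeight_apply (w : ℝ) (x : M) (p : V x × V x) :
    logWeight w x p = (w • p.1 + p.2, w • p.2) := rfl

variable (σ cov) in
/-- The derivative of `IdotD` with respect to the weight. -/
def IdotDWeightDeriv (w : ℝ) (s : ∀ x, V x) (x : M) : V x :=
  -((σ x * schoutenTrace g x) • s x) + (2 : ℝ) • cov s x (sharp g x (mvfderiv I σ x))
    + ((scaleTractor g σ x).2.2 * (dimR g - 2 + 4 * w)) • s x

namespace IsSmoothConnection

variable (hcov : IsSmoothConnection F cov) (hd : dimR g ≠ 0) (hσ : CMDiff ∞ σ)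
include hcov hd hσ

/-- The expression is polynomial in `w`; `IdotDWeightDeriv` is its termwise derivative in `w`. -/
lemma IdotD_weight (w : ℝ) {s : ∀ x, V x} {x : M} (hs : MDiffAt (T% s) x) :
    IdotD g σ cov (weight w) s x
      = -(σ x • (laplacian g cov s x + (schoutenTrace g x * w) • s x))
        + (dimR g - 2 + 2 * w) • cov s x (sharp g x (mvfderiv I σ x))
        + ((scaleTractor g σ x).2.2 * (dimR g - 2 + 2 * w) * w) • s x := by
  have h : (fun y => (dimR g - 2) • s y + (2 : ℝ) • weight (V := V) w y (s y))
      = (dimR g - 2 + 2 * w) • s := by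
    ext y
    simp only [weight, LinearMap.smul_apply, LinearMap.id_apply, Pi.smul_apply]
    module
  simp only [IdotD, thomasD]
  rw [h, hcov.const_smul _ hs, scaleTractor_fst g hd,
    scaleTractor_snd g hd ((hσ x).mdifferentiableAt (by simp))]
  simp only [weight, LinearMap.smul_apply, LinearMap.id_apply, smul_apply]
  module

lemma contMDiff_IdotD (w : ℝ) {s : ∀ x, V x} (hs : CMDiff ∞ (T% s)) :
    CMDiff ∞ (T% (IdotD g σ cov (weight w) s)) := by
  have h : IdotD g σ cov (weight w) s
      = -(σ • (laplacian g cov s + (fun x => schoutenTrace g x * w) • s))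
        + (fun _ : M => dimR g - 2 + 2 * w) • (fun x => cov s x (sharp g x (mvfderiv I σ x)))
        + (fun x => (scaleTractor g σ x).2.2 * (dimR g - 2 + 2 * w) * w) • s := by
    ext x
    exact hcov.IdotD_weight g hd hσ w (mdifferentiableAt_of_smooth hs x)
  rw [h]
  have hX := hcov.contMDiff_apply hs (contMDiff_sharp_mvfderiv g hσ)
  exact ((hσ.smul_section ((hcov.contMDiff_laplacian g hs).add_section
    (((contMDiff_schoutenTrace g).mul contMDiff_const).smul_section hs))).neg_section.add_section
    (contMDiff_const.smul_section hX)).add_section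
    ((((contMDiff_scaleTractor_trd g hσ).mul contMDiff_const).mul contMDiff_const).smul_section hs)

omit hd in
lemma contMDiff_IdotDWeightDeriv (w : ℝ) {s : ∀ x, V x} (hs : CMDiff ∞ (T% s)) :
    CMDiff ∞ (T% (IdotDWeightDeriv g σ cov w s)) := by
  have h : IdotDWeightDeriv g σ cov w s
      = -((fun x => σ x * schoutenTrace g x) • s)
        + (fun _ : M => (2 : ℝ)) • (fun x => cov s x (sharp g x (mvfderiv I σ x)))
        + (fun x => (scaleTractor g σ x).2.2 * (dimR g - 2 + 4 * w)) • s := rfl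
  rw [h]
  have hX := hcov.contMDiff_apply hs (contMDiff_sharp_mvfderiv g hσ)
  exact ((((hσ.mul (contMDiff_schoutenTrace g)).smul_section hs).neg_section).add_section
    (contMDiff_const.smul_section hX)).add_section
    (((contMDiff_scaleTractor_trd g hσ).mul contMDiff_const).smul_section hs)

omit hd hσ in
lemma laplacian_const_smul {s : ∀ x, V x} (c : ℝ) (hs : CMDiff ∞ (T% s)) (x : M) :
    laplacian g cov (c • s) x = c • laplacian g cov s x := by
  have hw := fun w : TangentSpace I x => hcov.mdifferentiableAt_apply hs (mdifferentiableAt_ext w)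
  have h : ∀ w : TangentSpace I x, (fun y => cov (c • s) y (ext w y))
      = c • fun y => cov s y (ext w y) := fun w => by
    ext y
    rw [hcov.const_smul c (mdifferentiableAt_of_smooth hs y)]
    rfl
  simp only [laplacian, metricTrace, hessian, h, hcov.const_smul c (hw _),
    hcov.const_smul c (mdifferentiableAt_of_smooth hs x), smul_apply, ← smul_sub,
    ← Finset.smul_sum]

lemma IdotD_add (w : ℝ) {s s' : ∀ x, V x} (hs : CMDiff ∞ (T% s)) (hs' : CMDiff ∞ (T% s')) :
    IdotD g σ cov (weight w) (s + s') = IdotD g σ cov (weight w) s + IdotD g σ cov (weight w) s' := by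
  ext x
  have h := mdifferentiableAt_of_smooth hs x
  have h' := mdifferentiableAt_of_smooth hs' x
  rw [Pi.add_apply, hcov.IdotD_weight g hd hσ w h, hcov.IdotD_weight g hd hσ w h',
    hcov.IdotD_weight g hd hσ w (mdifferentiableAt_add_section h h'), hcov.laplacian_add g hs hs',
    hcov.add h h', add_apply, Pi.add_apply]
  module

lemma IdotD_const_smul (w c : ℝ) {s : ∀ x, V x} (hs : CMDiff ∞ (T% s)) :
    IdotD g σ cov (weight w) (c • s) = c • IdotD g σ cov (weight w) s := by
  ext x
  have h := mdifferentiableAt_of_smooth hs x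
  have hc : CMDiff ∞ (T% (c • s)) := contMDiff_const.smul_section hs
  rw [Pi.smul_apply, hcov.IdotD_weight g hd hσ w h,
    hcov.IdotD_weight g hd hσ w (mdifferentiableAt_of_smooth hc x), hcov.laplacian_const_smul g c hs,
    hcov.const_smul c h, smul_apply, Pi.smul_apply]
  module

omit hd hσ in
lemma IdotDWeightDeriv_add (w : ℝ) {s s' : ∀ x, V x} (hs : CMDiff ∞ (T% s))
    (hs' : CMDiff ∞ (T% s')) :
    IdotDWeightDeriv g σ cov w (s + s') = IdotDWeightDeriv g σ cov w s
      + IdotDWeightDeriv g σ cov w s' := by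
  ext x
  have h := mdifferentiableAt_of_smooth hs x
  have h' := mdifferentiableAt_of_smooth hs' x
  simp only [IdotDWeightDeriv, Pi.add_apply]
  rw [hcov.add h h', add_apply]
  module

omit hd hσ in
lemma IdotDWeightDeriv_const_smul (w c : ℝ) {s : ∀ x, V x} (hs : CMDiff ∞ (T% s)) :
    IdotDWeightDeriv g σ cov w (c • s) = c • IdotDWeightDeriv g σ cov w s := by
  ext x
  simp only [IdotDWeightDeriv, Pi.smul_apply]
  rw [hcov.const_smul c (mdifferentiableAt_of_smooth hs x), smul_apply]
  module

/-- The product rule for the degenerate Laplacian. -/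
lemma IdotD_smul (w : ℝ) {φ : M → ℝ} (hφ : CMDiff ∞ φ) {s : ∀ x, V x} (hs : CMDiff ∞ (T% s))
    (x : M) :
    IdotD g σ cov (weight w) (φ • s) x = φ x • IdotD g σ cov (weight w) s x
      - σ x • ((2 : ℝ) • cov s x (sharp g x (mvfderiv I φ x))
        + laplacian (V := Bundle.Trivial M ℝ) g scalarCov φ x • s x)
      + ((dimR g - 2 + 2 * w) * mvfderiv I φ x (sharp g x (mvfderiv I σ x))) • s x := by
  have h := mdifferentiableAt_of_smooth hs x
  have hφ' : MDiffAt φ x := (hφ x).mdifferentiableAt (by simp)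
  rw [hcov.IdotD_weight g hd hσ w h, hcov.IdotD_weight g hd hσ w (hφ'.smul_section h),
    hcov.laplacian_smul g hφ hs, hcov.leibniz hφ' h, Pi.smul_apply']
  simp only [add_apply, smul_apply, ContinuousLinearMap.smulRight_apply]
  module

/-- The commutator of `I · D` with multiplication by `σ`. -/
lemma IdotD_scale_smul (w : ℝ) {s : ∀ x, V x} (hs : CMDiff ∞ (T% s)) (x : M) :
    IdotD g σ cov (weight (w + 1)) (σ • s) x = σ x • IdotD g σ cov (weight w) s x
      + (scaleNormSq g σ x * (dimR g + 2 * w)) • s x := by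
  have h := mdifferentiableAt_of_smooth hs x
  rw [hcov.IdotD_smul g hd hσ (w + 1) hσ hs, hcov.IdotD_weight g hd hσ (w + 1) h,
    hcov.IdotD_weight g hd hσ w h, scaleNormSq_eq g hd ((hσ x).mdifferentiableAt (by simp))]
  -- Eliminating `Δσ` in favour of the last slot of the scale tractor is what assembles the
  -- remaining terms into `I²`.
  have hρ : (laplacian (V := Bundle.Trivial M ℝ) g scalarCov σ x : ℝ)
      = -(dimR g * (scaleTractor g σ x).2.2) - schoutenTrace g x * σ x := by
    rw [scaleTractor_trd]; field_simp; ring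
  generalize (laplacian (V := Bundle.Trivial M ℝ) g scalarCov σ x : ℝ) = l at *
  subst hρ
  module

/-- This is the weight derivative of `IdotD_scale_smul`: the factor `d + 2w` there becomes `2`. -/
lemma IdotDWeightDeriv_scale_smul (w : ℝ) {s : ∀ x, V x} (hs : CMDiff ∞ (T% s)) (x : M) :
    IdotDWeightDeriv g σ cov (w + 1) (σ • s) x = σ x • IdotDWeightDeriv g σ cov w s x
      + (2 * scaleNormSq g σ x) • s x := by
  have h := mdifferentiableAt_of_smooth hs x
  have hσ' := (hσ x).mdifferentiableAt (n := ∞) (by simp)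
  simp only [IdotDWeightDeriv]
  rw [scaleNormSq_eq g hd hσ', hcov.leibniz hσ' h]
  simp only [add_apply, smul_apply, ContinuousLinearMap.smulRight_apply, Pi.smul_apply']
  module

/-- The commutator of `I · D` with the logarithm of `σ`. -/
lemma IdotD_log_smul (w : ℝ) {L : M → ℝ} (hLs : CMDiff ∞ L) {s : ∀ x, V x} (hs : CMDiff ∞ (T% s))
    {x : M} (hx : 0 < σ x) (hL : L =ᶠ[𝓝 x] fun y => Real.log (σ y)) :
    IdotD g σ cov (weight w) (L • s) x = L x • IdotD g σ cov (weight w) s x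
      - IdotDWeightDeriv g σ cov w s x
      + (scaleNormSq g σ x * (dimR g + 2 * w - 1) * (σ x)⁻¹) • s x := by
  have h := mdifferentiableAt_of_smooth hs x
  rw [hcov.IdotD_smul g hd hσ w hLs hs, scaleNormSq_eq g hd ((hσ x).mdifferentiableAt (by simp))]
  -- Multiplied by `-σ`, the term `-|dσ|²/σ²` in `Δ log σ` contributes `|dσ|²/σ`, which completes
  -- the `1/σ` term to a multiple of `I²`.
  have hρ : (laplacian (V := Bundle.Trivial M ℝ) g scalarCov L x : ℝ)
      = (σ x)⁻¹ * (-(dimR g * (scaleTractor g σ x).2.2) - schoutenTrace g x * σ x)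
       - ((σ x)⁻¹) ^ 2 * mvfderiv I σ x (sharp g x (mvfderiv I σ x)) := by
    rw [laplacian_log g hσ hLs hx hL, scaleTractor_trd]; field_simp; ring
  generalize (laplacian (V := Bundle.Trivial M ℝ) g scalarCov L x : ℝ) = l at *
  subst hρ
  rw [mvfderiv_log hσ hx hL, IdotDWeightDeriv]
  simp only [map_smul, smul_apply, smul_eq_mul]
  match_scalars <;> field_simp <;> ring

/-- The degenerate Laplacian on sections with log terms. -/
lemma IdotD_logWeight (w : ℝ) {s : ∀ x, V x × V x} (h1 : CMDiff ∞ (T% fun x => (s x).1))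
    (h2 : CMDiff ∞ (T% fun x => (s x).2)) (x : M) :
    IdotD g σ (logCov cov) (logWeight w) s x
      = (IdotD g σ cov (weight w) (fun y => (s y).1) x
          + IdotDWeightDeriv g σ cov w (fun y => (s y).2) x,
        IdotD g σ cov (weight w) (fun y => (s y).2) x) := by
  have d1 := mdifferentiableAt_of_smooth h1 x
  have d2 := mdifferentiableAt_of_smooth h2 x
  have hl : laplacian g (logCov cov) s x
      = (laplacian g cov (fun y => (s y).1) x, laplacian g cov (fun y => (s y).2) x) := by
    simp only [laplacian, metricTrace]
    refine Prod.ext ?_ ?_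
    · rw [Prod.fst_sum]; rfl
    · rw [Prod.snd_sum]; rfl
  have hc : logCov cov (fun y => (dimR g - 2) • s y + (2 : ℝ) • logWeight (V := V) w y (s y)) x
      = ((dimR g - 2 + 2 * w) • cov (fun y => (s y).1) x + (2 : ℝ) • cov (fun y => (s y).2) x).prod
        ((dimR g - 2 + 2 * w) • cov (fun y => (s y).2) x) := by
    have e1 : (fun y => ((dimR g - 2) • s y + (2 : ℝ) • logWeight (V := V) w y (s y)).1)
        = (dimR g - 2 + 2 * w) • (fun y => (s y).1) + (2 : ℝ) • fun y => (s y).2 := by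
      ext y
      simp only [logWeight_apply, Prod.fst_add, Prod.smul_fst, Pi.add_apply, Pi.smul_apply]
      module
    have e2 : (fun y => ((dimR g - 2) • s y + (2 : ℝ) • logWeight (V := V) w y (s y)).2)
        = (dimR g - 2 + 2 * w) • (fun y => (s y).2) := by
      ext y
      simp only [logWeight_apply, Prod.snd_add, Prod.smul_snd, Pi.smul_apply]
      module
    simp only [logCov]
    have c1 : MDiffAt (T% ((dimR g - 2 + 2 * w) • fun y => (s y).1)) x :=
      MDifferentiableAt.smul_section (f := fun _ => dimR g - 2 + 2 * w) mdifferentiableAt_const d1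
    have c2 : MDiffAt (T% ((2 : ℝ) • fun y => (s y).2)) x :=
      MDifferentiableAt.smul_section (f := fun _ => (2 : ℝ)) mdifferentiableAt_const d2
    rw [e1, e2, hcov.add c1 c2, hcov.const_smul _ d1, hcov.const_smul _ d2,
      hcov.const_smul _ d2]
  rw [hcov.IdotD_weight g hd hσ w d1, hcov.IdotD_weight g hd hσ w d2]
  simp only [IdotD, thomasD, IdotDWeightDeriv]
  rw [hl, hc, scaleTractor_fst g hd, scaleTractor_snd g hd ((hσ x).mdifferentiableAt (by simp))]
  simp only [logWeight_apply, ContinuousLinearMap.prod_apply, add_apply, smul_apply,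
    Prod.fst_add, Prod.snd_add, Prod.smul_fst, Prod.smul_snd, Prod.smul_mk, Prod.mk_add_mk,
    Prod.neg_mk]
  refine Prod.ext ?_ ?_
  · dsimp only
    module
  · dsimp only
    module

end IsSmoothConnection

end DegenerateLaplacian

/-! ### The formal solution as pure algebra of `x`, `y` and the weight -/

section SolutionAlgebra

variable {A : Type*} [AddCommGroup A] [Module ℝ A]

/-- Multiplication by `x` and the operators `y` in each weight, with the commutator
`[y, x] = -(d + 2w) - 2ε`, where `ε` is the nilpotent part of the weight operator. -/
structure ScaleAlgebra (d : ℝ) (X ε : A →ₗ[ℝ] A) (Y : ℝ → A →ₗ[ℝ] A) : Prop where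
  comm : ∀ w a, Y (w + 1) (X a) = X (Y w a) - (d + 2 * w) • a - (2 : ℝ) • ε a
  nil_X : ∀ a, ε (X a) = X (ε a)
  nil_Y : ∀ w a, ε (Y w a) = Y w (ε a)

/-- The iterates of `y`, each factor lowering the weight by one. -/
def iterY (Y : ℝ → A →ₗ[ℝ] A) (w : ℝ) : ℕ → A →ₗ[ℝ] A
  | 0 => LinearMap.id
  | k + 1 => Y (w - k) ∘ₗ iterY Y w k

lemma iterY_zero (Y : ℝ → A →ₗ[ℝ] A) (w : ℝ) (a : A) : iterY Y w 0 a = a := rfl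

lemma iterY_succ (Y : ℝ → A →ₗ[ℝ] A) (w : ℝ) (k : ℕ) (a : A) :
    iterY Y w (k + 1) a = Y (w - k) (iterY Y w k a) := rfl

lemma iterY_add (Y : ℝ → A →ₗ[ℝ] A) (w : ℝ) (m j : ℕ) (a : A) :
    iterY Y (w - m) j (iterY Y w m a) = iterY Y w (m + j) a := by
  induction j with
  | zero => rfl
  | succ j ih =>
    rw [iterY_succ, ih, ← add_assoc, iterY_succ]
    congr 2
    push_cast; ring

namespace ScaleAlgebra

variable {d : ℝ} {X ε : A →ₗ[ℝ] A} {Y : ℝ → A →ₗ[ℝ] A} (hA : ScaleAlgebra d X ε Y)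
include hA

lemma nil_pow_X (k : ℕ) (a : A) : ε ((X ^ k) a) = (X ^ k) (ε a) := by
  induction k with
  | zero => rfl
  | succ k ih => rw [pow_succ', Module.End.mul_apply, hA.nil_X, ih, Module.End.mul_apply]

lemma nil_iterY (w : ℝ) (k : ℕ) (a : A) : ε (iterY Y w k a) = iterY Y w k (ε a) := by
  induction k with
  | zero => rfl
  | succ k ih => rw [iterY_succ, hA.nil_Y, ih, iterY_succ]

/-- Moving `y` past `k + 1` factors `x` adds up an arithmetic progression of weights: the sum of `d
+ 2(w - 1 - i)` over `i ≤ k`. -/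
lemma Y_pow_X (w : ℝ) (k : ℕ) (a : A) :
    Y w ((X ^ (k + 1)) a) = (X ^ (k + 1)) (Y (w - (k + 1)) a)
      - ((k + 1) * (d + 2 * w - k - 2)) • (X ^ k) a - (2 * ((k : ℝ) + 1)) • (X ^ k) (ε a) := by
  have h (w : ℝ) (a : A) : Y w (X a) = X (Y (w - 1) a) - (d + 2 * (w - 1)) • a - (2 : ℝ) • ε a := by
    have := hA.comm (w - 1) a
    rwa [sub_add_cancel] at this
  induction k generalizing w with
  | zero =>
    simp only [zero_add, pow_one, pow_zero, Module.End.one_apply, Nat.cast_zero]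
    rw [h]
    module
  | succ k ih =>
    rw [pow_succ' X (k + 1), Module.End.mul_apply, h, ih (w - 1), hA.nil_pow_X,
      Module.End.mul_apply]
    simp only [map_sub, map_smul]
    rw [← Module.End.mul_apply X (X ^ k), ← Module.End.mul_apply X (X ^ k), ← pow_succ',
      show w - 1 - ((k : ℝ) + 1) = w - (((k + 1 : ℕ) : ℝ) + 1) by push_cast; ring]
    push_cast
    module

/-- Here the progression is `d + 2(w - i)`, `i ≤ k`. Its sum vanishes for `d + 2w = k`, so at that
weight `y^(k+1)` commutes with `x` up to `ε`. -/
lemma iterY_X (w : ℝ) (k : ℕ) (a : A) :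
    iterY Y (w + 1) (k + 1) (X a) = X (iterY Y w (k + 1) a)
      - ((k + 1) * (d + 2 * w - k)) • iterY Y w k a
      - (2 * ((k : ℝ) + 1)) • iterY Y w k (ε a) := by
  induction k with
  | zero =>
    simp only [iterY_succ, iterY_zero, Nat.cast_zero, sub_zero]
    rw [hA.comm]
    module
  | succ k ih =>
    rw [iterY_succ, ih, map_sub, map_sub, map_smul, map_smul,
      show w + 1 - ((k + 1 : ℕ) : ℝ) = w - k by push_cast; ring, ← iterY_succ, ← iterY_succ,
      show w - (k : ℝ) = (w - ((k + 1 : ℕ) : ℝ)) + 1 by push_cast; ring, hA.comm, hA.nil_iterY,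
      ← iterY_succ]
    push_cast
    module

end ScaleAlgebra

/-- The operator `y` on pairs, where `N` is the derivative of `y` in the weight. -/
def pairY (Y N : ℝ → A →ₗ[ℝ] A) (w : ℝ) : A × A →ₗ[ℝ] A × A :=
  (Y w ∘ₗ LinearMap.fst ℝ A A + N w ∘ₗ LinearMap.snd ℝ A A).prod (Y w ∘ₗ LinearMap.snd ℝ A A)

lemma pairY_apply (Y N : ℝ → A →ₗ[ℝ] A) (w : ℝ) (p : A × A) :
    pairY Y N w p = (Y w p.1 + N w p.2, Y w p.2) := rfl

variable (A) in
/-- The nilpotent part of the weight operator on pairs. -/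
def pairNil : A × A →ₗ[ℝ] A × A := (LinearMap.snd ℝ A A).prod 0

lemma pairNil_apply (p : A × A) : pairNil A p = (p.2, 0) := rfl

/-- On pairs the weight is `w + ε` with `ε² = 0`, so `Y(w + ε) = Y w + ε N w`. The hypothesis `hN`
is the derivative of the commutation relation in `w`. -/
lemma ScaleAlgebra.pair {d : ℝ} {X : A →ₗ[ℝ] A} {Y N : ℝ → A →ₗ[ℝ] A}
    (hA : ScaleAlgebra d X 0 Y) (hN : ∀ w a, N (w + 1) (X a) = X (N w a) - (2 : ℝ) • a) :
    ScaleAlgebra d (X.prodMap X) (pairNil A) (pairY Y N) where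
  comm w p := by
    have h := hA.comm
    simp only [LinearMap.zero_apply, smul_zero, sub_zero] at h
    refine Prod.ext ?_ ?_
    · simp only [pairY_apply, LinearMap.prodMap_apply, pairNil_apply, Prod.fst_sub, Prod.smul_fst,
        map_add, h, hN]
      module
    · simp only [pairY_apply, LinearMap.prodMap_apply, pairNil_apply, Prod.snd_sub, Prod.smul_snd,
        h]
      module
  nil_X p := by simp [pairNil_apply]
  nil_Y w p := by simp [pairNil_apply, pairY_apply]

lemma iterY_pair_snd (Y N : ℝ → A →ₗ[ℝ] A) (w : ℝ) (k : ℕ) (p : A × A) :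
    (iterY (pairY Y N) w k p).2 = iterY Y w k p.2 := by
  induction k with
  | zero => rfl
  | succ k ih => rw [iterY_succ, pairY_apply, iterY_succ, ih]

lemma iterY_pair_inl (Y N : ℝ → A →ₗ[ℝ] A) (w : ℝ) (k : ℕ) (a : A) :
    iterY (pairY Y N) w k (a, 0) = (iterY Y w k a, 0) := by
  induction k with
  | zero => rfl
  | succ k ih => rw [iterY_succ, ih, pairY_apply, iterY_succ]; simp

lemma prodMap_pow_apply (X : A →ₗ[ℝ] A) (k : ℕ) (p : A × A) :
    ((X.prodMap X) ^ k) p = ((X ^ k) p.1, (X ^ k) p.2) := by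
  induction k with
  | zero => rfl
  | succ k ih => rw [pow_succ', Module.End.mul_apply, ih, pow_succ', Module.End.mul_apply,
      Module.End.mul_apply]; rfl

/-- The coefficient conditions for a formal solution with logarithms starting at order `m`. -/
structure LogRecurrence (m : ℕ) (P Q L : ℕ → ℝ) : Prop where
  below : ∀ k, k < m → L k = 0
  above : ∀ j, L (m + j) = -Q j
  log_step : ∀ k : ℕ, ((k : ℝ) + 1) * (m - (k + 1)) * L (k + 1) = L k
  reg_step : ∀ k : ℕ, ((k : ℝ) + 1) * (m - (k + 1)) * P (k + 1) + (m - 2 * (k + 1)) * L (k + 1) = P k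

/-- The logarithmic coefficients of a formal solution. -/
def logCoeff (Y : ℝ → A →ₗ[ℝ] A) (w : ℝ) (L : ℕ → ℝ) (f : A) (k : ℕ) : A := L k • iterY Y w k f

/-- The regular coefficients of a formal solution. -/
def regCoeff (Y N : ℝ → A →ₗ[ℝ] A) (w : ℝ) (m : ℕ) (P Q : ℕ → ℝ) (f : A) (W : A × A) (k : ℕ) :
    A × A :=
  (P k • iterY Y w k f, 0)
    + if m ≤ k then Q (k - m) • iterY (pairY Y N) (w - m) (k - m) W else 0

section

variable {d : ℝ} {X : A →ₗ[ℝ] A} {Y N : ℝ → A →ₗ[ℝ] A} {m : ℕ} {P Q L : ℕ → ℝ}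

lemma regCoeff_lt {w : ℝ} {f : A} {W : A × A} {k : ℕ} (hk : k < m) :
    regCoeff Y N w m P Q f W k = (P k • iterY Y w k f, 0) := by
  rw [regCoeff, if_neg (by omega), add_zero]

lemma regCoeff_add {w : ℝ} {f : A} {W : A × A} (j : ℕ) :
    regCoeff Y N w m P Q f W (m + j)
      = (P (m + j) • iterY Y w (m + j) f, 0) + Q j • iterY (pairY Y N) (w - m) j W := by
  rw [regCoeff, if_pos (by omega), Nat.add_sub_cancel_left]

namespace LogRecurrence

variable (hR : LogRecurrence m P Q L)
include hR

/-- The opposite signs make the logarithms occur only as `log x` minus a log density. -/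
lemma regCoeff_snd {w : ℝ} {f : A} {W : A × A} (hW : W.2 = iterY Y w m f) (k : ℕ) :
    (regCoeff Y N w m P Q f W k).2 = -logCoeff Y w L f k := by
  rcases lt_or_ge k m with hk | hk
  · simp [regCoeff_lt hk, logCoeff, hR.below k hk]
  · obtain ⟨j, rfl⟩ := Nat.exists_eq_add_of_le hk
    rw [regCoeff_add, Prod.snd_add, Prod.smul_snd, iterY_pair_snd, hW, iterY_add, logCoeff,
      hR.above]
    simp

lemma Y_logCoeff {w : ℝ} (f : A) (k : ℕ) :
    Y (w - k) (logCoeff Y w L f k)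
      = (((k : ℝ) + 1) * (m - (k + 1))) • logCoeff Y w L f (k + 1) := by
  rw [logCoeff, logCoeff, smul_smul, hR.log_step, map_smul, iterY_succ]

/-- With `n = k + 1`, the two factors on the right are `p(n)` and `p'(n)` for the indicial
polynomial `p(n) = n(m - n)`. -/
lemma pairY_regCoeff {w : ℝ} (f : A) (W : A × A) (k : ℕ) :
    pairY Y N (w - k) (regCoeff Y N w m P Q f W k)
      = (((k : ℝ) + 1) * (m - (k + 1))) • regCoeff Y N w m P Q f W (k + 1)
        + ((m : ℝ) - 2 * (k + 1)) • (logCoeff Y w L f (k + 1), 0) := by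
  have hP := hR.reg_step k
  have hy : ∀ c : ℝ, pairY Y N (w - k) (c • iterY Y w k f, 0) = (c • iterY Y w (k + 1) f, 0) := by
    intro c
    rw [pairY_apply, iterY_succ]
    simp
  have hcoef : (P k • iterY Y w (k + 1) f, (0 : A))
      = (((k : ℝ) + 1) * (m - (k + 1))) • (P (k + 1) • iterY Y w (k + 1) f, (0 : A))
        + ((m : ℝ) - 2 * (k + 1)) • (logCoeff Y w L f (k + 1), 0) := by
    rw [← hP, logCoeff]
    refine Prod.ext ?_ ?_
    · simp only [Prod.fst_add, Prod.smul_fst]; module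
    · simp
  rcases lt_trichotomy (k + 1) m with hk | hk | hk
  · rw [regCoeff_lt (by omega : k < m), regCoeff_lt hk, hy, hcoef]
  -- At the critical order `p(m) = 0`, so the datum `W`, which first occurs there, drops out.
  · have hz : ((k : ℝ) + 1) * (m - (k + 1)) = 0 := by rw [← hk]; push_cast; ring
    rw [regCoeff_lt (by omega : k < m), hy, hcoef, hz, zero_smul, zero_smul]
  · obtain ⟨j, rfl⟩ := Nat.exists_eq_add_of_le (by omega : m ≤ k)
    have hQ : (((m + j : ℕ) : ℝ) + 1) * (m - ((m + j : ℕ) + 1)) * Q (j + 1) = Q j := by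
      have := hR.log_step (m + j)
      rw [add_assoc m j 1, hR.above, hR.above] at this
      linarith
    have e := regCoeff_add (Y := Y) (N := N) (m := m) (P := P) (Q := Q) (w := w) (f := f)
      (W := W) (j + 1)
    rw [← add_assoc] at e
    rw [regCoeff_add, map_add, hy, hcoef, e, map_smul, smul_add, smul_smul _ (Q (j + 1)), hQ,
      iterY_succ]
    rw [show w - ((m + j : ℕ) : ℝ) = w - m - j by push_cast; ring]
    abel

/-- The operator `y` on the truncated regular part. -/
lemma sum_pairY_regCoeff (hA : ScaleAlgebra d X 0 Y)
    (hN : ∀ w a, N (w + 1) (X a) = X (N w a) - (2 : ℝ) • a) {w : ℝ} (hw : d + 2 * w = m + 1)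
    {f : A} {W : A × A} (hW : W.2 = iterY Y w m f) (n : ℕ) :
    ∑ k ∈ Finset.range (n + 1), pairY Y N w (((X.prodMap X) ^ k) (regCoeff Y N w m P Q f W k))
      = ((X.prodMap X) ^ n) (pairY Y N (w - n) (regCoeff Y N w m P Q f W n))
        + (m : ℝ) • ∑ k ∈ Finset.range n, ((X ^ k) (logCoeff Y w L f (k + 1)), (0 : A)) := by
  induction n with
  | zero => simp
  | succ n ih =>
    have hε : pairNil A (regCoeff Y N w m P Q f W (n + 1)) = -(logCoeff Y w L f (n + 1), 0) := by
      rw [pairNil_apply, hR.regCoeff_snd hW]; simp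
    have hX : ((X.prodMap X) ^ n) (logCoeff Y w L f (n + 1), (0 : A))
        = ((X ^ n) (logCoeff Y w L f (n + 1)), 0) := by
      rw [prodMap_pow_apply]; simp
    -- The `p(n+1)` terms cancel. The factor `m - 2(n+1)` and the nilpotent term `2(n+1)` add up to
    -- `m`, the same at every order.
    rw [Finset.sum_range_succ, ih, hR.pairY_regCoeff, (hA.pair hN).Y_pow_X, hε,
      Finset.sum_range_succ, map_add, map_smul, map_smul, map_neg, hX, hw]
    push_cast
    module

/-- The value of `y` on each coefficient is cancelled by the commutator term of the next order, so
only the top order survives. -/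
lemma sum_Y_logCoeff (hA : ScaleAlgebra d X 0 Y) {w : ℝ} (hw : d + 2 * w = m + 1) (f : A) (n : ℕ) :
    ∑ k ∈ Finset.range (n + 1), Y w ((X ^ k) (logCoeff Y w L f k))
      = (X ^ n) (Y (w - n) (logCoeff Y w L f n)) := by
  induction n with
  | zero => simp
  | succ n ih =>
    rw [Finset.sum_range_succ, ih, hR.Y_logCoeff, hA.Y_pow_X, map_smul, hw]
    simp only [LinearMap.zero_apply, map_zero, smul_zero, sub_zero]
    push_cast
    module

lemma logCoeff_X (hA : ScaleAlgebra d X 0 Y) {w : ℝ} (hw : d + 2 * w = m - 1) (a : A) (k : ℕ) :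
    logCoeff Y (w + 1) L (X a) (k + 1)
      = X (logCoeff Y w L a (k + 1)) - logCoeff Y w L a k := by
  rw [logCoeff, logCoeff, logCoeff, hA.iterY_X, hw, map_smul, ← hR.log_step k]
  simp only [LinearMap.zero_apply, map_zero, smul_zero, sub_zero]
  module

/-- Multiplying the leading datum by `x` leads to a telescoping formal series. -/
lemma regCoeff_X (hA : ScaleAlgebra d X 0 Y)
    (hN : ∀ w a, N (w + 1) (X a) = X (N w a) - (2 : ℝ) • a) {w : ℝ} (hw : d + 2 * w = m - 1)
    {a : A} {W : A × A} (hW : W.2 = iterY Y w m a) (k : ℕ) :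
    regCoeff Y N (w + 1) m P Q (X a)
        (X.prodMap X W - (m : ℝ) • (iterY Y w (m - 1) a, 0)) (k + 1)
      = X.prodMap X (regCoeff Y N w m P Q a W (k + 1)) - regCoeff Y N w m P Q a W k := by
  have hP := hR.reg_step k
  have h1 : iterY Y (w + 1) (k + 1) (X a) = X (iterY Y w (k + 1) a)
      - (((k : ℝ) + 1) * (m - (k + 1))) • iterY Y w k a := by
    rw [hA.iterY_X, hw]
    simp only [LinearMap.zero_apply, map_zero, smul_zero, sub_zero]
    module
  have hL := hR.above
  have hbelow := hR.below (k + 1)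
  rcases lt_trichotomy (k + 1) m with hk | hk | hk
  · rw [regCoeff_lt (by omega : k < m), regCoeff_lt hk, regCoeff_lt hk, h1, ← hP, hbelow hk]
    refine Prod.ext ?_ ?_
    · simp only [LinearMap.prodMap_apply, Prod.fst_sub, map_smul]; module
    · simp
  -- At this order `reg_step` reads `P (m - 1) = m * Q 0`, so the correction `-m y^(m-1) a` in the
  -- datum yields exactly the subtracted coefficient of order `m - 1`.
  · subst hk
    have h0 := regCoeff_add (Y := Y) (N := N) (m := k + 1) (P := P) (Q := Q) (w := w + 1) (f := X a)
      (W := X.prodMap X W - ((k + 1 : ℕ) : ℝ) • (iterY Y w (k + 1 - 1) a, 0)) 0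
    have h0' := regCoeff_add (Y := Y) (N := N) (m := k + 1) (P := P) (Q := Q) (w := w) (f := a)
      (W := W) 0
    simp only [add_zero] at h0 h0'
    rw [h0, h0', regCoeff_lt (by omega : k < k + 1), h1, ← hP, hL 0, iterY_zero, iterY_zero]
    refine Prod.ext ?_ ?_
    · simp only [LinearMap.prodMap_apply, Prod.fst_sub, Prod.fst_add, Prod.smul_fst, map_smul,
        map_add, Nat.add_sub_cancel]
      push_cast
      module
    · simp
  · obtain ⟨j, rfl⟩ := Nat.exists_eq_add_of_le (by omega : m ≤ k)
    have hQ : (((m + j : ℕ) : ℝ) + 1) * (m - ((m + j : ℕ) + 1)) * Q (j + 1) = Q j := by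
      have := hR.log_step (m + j)
      rw [add_assoc m j 1, hR.above, hR.above] at this
      linarith
    have hy := (hA.pair hN).iterY_X (w - m) j W
    have hs : ∀ j, iterY (pairY Y N) (w + 1 - m) j ((m : ℝ) • (iterY Y w (m - 1) a, 0))
        = (m : ℝ) • (iterY Y w (m - 1 + j) a, 0) := by
      intro j
      rw [map_smul, iterY_pair_inl]
      -- For `m = 0` the truncated subtraction `m - 1` is harmless, since the term carries the
      -- factor `m`.
      rcases Nat.eq_zero_or_pos m with rfl | hm
      · simp
      · rw [show w + 1 - (m : ℝ) = w - ((m - 1 : ℕ) : ℝ) by rw [Nat.cast_sub hm]; push_cast; ring,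
          iterY_add]
    have hm : (m : ℝ) • (iterY Y w (m - 1 + (j + 1)) a, (0 : A))
        = (m : ℝ) • (iterY Y w (m + j) a, (0 : A)) := by
      rcases Nat.eq_zero_or_pos m with rfl | hm
      · simp
      · rw [show m - 1 + (j + 1) = m + j by omega]
    rw [add_assoc m j 1] at *
    rw [regCoeff_add, regCoeff_add, regCoeff_add, h1, map_sub, hs, hm,
      show w + 1 - (m : ℝ) = w - m + 1 by ring, hy, pairNil_apply, hW, iterY_pair_inl, iterY_add,
      ← hP, ← hQ, hL]
    have hw' : d = m - 1 - 2 * w := by linarith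
    subst hw'
    refine Prod.ext ?_ ?_
    · simp only [LinearMap.prodMap_apply, Prod.fst_sub, Prod.fst_add, Prod.smul_fst, map_smul,
        map_add]
      push_cast
      module
    · simp only [LinearMap.prodMap_apply, Prod.snd_sub, Prod.snd_add, Prod.smul_snd, map_smul,
        map_add, map_zero, smul_zero]
      push_cast
      module

/-- Changing the auxiliary scale leads to a telescoping formal series. -/
lemma iterY_scale_change (hA : ScaleAlgebra d X 0 Y) {w : ℝ} (hw : d + 2 * w = m + 1) (v : A)
    (j : ℕ) :
    Q (j + 1) • iterY Y (w - m) (j + 1) (X v)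
      = X (Q (j + 1) • iterY Y (w - m - 1) (j + 1) v) - Q j • iterY Y (w - m - 1) j v := by
  have hQ : (((m + j : ℕ) : ℝ) + 1) * (m - ((m + j : ℕ) + 1)) * Q (j + 1) = Q j := by
    have := hR.log_step (m + j)
    rw [add_assoc m j 1, hR.above, hR.above] at this
    linarith
  rw [show w - (m : ℝ) = w - m - 1 + 1 by ring, hA.iterY_X, ← hQ, map_smul, add_sub_cancel_right]
  have hw' : d = m + 1 - 2 * w := by linarith
  subst hw'
  simp only [LinearMap.zero_apply, map_zero, smul_zero, sub_zero]
  push_cast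
  module

end LogRecurrence

/-- The Weyl average, where `T` is multiplication by a logarithm. -/
def algWeyl (Y N : ℝ → A →ₗ[ℝ] A) (T : A →ₗ[ℝ] A) (w : ℝ) (m : ℕ) (f : A) : A × A :=
  (1 / 2 : ℝ) • ((T (iterY Y w m f), iterY Y w m f) + iterY (pairY Y N) w m (T f, f))

lemma algWeyl_snd (T : A →ₗ[ℝ] A) (w : ℝ) (m : ℕ) (f : A) :
    (algWeyl Y N T w m f).2 = iterY Y w m f := by
  simp only [algWeyl, Prod.smul_snd, Prod.snd_add, iterY_pair_snd]
  module

/-- At this weight `y^m` commutes with `x` on densities; on log densities there is a defect `-2m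
y^(m-1)`. Averaging the two orderings leaves half of it, the amount required by
`LogRecurrence.regCoeff_X`. -/
lemma algWeyl_X (hA : ScaleAlgebra d X 0 Y)
    (hN : ∀ w a, N (w + 1) (X a) = X (N w a) - (2 : ℝ) • a) {T : A →ₗ[ℝ] A}
    (hT : ∀ a, T (X a) = X (T a)) {w : ℝ} (hw : d + 2 * w = m - 1) (a : A) :
    algWeyl Y N T (w + 1) m (X a)
      = X.prodMap X (algWeyl Y N T w m a) - (m : ℝ) • (iterY Y w (m - 1) a, 0) := by
  cases m with
  | zero =>
    refine Prod.ext ?_ ?_ <;> simp [algWeyl, iterY_zero, hT]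
  | succ k =>
    have h1 : iterY Y (w + 1) (k + 1) (X a) = X (iterY Y w (k + 1) a) := by
      rw [hA.iterY_X, hw]
      push_cast
      simp
    have h2 := (hA.pair hN).iterY_X w k (T a, a)
    rw [hw, pairNil_apply, iterY_pair_inl] at h2
    have h3 : (T (X a), X a) = X.prodMap X (T a, a) := by rw [hT]; rfl
    simp only [algWeyl]
    rw [h1, h3, h2, Nat.add_sub_cancel, hT]
    refine Prod.ext ?_ ?_
    · simp only [LinearMap.prodMap_apply, Prod.fst_sub, Prod.fst_add, Prod.smul_fst, map_smul,
        map_add]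
      push_cast
      module
    · simp only [LinearMap.prodMap_apply, Prod.snd_sub, Prod.snd_add, Prod.smul_snd, map_smul,
        map_add, smul_zero, sub_zero]
      push_cast
      module

end

end SolutionAlgebra

/-! ### The given power series satisfy the recurrences -/

section Recurrences

/-- The coefficients of `K^{1-m}`. -/
def kernelCoeff (m j : ℕ) : ℝ :=
  (-1) ^ j * (m.factorial : ℝ) / ((j.factorial : ℝ) * ((m + j).factorial : ℝ))

lemma kernelCoeff_zero (m : ℕ) : kernelCoeff m 0 = 1 := by
  have : (m.factorial : ℝ) ≠ 0 := by exact_mod_cast m.factorial_ne_zero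
  simp [kernelCoeff, this]

lemma kernelCoeff_succ (m j : ℕ) :
    ((j : ℝ) + 1) * (m + j + 1) * kernelCoeff m (j + 1) = -kernelCoeff m j := by
  have h1 := j.factorial_ne_zero
  have h2 := (m + j).factorial_ne_zero
  have h3 : ((m + j : ℝ) + 1) ≠ 0 := by positivity
  rw [kernelCoeff, kernelCoeff, ← add_assoc, Nat.factorial_succ, Nat.factorial_succ]
  push_cast
  field_simp
  ring

lemma descPochhammer_eval_add (m j : ℕ) :
    (m.factorial : ℝ) * (descPochhammer ℝ j).eval ((m : ℝ) + j) = (m + j).factorial := by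
  have h := Nat.factorial_mul_descFactorial (Nat.le_add_left j m)
  rw [Nat.add_sub_cancel] at h
  rw [show (m : ℝ) + j = ((m + j : ℕ) : ℝ) by push_cast; ring,
    descPochhammer_eval_eq_descFactorial, ← h]
  push_cast
  ring

lemma coeff_seriesK (m j : ℕ) :
    PowerSeries.coeff j (seriesK (1 - (m : ℝ))) = kernelCoeff m j := by
  have h := descPochhammer_eval_add m j
  have h1 := j.factorial_ne_zero
  have h2 := m.factorial_ne_zero
  have h3 : (descPochhammer ℝ j).eval ((m : ℝ) + j) ≠ 0 := by
    intro h0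
    rw [h0, mul_zero] at h
    exact (m + j).factorial_ne_zero (by exact_mod_cast h.symm)
  rw [seriesK, PowerSeries.coeff_mk, kernelCoeff, ← h,
    show (j : ℝ) + 1 - (1 - m) = m + j by ring]
  field_simp

lemma coeff_seriesJ0 (j : ℕ) : PowerSeries.coeff j seriesJ0 = kernelCoeff 0 j := by
  rw [seriesJ0, PowerSeries.coeff_mk, kernelCoeff, zero_add, Nat.factorial_zero]
  ring_nf

/-- This is `reg_step` at order `m + 1`, where the coefficient of order `m` is zero; it fixes `γ₀`.
-/
lemma gammaH_zero (m : ℕ) : ((m : ℝ) + 1) * gammaH (m + 1) 0 = -((m + 2) * kernelCoeff m 1) := by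
  have h := kernelCoeff_succ m 0
  rw [kernelCoeff_zero] at h
  have hm : (m : ℝ) + 1 ≠ 0 := by positivity
  have h' : kernelCoeff m 1 = -(1 / ((m : ℝ) + 1)) := by
    field_simp
    push_cast at h
    linarith
  rw [h', gammaH]
  push_cast
  field_simp
  ring

/-- With `n = m + j + 2` one has `p(n) = -(j + 2)(m + j + 2)` and `p'(n) = -(m + 2j + 4)`, so the
recursion for `γ` is `reg_step` above the critical order. -/
lemma gammaH_succ (m j : ℕ) :
    ((j : ℝ) + 2) * (m + j + 2) * gammaH (m + 1) (j + 1)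
      = -gammaH (m + 1) j - (m + 2 * j + 4) * kernelCoeff m (j + 2) := by
  have h := coeff_seriesK m (j + 2)
  rw [seriesK, PowerSeries.coeff_mk,
    show ((j + 2 : ℕ) : ℝ) + 1 - (1 - m) = ((m + 1 : ℕ) : ℝ) + j + 1 by push_cast; ring] at h
  have h1 : (j : ℝ) + 2 ≠ 0 := by positivity
  have h2 : (m : ℝ) + 1 + j + 1 ≠ 0 := by positivity
  rw [← h, gammaH]
  simp only [div_eq_mul_inv]
  generalize (((j + 2).factorial : ℝ) * Polynomial.eval _ _)⁻¹ = q
  push_cast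
  field_simp
  ring

/-- The logarithmic coefficients with leading constant `-c`. -/
def logSeq (m : ℕ) (c : ℝ) (k : ℕ) : ℝ := if m ≤ k then -(c * kernelCoeff m (k - m)) else 0

/-- The recursion splits at the critical order: below it there is no logarithm; `hcrit` is forced by
the leading log coefficient `-c`; `P m` is free because `p(m) = 0` and is set to `0`; above it `γ`
takes over. -/
lemma logRecurrence_of_gamma {m : ℕ} {c : ℝ} {P : ℕ → ℝ}
    (hlow : ∀ k, k + 1 < m → ((k : ℝ) + 1) * (m - (k + 1)) * P (k + 1) = P k)
    (hcrit : ∀ k, k + 1 = m → P k = m * c) (hm : P m = 0)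
    (hhigh : ∀ j, P (m + 1 + j) = -(c * gammaH (m + 1) j)) :
    LogRecurrence m P (fun j => c * kernelCoeff m j) (logSeq m c) := by
  have hbelow : ∀ k, k < m → logSeq m c k = 0 := fun k hk => by
    rw [logSeq, if_neg (by omega)]
  have habove : ∀ j, logSeq m c (m + j) = -(c * kernelCoeff m j) := fun j => by
    rw [logSeq, if_pos (by omega), Nat.add_sub_cancel_left]
  refine ⟨hbelow, habove, fun k => ?_, fun k => ?_⟩
  · rcases lt_trichotomy (k + 1) m with hk | hk | hk
    · rw [hbelow _ hk, hbelow _ (by omega), mul_zero]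
    · rw [hbelow k (by omega), ← hk]
      push_cast
      ring
    · obtain ⟨j, rfl⟩ := Nat.exists_eq_add_of_le (by omega : m ≤ k)
      have h := kernelCoeff_succ m j
      rw [add_assoc m j 1, habove, habove]
      push_cast
      linear_combination c * h
  · rcases lt_trichotomy (k + 1) m with hk | hk | hk
    · rw [hbelow _ hk, ← hlow k hk]
      ring
    · have h := habove 0
      rw [add_zero, kernelCoeff_zero] at h
      rw [hcrit k hk, hk, h, ← hk]
      push_cast
      ring
    · obtain ⟨j, rfl⟩ := Nat.exists_eq_add_of_le (by omega : m ≤ k)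
      rw [add_assoc m j 1, habove]
      cases j with
      | zero =>
        have h := gammaH_zero m
        have h1 := hhigh 0
        rw [add_zero] at h1
        rw [add_zero, zero_add, hm, h1]
        linear_combination c * h
      | succ j =>
        have h := gammaH_succ m j
        have h1 := hhigh j
        have h2 := hhigh (j + 1)
        rw [show m + (j + 1 + 1) = m + 1 + (j + 1) by ring, h2,
          show m + (j + 1) = m + 1 + j by ring, h1]
        push_cast
        linear_combination c * h

/-- The coefficients of the regular part for `h = m + 1 ≥ 2`. -/
def regSeq (m : ℕ) (c : ℝ) (k : ℕ) : ℝ :=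
  PowerSeries.coeff k (polyF (m + 1) : PowerSeries ℝ)
    - c * PowerSeries.coeff k (PowerSeries.X ^ (m + 1) * seriesH (m + 1))

lemma coeff_polyF (m k : ℕ) : PowerSeries.coeff k (polyF (m + 1) : PowerSeries ℝ)
    = if k < m then 1 / ((k.factorial : ℝ) * ((m - 1).descFactorial k : ℝ)) else 0 := by
  rw [Polynomial.coeff_coe, polyF, Polynomial.finsetSum_coeff]
  simp only [Polynomial.coeff_monomial, Finset.sum_ite_eq', Finset.mem_range, Nat.add_sub_cancel]
  rfl

lemma coeff_X_pow_mul_seriesH (n h k : ℕ) :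
    PowerSeries.coeff k (PowerSeries.X ^ n * seriesH h) = if n ≤ k then gammaH h (k - n) else 0 := by
  rw [PowerSeries.coeff_X_pow_mul']
  simp only [seriesH, PowerSeries.coeff_mk]

/-- The constant `c` is determined by the last coefficient of `F`: `1/((m-1)!)² = m c`. -/
lemma logRecurrence_regSeq {m : ℕ} (hm : 1 ≤ m) :
    LogRecurrence m (regSeq m (1 / ((m.factorial : ℝ) * ((m - 1).factorial : ℝ))))
      (fun j => 1 / ((m.factorial : ℝ) * ((m - 1).factorial : ℝ)) * kernelCoeff m j)
      (logSeq m (1 / ((m.factorial : ℝ) * ((m - 1).factorial : ℝ)))) := by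
  refine logRecurrence_of_gamma (fun k hk => ?_) (fun k hk => ?_) ?_ (fun j => ?_)
  · simp only [regSeq, coeff_polyF, coeff_X_pow_mul_seriesH]
    rw [if_pos hk, if_pos (by omega : k < m), if_neg (by omega : ¬ m + 1 ≤ k + 1),
      if_neg (by omega : ¬ m + 1 ≤ k), Nat.factorial_succ,
      Nat.descFactorial_succ]
    have h1 := k.factorial_ne_zero
    have h2 : ((m - 1).descFactorial k : ℝ) ≠ 0 := by
      exact_mod_cast (Nat.descFactorial_pos.mpr (by omega)).ne'
    have h3 : ((m - 1 - k : ℕ) : ℝ) = m - (k + 1) := by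
      rw [Nat.sub_sub, Nat.cast_sub (by omega)]; push_cast; ring
    have h4 : (m : ℝ) - (k + 1) ≠ 0 := by
      rw [← h3]; exact_mod_cast (by omega : m - 1 - k ≠ 0)
    push_cast
    rw [h3]
    field_simp
    ring
  · subst hk
    simp only [regSeq, coeff_polyF, coeff_X_pow_mul_seriesH]
    rw [if_pos (by omega), if_neg (by omega), Nat.add_sub_cancel, Nat.descFactorial_self,
      Nat.factorial_succ]
    have h1 := k.factorial_ne_zero
    push_cast
    field_simp
    ring
  · simp only [regSeq, coeff_polyF, coeff_X_pow_mul_seriesH]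
    rw [if_neg (by omega), if_neg (by omega)]
    ring
  · simp only [regSeq, coeff_polyF, coeff_X_pow_mul_seriesH]
    rw [if_neg (by omega), if_pos (by omega), Nat.add_sub_cancel_left]
    ring

/-- For `m = 0` the conditions below the critical order are void, and `c = -1` normalises the
leading log coefficient to `1`. -/
lemma logRecurrence_one :
    LogRecurrence 0 (fun k => PowerSeries.coeff k (PowerSeries.X * seriesH 1))
      (fun j => -1 * kernelCoeff 0 j) (logSeq 0 (-1)) := by
  have h : ∀ k, PowerSeries.coeff k (PowerSeries.X * seriesH 1)
      = if 1 ≤ k then gammaH 1 (k - 1) else 0 := fun k => by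
    rw [← coeff_X_pow_mul_seriesH, pow_one]
  refine logRecurrence_of_gamma (fun k hk => by omega) (fun k hk => by omega) ?_ (fun j => ?_)
  · simp [h]
  · simp only [h]
    rw [if_pos (by omega), zero_add, Nat.add_sub_cancel_left]
    ring

end Recurrences

/-! ### Differentiation under the integral up to the edge of a convex set -/

section ParametricIntegral

universe u

open Set

lemma hasFDerivWithinAt_slice {E F : Type u} [NormedAddCommGroup E] [NormedSpace ℝ E]
    [NormedAddCommGroup F] [NormedSpace ℝ F] {s : Set E} {K : Set ℝ} {G : E × ℝ → F}
    (hG : DifferentiableOn ℝ G (s ×ˢ K)) {z : E} (hz : z ∈ s) {t : ℝ} (ht : t ∈ K) :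
    HasFDerivWithinAt (fun z => G (z, t))
      ((fderivWithin ℝ G (s ×ˢ K) (z, t)).comp (ContinuousLinearMap.inl ℝ E ℝ)) s z := by
  have h1 : HasFDerivWithinAt (fun z : E => (z, t)) (ContinuousLinearMap.inl ℝ E ℝ) s z :=
    (hasFDerivAt_prodMk_left z t).hasFDerivWithinAt
  have hm : MapsTo (fun z : E => (z, t)) s (s ×ˢ K) := fun y hy => ⟨hy, ht⟩
  exact (hG (z, t) ⟨hz, ht⟩).hasFDerivWithinAt.comp z h1 hm

/-- Differentiation under the integral sign within a convex set. -/
lemma hasFDerivWithinAt_integral_of_convex {E F : Type u} [NormedAddCommGroup E] [NormedSpace ℝ E]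
    [NormedAddCommGroup F] [NormedSpace ℝ F] {s : Set E} (hs : Convex ℝ s)
    {G : E × ℝ → F} {G' : E × ℝ → E →L[ℝ] F} (hG : ContinuousOn G (s ×ˢ Icc 0 1))
    (hG' : ContinuousOn G' (s ×ˢ Icc 0 1))
    (hd : ∀ z ∈ s, ∀ t ∈ Icc (0 : ℝ) 1, HasFDerivWithinAt (fun z => G (z, t)) (G' (z, t)) s z)
    {z : E} (hz : z ∈ s) :
    HasFDerivWithinAt (fun z => ∫ t in (0 : ℝ)..1, G (z, t)) (∫ t in (0 : ℝ)..1, G' (z, t)) s z := by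
  have hslice : ∀ {A : Type u} [NormedAddCommGroup A] [NormedSpace ℝ A] {f : E × ℝ → A},
      ContinuousOn f (s ×ˢ Icc 0 1) → ∀ y ∈ s,
        IntervalIntegrable (fun t => f (y, t)) MeasureTheory.volume 0 1 := fun hf y hy =>
    ContinuousOn.intervalIntegrable_of_Icc zero_le_one
      (hf.comp (by fun_prop) fun t ht => ⟨hy, ht⟩)
  refine .of_isLittleO (Asymptotics.isLittleO_iff.mpr fun c hc => ?_)
  -- Compactness of `[0, 1]` makes `G' (y, t)` close to `G' (z, t)` uniformly in `t`. The mean value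
  -- inequality on the convex set `ball ∩ s` then gives the `c * ‖y - z‖` bound without requiring
  -- `z` to be interior.
  obtain ⟨v, hv, hv'⟩ := isCompact_Icc.mem_uniformity_of_prod (f := fun y t => G' (y, t))
    (s := s) (k := Icc (0 : ℝ) 1) (q := z) hG' hz (Metric.dist_mem_uniformity hc)
  obtain ⟨r, hr, hrv⟩ := Metric.mem_nhdsWithin_iff.mp hv
  filter_upwards [Metric.mem_nhdsWithin_iff.mpr ⟨r, hr, subset_rfl⟩] with y hy
  have hconv : Convex ℝ (Metric.ball z r ∩ s) := (convex_ball z r).inter hs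
  have hzm : z ∈ Metric.ball z r ∩ s := ⟨Metric.mem_ball_self hr, hz⟩
  have hpt : ∀ t ∈ Icc (0 : ℝ) 1, ‖G (y, t) - G (z, t) - G' (z, t) (y - z)‖ ≤ c * ‖y - z‖ := by
    intro t ht
    refine Convex.norm_image_sub_le_of_norm_hasFDerivWithin_le' (f := fun z => G (z, t))
      (f' := fun z => G' (z, t)) (s := Metric.ball z r ∩ s) (φ := G' (z, t))
      (fun x hx => (hd x hx.2 t ht).mono inter_subset_right) (fun x hx => ?_) hconv hzm hy
    have := hv' x (hrv hx) t ht
    rw [← dist_eq_norm]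
    exact le_of_lt this
  have hi := hslice hG y hy.2
  have hi' := hslice hG z hz
  have hi2 := hslice hG' z hz
  have hi3 : IntervalIntegrable (fun t => G' (z, t) (y - z)) MeasureTheory.volume 0 1 :=
    hslice (hG'.clm_apply continuousOn_const) z hz
  rw [ContinuousLinearMap.intervalIntegral_apply hi2, ← intervalIntegral.integral_sub hi hi',
    ← intervalIntegral.integral_sub (hi.sub hi') hi3]
  refine (intervalIntegral.norm_integral_le_of_norm_le_const (C := c * ‖y - z‖) fun t ht => ?_).trans
    (by simp)
  rw [uIoc_of_le zero_le_one] at ht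
  exact hpt t ⟨ht.1.le, ht.2⟩

/-- The derivative of the integral is an integral of the same kind with values in `E →L[ℝ] F`; the
induction therefore runs over all `F`, and one universe is used throughout. -/
lemma contDiffOn_nat_integral {E : Type u} [NormedAddCommGroup E] [NormedSpace ℝ E] {s : Set E}
    (hs : Convex ℝ s) (hu : UniqueDiffOn ℝ s) (n : ℕ) :
    ∀ {F : Type u} [NormedAddCommGroup F] [NormedSpace ℝ F] {G : E × ℝ → F},
      ContDiffOn ℝ ∞ G (s ×ˢ Icc 0 1) →
        ContDiffOn ℝ n (fun z => ∫ t in (0 : ℝ)..1, G (z, t)) s := by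
  have huK : UniqueDiffOn ℝ (s ×ˢ Icc (0 : ℝ) 1) := hu.prod (uniqueDiffOn_Icc zero_lt_one)
  have key : ∀ {F : Type u} [NormedAddCommGroup F] [NormedSpace ℝ F] {G : E × ℝ → F},
      ContDiffOn ℝ ∞ G (s ×ˢ Icc 0 1) → ∃ G' : E × ℝ → E →L[ℝ] F,
        ContDiffOn ℝ ∞ G' (s ×ˢ Icc 0 1) ∧ ∀ z ∈ s, HasFDerivWithinAt
          (fun z => ∫ t in (0 : ℝ)..1, G (z, t)) (∫ t in (0 : ℝ)..1, G' (z, t)) s z := by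
    intro F _ _ G hG
    have h1 : ContDiffOn ℝ ∞ (fderivWithin ℝ G (s ×ˢ Icc (0 : ℝ) 1)) (s ×ˢ Icc (0 : ℝ) 1) :=
      hG.fderivWithin huK (by simp)
    have h2 : ContDiffOn ℝ ∞ (fun p => (fderivWithin ℝ G (s ×ˢ Icc (0 : ℝ) 1) p).comp
        (ContinuousLinearMap.inl ℝ E ℝ)) (s ×ˢ Icc (0 : ℝ) 1) := h1.clm_comp contDiffOn_const
    exact ⟨_, h2, fun z hz => hasFDerivWithinAt_integral_of_convex hs hG.continuousOn
      h2.continuousOn (fun y hy t ht => hasFDerivWithinAt_slice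
        (hG.differentiableOn (by simp)) hy ht) hz⟩
  induction n with
  | zero =>
    intro F _ _ G hG
    obtain ⟨G', -, h⟩ := key hG
    exact contDiffOn_zero.mpr fun z hz => (h z hz).continuousWithinAt
  | succ n ih =>
    intro F _ _ G hG
    obtain ⟨G', h1, h2⟩ := key hG
    exact_mod_cast (contDiffOn_succ_iff_hasFDerivWithinAt_of_uniqueDiffOn hu).mpr
      ⟨by simp, _, ih h1, h2⟩

/-- Smooth dependence of an integral on parameters in a convex set. -/
lemma contDiffOn_integral_of_convex {E F : Type u} [NormedAddCommGroup E] [NormedSpace ℝ E]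
    [NormedAddCommGroup F] [NormedSpace ℝ F] {s : Set E} (hs : Convex ℝ s) (hu : UniqueDiffOn ℝ s)
    {G : E × ℝ → F} (hG : ContDiffOn ℝ ∞ G (s ×ˢ Icc 0 1)) :
    ContDiffOn ℝ ∞ (fun z => ∫ t in (0 : ℝ)..1, G (z, t)) s :=
  contDiffOn_infty.mpr fun n => contDiffOn_nat_integral hs hu n hG

end ParametricIntegral

/-! ### Hadamard's lemma on convex sets -/

section Division

open Set

/-- Smooth functions on a convex set which vanish on a hyperplane are divisible by the linear
function defining it, if the set is stable under projection to the hyperplane. -/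
lemma exists_smooth_quotient {E : Type} [NormedAddCommGroup E] [NormedSpace ℝ E] {s : Set E}
    (hs : Convex ℝ s) (hu : UniqueDiffOn ℝ s) (ℓ : E →L[ℝ] ℝ) (e : E)
    (hproj : ∀ z ∈ s, z - ℓ z • e ∈ s) {φ : E → ℝ}
    (hφ : ContDiffOn ℝ ∞ φ s) (hφ0 : ∀ z ∈ s, φ (z - ℓ z • e) = 0) :
    ∃ ψ : E → ℝ, ContDiffOn ℝ ∞ ψ s ∧ ∀ z ∈ s, φ z = ℓ z * ψ z := by
  -- The segment from the projection of `z` at `t = 0` to `z` at `t = 1`. Its velocity `ℓ z • e`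
  -- supplies the factor `ℓ z`, and the quotient is the integral of the derivative of `φ` in
  -- direction `e`.
  let A : E × ℝ → E := fun p => p.1 - ((1 - p.2) * ℓ p.1) • e
  have hA : ContDiff ℝ ∞ A := by
    refine contDiff_fst.sub (ContDiff.smul ?_ contDiff_const)
    exact (contDiff_const.sub contDiff_snd).mul (ℓ.contDiff.comp contDiff_fst)
  have hmaps : ∀ z ∈ s, ∀ t ∈ Icc (0 : ℝ) 1, A (z, t) ∈ s := by
    intro z hz t ht
    have := hs hz (hproj z hz) ht.1 (sub_nonneg.mpr ht.2) (by ring)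
    convert this using 1
    simp only [A]
    module
  have hD : ContDiffOn ℝ ∞ (fderivWithin ℝ φ s) s := hφ.fderivWithin hu (by simp)
  have hG : ContDiffOn ℝ ∞ (fun p : E × ℝ => fderivWithin ℝ φ s (A p) e) (s ×ˢ Icc 0 1) :=
    (hD.comp hA.contDiffOn fun p hp => hmaps p.1 hp.1 p.2 hp.2).clm_apply contDiffOn_const
  refine ⟨_, contDiffOn_integral_of_convex hs hu hG, fun z hz => ?_⟩
  have hderiv : ∀ t ∈ Icc (0 : ℝ) 1, HasDerivWithinAt (fun t => φ (A (z, t)))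
      (ℓ z * fderivWithin ℝ φ s (A (z, t)) e) (Icc 0 1) t := by
    intro t ht
    have h1 : HasDerivWithinAt (fun t => A (z, t)) (ℓ z • e) (Icc 0 1) t := by
      have h := (((hasDerivAt_id t).const_sub 1).mul_const (ℓ z)).smul_const e
      exact ((h.const_sub z).hasDerivWithinAt (s := Icc (0 : ℝ) 1)).congr_deriv (by module)
    have h2 := ((hφ.differentiableOn (by simp)) _ (hmaps z hz t ht)).hasFDerivWithinAt
    have := h2.comp_hasDerivWithinAt t h1 fun t ht => hmaps z hz t ht
    rwa [map_smul, smul_eq_mul] at this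
  have hint : IntervalIntegrable (fun t => ℓ z * fderivWithin ℝ φ s (A (z, t)) e)
      MeasureTheory.volume 0 1 :=
    ContinuousOn.intervalIntegrable_of_Icc zero_le_one
      (continuousOn_const.mul (hG.continuousOn.comp (by fun_prop) fun t ht => ⟨hz, ht⟩))
  have := intervalIntegral.integral_eq_sub_of_hasDerivAt_of_le zero_le_one
    (fun t ht => (hderiv t ht).continuousWithinAt)
    (fun t ht => (hderiv t (Ioo_subset_Icc_self ht)).hasDerivAt (Icc_mem_nhds ht.1 ht.2)) hint
  rw [intervalIntegral.integral_const_mul] at this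
  rw [this]
  have e1 : A (z, 1) = z := by simp [A]
  have e0 : A (z, 0) = z - ℓ z • e := by simp [A]
  rw [e1, e0, hφ0 z hz, sub_zero]

end Division

/-! ### Division by a boundary defining function -/

section BoundaryDivision

open Set

variable {d : ℕ} [NeZero d] {M : Type*} [TopologicalSpace M]
  [ChartedSpace (EuclideanHalfSpace d) M] [IsManifold (𝓡∂ d) ∞ M]

/-- Keeps a half ball centred on the boundary stable under projection to the boundary hyperplane. -/
lemma norm_sub_coord_le (w : EuclideanSpace ℝ (Fin d)) :
    ‖w - w 0 • EuclideanSpace.single (0 : Fin d) (1 : ℝ)‖ ≤ ‖w‖ := by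
  rw [EuclideanSpace.norm_eq, EuclideanSpace.norm_eq]
  refine Real.sqrt_le_sqrt (Finset.sum_le_sum fun i _ => ?_)
  by_cases hi : i = 0
  · subst hi
    simp [sq_nonneg]
  · simp [hi]

/-- Being a boundary point can be tested in any chart of the atlas, so the chart at `x₀` serves for
nearby points as well. -/
lemma isBoundaryPoint_extChartAt_symm (x₀ : M) {z : EuclideanSpace ℝ (Fin d)}
    (hz : z ∈ (extChartAt (𝓡∂ d) x₀).target) (h0 : z 0 = 0) :
    (𝓡∂ d).IsBoundaryPoint ((extChartAt (𝓡∂ d) x₀).symm z) := by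
  have hs := (extChartAt (𝓡∂ d) x₀).map_target hz
  rw [extChartAt_source] at hs
  rw [ModelWithCorners.isBoundaryPoint_iff_of_mem_atlas (n := ∞) (by simp)
    (chart_mem_atlas _ x₀) hs]
  change extChartAt (𝓡∂ d) x₀ _ ∈ frontier (extChartAt (𝓡∂ d) x₀).target
  rw [(extChartAt (𝓡∂ d) x₀).right_inv hz]
  refine ⟨subset_closure hz, fun hi => ?_⟩
  have := interior_mono (extChartAt_target_subset_range (I := 𝓡∂ d) x₀) hi
  rw [interior_range_modelWithCornersEuclideanHalfSpace] at this
  exact (ne_of_gt this) h0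

/-- A chart domain around a boundary point which is a half ball. -/
lemma exists_halfBall {x₀ : M} (hb : (𝓡∂ d).IsBoundaryPoint x₀) :
    ∃ S : Set (EuclideanSpace ℝ (Fin d)), S ∈ 𝓝[range (𝓡∂ d)] (extChartAt (𝓡∂ d) x₀ x₀) ∧
      extChartAt (𝓡∂ d) x₀ x₀ ∈ S ∧ S ⊆ (extChartAt (𝓡∂ d) x₀).target ∧
      Convex ℝ S ∧ UniqueDiffOn ℝ S ∧
      ∀ z ∈ S, z - z 0 • EuclideanSpace.single (0 : Fin d) (1 : ℝ) ∈ S := by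
  set z₀ := extChartAt (𝓡∂ d) x₀ x₀ with hz₀
  have h0 : z₀ 0 = 0 := by
    rw [ModelWithCorners.isBoundaryPoint_iff, frontier_range_modelWithCornersEuclideanHalfSpace]
      at hb
    exact hb.symm
  obtain ⟨r, hr, hsub⟩ := Metric.mem_nhdsWithin_iff.mp
    (extChartAt_target_mem_nhdsWithin (I := 𝓡∂ d) x₀)
  have hconv : Convex ℝ (range (𝓡∂ d)) := (𝓡∂ d).convex_range
  refine ⟨Metric.ball z₀ r ∩ range (𝓡∂ d), Filter.inter_mem
    (mem_nhdsWithin_of_mem_nhds (Metric.ball_mem_nhds _ hr)) self_mem_nhdsWithin,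
    ⟨Metric.mem_ball_self hr, mem_range_self _⟩, hsub, (convex_ball _ _).inter hconv, ?_, ?_⟩
  · rw [inter_comm]
    exact (𝓡∂ d).uniqueDiffOn.inter Metric.isOpen_ball
  · rintro z ⟨hz, hz'⟩
    refine ⟨?_, ?_⟩
    · rw [mem_ball_iff_norm] at hz ⊢
      refine lt_of_le_of_lt ?_ hz
      have := norm_sub_coord_le (z - z₀)
      rw [PiLp.sub_apply, h0, sub_zero] at this
      rwa [sub_right_comm] at this
    · rw [range_modelWithCornersEuclideanHalfSpace]
      simp

lemma contDiffOn_comp_extChartAt_symm {f : M → ℝ} (hf : ContMDiff (𝓡∂ d) 𝓘(ℝ, ℝ) ∞ f) (x₀ : M)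
    {S : Set (EuclideanSpace ℝ (Fin d))} (hS : S ⊆ (extChartAt (𝓡∂ d) x₀).target) :
    ContDiffOn ℝ ∞ (f ∘ (extChartAt (𝓡∂ d) x₀).symm) S := by
  rw [← contMDiffOn_iff_contDiffOn]
  exact hf.comp_contMDiffOn ((contMDiffOn_extChartAt_symm x₀).mono hS)

variable {σ : M → ℝ} (hσ : ContMDiff (𝓡∂ d) 𝓘(ℝ, ℝ) ∞ σ) (hσ_nonneg : ∀ x, 0 ≤ σ x)
  (hσ_zero : ∀ x, σ x = 0 ↔ (𝓡∂ d).IsBoundaryPoint x)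
  (hdσ : ∀ x, σ x = 0 → mvfderiv (𝓡∂ d) σ x ≠ 0)
include hσ hσ_nonneg hσ_zero hdσ

/-- Smooth functions which vanish on the boundary are locally divisible by a defining function. -/
lemma exists_local_quotient {f : M → ℝ} (hf : ContMDiff (𝓡∂ d) 𝓘(ℝ, ℝ) ∞ f) (hf0 : ∀ x, σ x = 0 → f x = 0) (x₀ : M) :
    ∃ U ∈ 𝓝 x₀, ∃ f' : M → ℝ, ContMDiffOn (𝓡∂ d) 𝓘(ℝ, ℝ) ∞ f' U ∧ ∀ y ∈ U, f y = σ y * f' y := by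
  rcases (hσ_nonneg x₀).eq_or_lt with hx | hx
  swap
  -- Off the boundary one simply divides. At a boundary point both `σ` and `f` are divided by the
  -- normal coordinate `ℓ`, and the quotient is `χ / ψ`.
  · refine ⟨{y | σ y ≠ 0}, (isOpen_ne_fun hσ.continuous continuous_const).mem_nhds hx.ne',
      fun y => f y / σ y, hf.contMDiffOn.div₀ hσ.contMDiffOn fun y hy => hy, fun y hy => ?_⟩
    have : σ y ≠ 0 := hy
    field_simp
  set φ := extChartAt (𝓡∂ d) x₀ with hφ
  obtain ⟨S, hSn, hSm, hSt, hSc, hSu, hSp⟩ := exists_halfBall ((hσ_zero x₀).mp hx.symm)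
  have hz : ∀ z ∈ S, z 0 = 0 → σ (φ.symm z) = 0 := fun z hz h0 =>
    (hσ_zero _).mpr (isBoundaryPoint_extChartAt_symm x₀ (hSt hz) h0)
  have hcoord : ∀ z : EuclideanSpace ℝ (Fin d),
      (z - z 0 • EuclideanSpace.single (0 : Fin d) (1 : ℝ)) 0 = 0 := fun z => by simp
  let ℓ : EuclideanSpace ℝ (Fin d) →L[ℝ] ℝ := EuclideanSpace.proj 0
  obtain ⟨ψ, hψ, hψ'⟩ := exists_smooth_quotient hSc hSu ℓ _ hSp
    (contDiffOn_comp_extChartAt_symm hσ x₀ hSt) fun z h => hz _ (hSp z h) (hcoord z)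
  obtain ⟨χ, hχ, hχ'⟩ := exists_smooth_quotient hSc hSu ℓ _ hSp
    (contDiffOn_comp_extChartAt_symm hf x₀ hSt)
    fun z h => hf0 _ (hz _ (hSp z h) (hcoord z))
  have hℓ : ℓ (φ x₀) = 0 := by
    have hb := (hσ_zero x₀).mp hx.symm
    rw [ModelWithCorners.isBoundaryPoint_iff, frontier_range_modelWithCornersEuclideanHalfSpace]
      at hb
    exact hb.symm
  -- Otherwise `σ = ℓ ψ` would be a product of two functions vanishing at the point, and its
  -- differential would be zero there.
  have hne : ψ (φ x₀) ≠ 0 := by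
    intro h0
    refine hdσ x₀ hx.symm ?_
    have h1 : HasFDerivWithinAt (σ ∘ φ.symm)
        (0 : EuclideanSpace ℝ (Fin d) →L[ℝ] ℝ) S (φ x₀) := by
      have h2 := (ℓ.hasFDerivWithinAt (s := S) (x := φ x₀)).mul
        ((hψ.differentiableOn (by simp)) _ hSm).hasFDerivWithinAt
      rw [h0, hℓ, zero_smul, zero_smul, add_zero] at h2
      exact h2.congr hψ' (hψ' _ hSm)
    have h3 : HasMFDerivAt (𝓡∂ d) 𝓘(ℝ, ℝ) σ x₀ 0 :=
      ⟨hσ.continuous.continuousAt, h1.mono_of_mem_nhdsWithin hSn⟩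
    rw [mvfderiv, h3.mfderiv]
    ext v
    simp
  have hnear : S ∩ {z | ψ z ≠ 0} ∈ 𝓝[range (𝓡∂ d)] (φ x₀) := by
    have h1 : ∀ᶠ z in 𝓝[S] (φ x₀), ψ z ≠ 0 :=
      (hψ.continuousOn _ hSm).eventually_ne hne
    have h2 := nhdsWithin_le_of_mem hSn h1
    exact Filter.inter_mem hSn h2
  rw [hφ, ← map_extChartAt_nhds, Filter.mem_map] at hnear
  refine ⟨_, Filter.inter_mem (extChartAt_source_mem_nhds (I := 𝓡∂ d) x₀) hnear,
    fun y => χ (φ y) / ψ (φ y), ?_, ?_⟩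
  · have h1 : ContDiffOn ℝ ∞ (fun z => χ z / ψ z) (S ∩ {z | ψ z ≠ 0}) :=
      (hχ.mono inter_subset_left).div (hψ.mono inter_subset_left) fun z hz => hz.2
    refine h1.contMDiffOn.comp (t := S ∩ {z | ψ z ≠ 0})
      ((contMDiffOn_extChartAt (x := x₀)).mono fun y hy => ?_) inter_subset_right
    rw [← extChartAt_source (𝓡∂ d)]
    exact hy.1
  · rintro y ⟨hy, hy'⟩
    have h1 := hψ' _ hy'.1
    have h2 := hχ' _ hy'.1
    have hne : ψ (extChartAt (𝓡∂ d) x₀ y) ≠ 0 := hy'.2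
    rw [Function.comp_apply, (extChartAt (𝓡∂ d) x₀).left_inv hy] at h1 h2
    rw [h1, h2]
    rw [mul_assoc, hφ, mul_div_cancel₀ _ hne]

variable [T2Space M] [SecondCountableTopology M]
  {F : Type*} [NormedAddCommGroup F] [NormedSpace ℝ F] [FiniteDimensional ℝ F]
  {V : M → Type*} [TopologicalSpace (TotalSpace F V)]
  [∀ x, AddCommGroup (V x)] [∀ x, Module ℝ (V x)] [∀ x, TopologicalSpace (V x)]
  [FiberBundle F V] [VectorBundle ℝ F V] [ContMDiffVectorBundle ∞ F V (𝓡∂ d)]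

/-- Smooth sections which vanish on the boundary are divisible by a defining function. -/
theorem exists_section_quotient {s : ∀ x, V x} (hs : SmoothSection (𝓡∂ d) F s)
    (hs0 : ∀ x, σ x = 0 → s x = 0) :
    ∃ s' : ∀ x, V x, SmoothSection (𝓡∂ d) F s' ∧ s = σ • s' := by
  have : LocallyCompactSpace M :=
    Manifold.locallyCompact_of_finiteDimensional (𝓡∂ d)
  have : ContMDiffVectorBundle 1 F V (𝓡∂ d) := ContMDiffVectorBundle.of_le (n := ∞) (by simp)
  suffices h : ∃ s' : Cₛ^(∞)⟮𝓡∂ d; F, V⟯, ∀ x, s' x ∈ {v | s x = σ x • v} by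
    obtain ⟨s', hs'⟩ := h
    exact ⟨s', s'.contMDiff, funext fun x => hs' x⟩
  -- The solutions `v` of `s x = σ x • v` form an affine set, so local quotients can be glued by a
  -- partition of unity even on the boundary, where the equation does not determine `v`.
  refine exists_contMDiffSection_forall_mem_convex_of_local (n := (⊤ : ℕ∞)) (𝓡∂ d)
    (F_fiber := F) V (fun x => {v | s x = σ x • v}) (fun x => ?_) fun x₀ => ?_
  · intro v hv w hw a b _ _ hab
    simp only [mem_ofPred_eq] at hv hw ⊢
    rw [smul_add, smul_comm _ a, smul_comm _ b, ← hv, ← hw, ← add_smul, hab, one_smul]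
  · let t := trivializationAt F V x₀
    have hx : x₀ ∈ t.baseSet := FiberBundle.mem_baseSet_trivializationAt F V x₀
    let b := Module.finBasis ℝ F
    obtain ⟨χ, -, hχ⟩ := (SmoothBumpFunction.nhds_basis_tsupport (I := 𝓡∂ d) x₀).mem_iff.mp
      (t.open_baseSet.mem_nhds hx)
    -- `exists_local_quotient` takes global functions, so the frame coefficients are cut off; only
    -- the region `χ = 1` is used afterwards.
    let c : Fin (Module.finrank ℝ F) → M → ℝ := fun i y => χ y • t.localFrameCoeff (𝓡∂ d) b i y (s y)
    have hc : ∀ i, ContMDiff (𝓡∂ d) 𝓘(ℝ, ℝ) ∞ (c i) := fun i y => by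
      by_cases hy : y ∈ t.baseSet
      · exact χ.contMDiffAt.smul (contMDiffAt_localFrameCoeff b hy (hs y) i)
      · have : ∀ᶠ z in 𝓝 y, c i z = 0 := by
          have h1 : (tsupport χ)ᶜ ∈ 𝓝 y :=
            (isClosed_tsupport _).isOpen_compl.mem_nhds fun h => hy (hχ h)
          filter_upwards [h1] with z hz
          simp [c, image_eq_zero_of_notMem_tsupport hz]
        exact (contMDiffAt_const (c := (0 : ℝ))).congr_of_eventuallyEq this
    have hc0 : ∀ i y, σ y = 0 → c i y = 0 := fun i y hy => by simp [c, hs0 y hy]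
    choose U hU c' hc' hcc' using fun i => exists_local_quotient hσ hσ_nonneg hσ_zero hdσ (hc i)
      (hc0 i) x₀
    refine ⟨(⋂ i, U i) ∩ (t.baseSet ∩ {y | χ y = 1}), Filter.inter_mem
      (Filter.iInter_mem.mpr hU) (Filter.inter_mem (t.open_baseSet.mem_nhds hx) χ.eventuallyEq_one),
      fun y => ∑ i, c' i y • t.localFrame b i y, ?_, ?_⟩
    · refine ContMDiffOn.sum_section fun i _ => ?_
      exact ((hc' i).mono fun y hy => mem_iInter.mp hy.1 i).smul_section
        ((Trivialization.contMDiffOn_localFrame_baseSet (I := 𝓡∂ d) ∞ t b i).mono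
          fun y hy => hy.2.1)
    · rintro y ⟨hyU, hyt, hy1⟩
      have h := Trivialization.eq_sum_localFrameCoeff_smul (I := 𝓡∂ d) (e := t) (b := b) (s := s) hyt
      simp only [mem_ofPred_eq, Finset.smul_sum]
      rw [h]
      refine Finset.sum_congr rfl fun i _ => ?_
      have h2 := hcc' i y (mem_iInter.mp hyU i)
      have h3 : c i y = t.localFrameCoeff (𝓡∂ d) b i y (s y) := by
        have : χ y = 1 := hy1
        simp [c, this]
      rw [smul_smul, ← h2, h3]

end BoundaryDivision

/-! ### The operators as endomorphisms of the module of smooth sections -/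

section SmoothSections

variable {E : Type*} [NormedAddCommGroup E] [NormedSpace ℝ E] [FiniteDimensional ℝ E]
  {H : Type*} [TopologicalSpace H] {I : ModelWithCorners ℝ E H}
  {M : Type*} [TopologicalSpace M] [ChartedSpace H M] [IsManifold I ∞ M] [T2Space M]
  (g : PseudoMetric I M) {σ : M → ℝ}
  {F : Type*} [NormedAddCommGroup F] [NormedSpace ℝ F]
  {V : M → Type*} [TopologicalSpace (TotalSpace F V)]
  [∀ x, AddCommGroup (V x)] [∀ x, Module ℝ (V x)] [∀ x, TopologicalSpace (V x)]
  [∀ x, IsTopologicalAddGroup (V x)] [∀ x, ContinuousSMul ℝ (V x)]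
  [FiberBundle F V] [VectorBundle ℝ F V]
  {cov : (∀ x, V x) → ∀ x, TangentSpace I x →L[ℝ] V x}

variable (I F V) in
/-- The module of smooth sections. -/
def smoothSections : Submodule ℝ (∀ x, V x) where
  carrier := {s | SmoothSection I F s}
  zero_mem' := Bundle.contMDiff_zeroSection ℝ V
  add_mem' ha hb := ContMDiff.add_section ha hb
  smul_mem' c s hs := ContMDiff.smul_section (f := fun _ => c) contMDiff_const hs

/-- Multiplication of smooth sections by a smooth function. -/
def mulSection {φ : M → ℝ} (hφ : CMDiff ∞ φ) : smoothSections I F V →ₗ[ℝ] smoothSections I F V where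
  toFun s := ⟨φ • s.1, hφ.smul_section s.2⟩
  map_add' s s' := Subtype.ext (smul_add φ s.1 s'.1)
  map_smul' c s := Subtype.ext (smul_comm φ c s.1)

lemma mulSection_apply {φ : M → ℝ} (hφ : CMDiff ∞ φ) (s : smoothSections I F V) (x : M) :
    (mulSection hφ s).1 x = φ x • s.1 x := rfl

lemma mulSection_pow_apply {φ : M → ℝ} (hφ : CMDiff ∞ φ) (k : ℕ) (s : smoothSections I F V)
    (x : M) : ((mulSection hφ ^ k) s).1 x = φ x ^ k • s.1 x := by
  induction k with
  | zero => simp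
  | succ k ih =>
    rw [pow_succ', Module.End.mul_apply, mulSection_apply, ih, smul_smul, pow_succ']

/-- A pair of smooth sections as a section of pairs. -/
def pairSection (p : smoothSections I F V × smoothSections I F V) : ∀ x, V x × V x :=
  fun x => (p.1.1 x, p.2.1 x)

lemma mdifferentiableAt_congr_section {s s' : ∀ x, V x} {x : M} (h : ∀ᶠ y in 𝓝 x, s y = s' y)
    (hs : MDiffAt (T% s') x) : MDiffAt (T% s) x := by
  refine hs.congr_of_eventuallyEq ?_
  filter_upwards [h] with y hy
  exact congrArg (TotalSpace.mk' F y) hy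

namespace IsSmoothConnection

variable (hcov : IsSmoothConnection F cov)
include hcov

/-- The degenerate Laplacian only depends on the germ of a section. -/
lemma IdotD_congr_germ (w : ℝ) {s s' : ∀ x, V x} (hs' : SmoothSection I F s') {x : M}
    (h : ∀ᶠ y in 𝓝 x, s y = s' y) :
    IdotD g σ cov (weight w) s x = IdotD g σ cov (weight w) s' x := by
  have hcongr : ∀ {s s' : ∀ x, V x}, ∀ y, (∀ᶠ z in 𝓝 y, s z = s' z) → MDiffAt (T% s') y →
      cov s y = cov s' y := fun {s s'} y hy hd =>
    hcov.isCov.congr_of_eventuallyEq (mdifferentiableAt_congr_section hy hd) hd Filter.univ_mem hy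
  have hd := mdifferentiableAt_of_smooth hs'
  have hlap : laplacian g cov s x = laplacian g cov s' x := by
    have hh : ∀ v w, hessian g cov s x v w = hessian g cov s' x v w := fun v w => by
      have h1 : ∀ᶠ y in 𝓝 x, cov s y (ext w y) = cov s' y (ext w y) := by
        filter_upwards [h.eventually_nhds] with y hy
        rw [hcongr y hy (hd y)]
      simp only [hessian]
      rw [hcongr x h1 (hcov.mdifferentiableAt_apply hs' (mdifferentiableAt_ext w)),
        hcongr x h (hd x)]
    simp only [laplacian, metricTrace, hh]
  have hx := h.self_of_nhds
  have h2 : cov (fun y => (dimR g - 2) • s y + (2 : ℝ) • weight (V := V) w y (s y)) x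
      = cov (fun y => (dimR g - 2) • s' y + (2 : ℝ) • weight (V := V) w y (s' y)) x := by
    refine hcongr x ?_ ?_
    · filter_upwards [h] with y hy
      rw [hy]
    · have h3 : SmoothSection I F ((dimR g - 2 + 2 * w) • s') :=
        (smoothSections I F V).smul_mem _ hs'
      refine mdifferentiableAt_congr_section (s' := (dimR g - 2 + 2 * w) • s')
        (Filter.Eventually.of_forall fun y => ?_) (mdifferentiableAt_of_smooth h3 x)
      simp only [weight, LinearMap.smul_apply, LinearMap.id_apply, Pi.smul_apply]
      module
  simp only [IdotD, thomasD, hlap, h2, hx]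

variable (hd : dimR g ≠ 0) (hσ : CMDiff ∞ σ) (hI : ∀ x, scaleNormSq g σ x ≠ 0)

omit hcov in
include hd hσ hI in
lemma contMDiff_scaleNormSq_inv : CMDiff ∞ (fun x => (scaleNormSq g σ x)⁻¹) :=
  (contMDiff_scaleNormSq g hd hσ).inv₀ hI

/-- The operator `y` on smooth sections. -/
def ySection (w : ℝ) : smoothSections I F V →ₗ[ℝ] smoothSections I F V where
  toFun s := -mulSection (contMDiff_scaleNormSq_inv g hd hσ hI)
    ⟨IdotD g σ cov (weight w) s.1, hcov.contMDiff_IdotD g hd hσ w s.2⟩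
  map_add' s s' := by
    rw [← neg_add, ← map_add]
    congr 2
    exact Subtype.ext (hcov.IdotD_add g hd hσ w s.2 s'.2)
  map_smul' c s := by
    rw [RingHom.id_apply, smul_neg, ← map_smul]
    congr 2
    exact Subtype.ext (hcov.IdotD_const_smul g hd hσ w c s.2)

/-- The derivative of `y` in the weight on smooth sections. -/
def ySectionDeriv (w : ℝ) : smoothSections I F V →ₗ[ℝ] smoothSections I F V where
  toFun s := -mulSection (contMDiff_scaleNormSq_inv g hd hσ hI)
    ⟨IdotDWeightDeriv g σ cov w s.1, hcov.contMDiff_IdotDWeightDeriv g hσ w s.2⟩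
  map_add' s s' := by
    rw [← neg_add, ← map_add]
    congr 2
    exact Subtype.ext (hcov.IdotDWeightDeriv_add g w s.2 s'.2)
  map_smul' c s := by
    rw [RingHom.id_apply, smul_neg, ← map_smul]
    congr 2
    exact Subtype.ext (hcov.IdotDWeightDeriv_const_smul g w c s.2)

lemma ySection_apply (w : ℝ) (s : smoothSections I F V) (x : M) :
    (hcov.ySection g hd hσ hI w s).1 x
      = -((scaleNormSq g σ x)⁻¹ • IdotD g σ cov (weight w) s.1 x) := rfl

lemma ySectionDeriv_apply (w : ℝ) (s : smoothSections I F V) (x : M) :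
    (hcov.ySectionDeriv g hd hσ hI w s).1 x
      = -((scaleNormSq g σ x)⁻¹ • IdotDWeightDeriv g σ cov w s.1 x) := rfl

/-- `IdotD_scale_smul` divided by `-I²`. On densities the weight operator is a scalar, so `ε = 0`.
-/
lemma scaleAlgebra : ScaleAlgebra (dimR g) (mulSection (F := F) (V := V) hσ) 0
    (hcov.ySection g hd hσ hI) where
  comm w s := Subtype.ext <| funext fun x => by
    have h := hcov.IdotD_scale_smul g hd hσ w s.2 x
    change -((scaleNormSq g σ x)⁻¹ • IdotD g σ cov (weight (w + 1)) (σ • s.1) x)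
      = σ x • (-((scaleNormSq g σ x)⁻¹ • IdotD g σ cov (weight w) s.1 x))
        - (dimR g + 2 * w) • s.1 x - (2 : ℝ) • (0 : V x)
    rw [h]
    have := hI x
    match_scalars <;> field_simp
  nil_X s := by simp
  nil_Y w s := by simp

lemma ySectionDeriv_comm (w : ℝ) (s : smoothSections I F V) :
    hcov.ySectionDeriv g hd hσ hI (w + 1) (mulSection hσ s)
      = mulSection hσ (hcov.ySectionDeriv g hd hσ hI w s) - (2 : ℝ) • s :=
  Subtype.ext <| funext fun x => by
    have h := hcov.IdotDWeightDeriv_scale_smul g hd hσ w s.2 x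
    change -((scaleNormSq g σ x)⁻¹ • IdotDWeightDeriv g σ cov (w + 1) (σ • s.1) x)
      = σ x • (-((scaleNormSq g σ x)⁻¹ • IdotDWeightDeriv g σ cov w s.1 x)) - (2 : ℝ) • s.1 x
    rw [h]
    have := hI x
    match_scalars <;> field_simp

omit hcov in
lemma weight_sub (w c : ℝ) : (fun x => weight (V := V) w x - c • LinearMap.id) = weight (w - c) := by
  ext x v
  simp only [weight, LinearMap.sub_apply, LinearMap.smul_apply, LinearMap.id_apply]
  module

omit hcov in
lemma logWeight_sub (w c : ℝ) :
    (fun x => logWeight (V := V) w x - c • LinearMap.id) = logWeight (w - c) := by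
  funext x
  refine LinearMap.ext fun p => ?_
  simp only [LinearMap.sub_apply, LinearMap.smul_apply, LinearMap.id_apply, logWeight_apply]
  refine Prod.ext ?_ ?_
  · simp only [Prod.fst_sub, Prod.smul_fst]; module
  · simp only [Prod.snd_sub, Prod.smul_snd]; module

lemma yPow_eq (w : ℝ) (k : ℕ) (s : smoothSections I F V) :
    yPow g σ cov (weight w) k s.1 = (iterY (hcov.ySection g hd hσ hI) w k s).1 := by
  induction k with
  | zero => rfl
  | succ k ih =>
    rw [yPow, ih, weight_sub, iterY_succ]
    rfl

/-- The geometric `y` on log densities is the algebraic `pairY` by `IdotD_logWeight`, where the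
nilpotent part of the weight produces the weight derivative. -/
lemma yPow_log_eq (w : ℝ) (k : ℕ) (p : smoothSections I F V × smoothSections I F V) :
    yPow g σ (logCov cov) (logWeight w) k (pairSection p)
      = pairSection (iterY (pairY (hcov.ySection g hd hσ hI) (hcov.ySectionDeriv g hd hσ hI))
          w k p) := by
  induction k with
  | zero => rfl
  | succ k ih =>
    rw [yPow, ih, logWeight_sub, iterY_succ]
    generalize iterY _ w k p = q
    funext x
    have h := hcov.IdotD_logWeight g hd hσ (w - k) (s := pairSection q) q.1.2 q.2.2 x
    rw [yOp, h, pairY_apply]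
    refine Prod.ext ?_ ?_
    · change -((scaleNormSq g σ x)⁻¹ • (IdotD g σ cov (weight (w - k)) q.1.1 x
          + IdotDWeightDeriv g σ cov (w - k) q.2.1 x))
        = -((scaleNormSq g σ x)⁻¹ • IdotD g σ cov (weight (w - k)) q.1.1 x)
          + -((scaleNormSq g σ x)⁻¹ • IdotDWeightDeriv g σ cov (w - k) q.2.1 x)
      module
    · rfl

lemma weylAverage_eq {τ : M → ℝ} (hτ : CMDiff ∞ (fun x => Real.log (τ x))) (w : ℝ) (m : ℕ)
    (s : smoothSections I F V) :
    weylAverage g σ cov w τ m s.1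
      = pairSection (algWeyl (hcov.ySection g hd hσ hI) (hcov.ySectionDeriv g hd hσ hI)
          (mulSection hτ) w m s) := by
  have h : logMul τ s.1 = pairSection (mulSection hτ s, s) := rfl
  rw [weylAverage, h, hcov.yPow_eq g hd hσ hI, hcov.yPow_log_eq g hd hσ hI]
  rfl

/-- The formal series of `regCoeff` and `logCoeff`. -/
def algSeries (w : ℝ) (m : ℕ) (P Q L : ℕ → ℝ) (f : smoothSections I F V)
    (W : smoothSections I F V × smoothSections I F V) : LogSeries V where
  reg k := pairSection (regCoeff (hcov.ySection g hd hσ hI) (hcov.ySectionDeriv g hd hσ hI) w m P Q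
    f W k)
  logx k := (logCoeff (hcov.ySection g hd hσ hI) w L f k).1

/-- Transfers the solution operator to the algebraic model. `F` and `H` merge into `regSeq`, and in
the logarithmic part the outer `y^j` joins the inner `y^m` by `iterY_add`. -/
lemma solO_eq {τ : M → ℝ} (hτ : CMDiff ∞ (fun x => Real.log (τ x))) (m : ℕ)
    (s : smoothSections I F V) :
    solO g σ cov (m + 1) τ s.1
      = hcov.algSeries g hd hσ hI (weightOf g (m + 1)) m
          (regSeq m (1 / ((m.factorial : ℝ) * ((m - 1).factorial : ℝ))))
          (fun j => 1 / ((m.factorial : ℝ) * ((m - 1).factorial : ℝ)) * kernelCoeff m j)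
          (logSeq m (1 / ((m.factorial : ℝ) * ((m - 1).factorial : ℝ)))) s
          (algWeyl (hcov.ySection g hd hσ hI) (hcov.ySectionDeriv g hd hσ hI)
            (mulSection hτ) (weightOf g (m + 1)) m s) := by
  set c : ℝ := 1 / ((m.factorial : ℝ) * ((m - 1).factorial : ℝ)) with hc
  have hK : seriesK (2 - ((m + 1 : ℕ) : ℝ)) = seriesK (1 - m) := by
    congr 1; push_cast; ring
  have hm : m + 1 - 2 = m - 1 := by omega
  simp only [solO, algSeries, Nat.add_sub_cancel, hK, hm, ← hc]
  congr 1
  · funext k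
    rw [hcov.weylAverage_eq g hd hσ hI hτ]
    funext x
    simp only [shift, normalOrder, regCoeff, Pi.add_apply, Pi.sub_apply, Pi.smul_apply, ofDensity,
      hcov.yPow_eq g hd hσ hI, hcov.yPow_log_eq g hd hσ hI, coeff_seriesK]
    generalize algWeyl _ _ _ _ _ s = W
    split_ifs with hk
    · refine Prod.ext ?_ ?_
      · simp only [pairSection, Prod.fst_add, Prod.fst_sub, Prod.smul_fst, Submodule.coe_add,
          Submodule.coe_smul, Pi.add_apply, Pi.smul_apply, regSeq]
        module
      · simp only [pairSection, Prod.snd_add, Prod.snd_sub, Prod.smul_snd, Submodule.coe_add,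
          Submodule.coe_smul, Pi.add_apply, Pi.smul_apply, Submodule.coe_zero, Pi.zero_apply]
        module
    · refine Prod.ext ?_ ?_
      · simp only [pairSection, Prod.fst_add, Prod.fst_sub, Prod.smul_fst, Submodule.coe_add,
          Submodule.coe_smul, Pi.add_apply, Pi.smul_apply, regSeq, Pi.zero_apply, Prod.fst_zero,
          Submodule.coe_zero]
        module
      · simp [pairSection]
  · funext k
    rw [hcov.yPow_eq g hd hσ hI]
    simp only [shift, normalOrder, logCoeff, logSeq, hcov.yPow_eq g hd hσ hI, coeff_seriesK]
    split_ifs with hk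
    · rw [iterY_add, Nat.add_sub_cancel' hk, Submodule.coe_smul]
      module
    · simp

/-- With no power of `y` to average over, the Weyl average is just multiplication by `log τ`, so
this case is the instance `m = 0` of the same model. -/
lemma solBar_eq {τ : M → ℝ} (hτ : CMDiff ∞ (fun x => Real.log (τ x)))
    (s : smoothSections I F V) :
    solObar g σ cov τ s.1
      = hcov.algSeries g hd hσ hI (weightOf g 1) 0
          (fun k => PowerSeries.coeff k (PowerSeries.X * seriesH 1))
          (fun j => -1 * kernelCoeff 0 j) (logSeq 0 (-1)) s
          (algWeyl (hcov.ySection g hd hσ hI) (hcov.ySectionDeriv g hd hσ hI)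
            (mulSection hτ) (weightOf g 1) 0 s) := by
  have hW : algWeyl (hcov.ySection g hd hσ hI) (hcov.ySectionDeriv g hd hσ hI)
      (mulSection hτ) (weightOf g 1) 0 s = (mulSection hτ s, s) := by
    rw [algWeyl, iterY_zero, iterY_zero, ← two_smul ℝ, smul_smul]
    norm_num
  have h : logMul τ s.1 = pairSection (mulSection hτ s, s) := rfl
  rw [hW]
  simp only [solObar, algSeries, h]
  congr 1
  · funext k x
    simp only [normalOrder, regCoeff, Pi.add_apply, Pi.neg_apply, Pi.smul_apply, ofDensity,
      hcov.yPow_eq g hd hσ hI, hcov.yPow_log_eq g hd hσ hI, coeff_seriesJ0, Nat.zero_le, if_true,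
      Nat.sub_zero, Nat.cast_zero, sub_zero]
    generalize iterY _ _ _ (mulSection hτ s, s) = q
    refine Prod.ext ?_ ?_
    · simp only [pairSection, Prod.fst_add, Prod.smul_fst, Submodule.coe_add, Prod.fst_neg,
        Submodule.coe_smul, Pi.add_apply, Pi.smul_apply]
      module
    · simp only [pairSection, Prod.snd_add, Prod.smul_snd, Submodule.coe_add, Prod.snd_neg,
        Submodule.coe_smul, Pi.add_apply, Pi.smul_apply, Submodule.coe_zero, Pi.zero_apply]
      module
  · funext k
    simp only [normalOrder, logCoeff, logSeq, hcov.yPow_eq g hd hσ hI, coeff_seriesJ0, Nat.zero_le,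
      if_true, Nat.sub_zero, Submodule.coe_smul]
    module

end IsSmoothConnection

end SmoothSections

/-! ### How the coefficients react to a change of the data -/

section CoefficientDifferences

variable {A : Type*} [AddCommGroup A] [Module ℝ A] {X : A →ₗ[ℝ] A} {Y N : ℝ → A →ₗ[ℝ] A} {d w : ℝ}
  {m : ℕ} {P Q L : ℕ → ℝ}

lemma regCoeff_sub (f f' : A) (W W' : A × A) (k : ℕ) :
    regCoeff Y N w m P Q (f - f') (W - W') k
      = regCoeff Y N w m P Q f W k - regCoeff Y N w m P Q f' W' k := by
  simp only [regCoeff, map_sub, smul_sub]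
  split_ifs
  · rw [show ((P k • iterY Y w k f - P k • iterY Y w k f', (0 : A)) : A × A)
      = (P k • iterY Y w k f, 0) - (P k • iterY Y w k f', 0) by simp]
    abel
  · simp

lemma logCoeff_sub (f f' : A) (k : ℕ) :
    logCoeff Y w L (f - f') k = logCoeff Y w L f k - logCoeff Y w L f' k := by
  simp only [logCoeff, map_sub, smul_sub]

lemma algWeyl_sub (T : A →ₗ[ℝ] A) (f f' : A) :
    algWeyl Y N T w m (f - f') = algWeyl Y N T w m f - algWeyl Y N T w m f' := by
  have h : (T (f - f'), f - f') = (T f, f) - (T f', f') := by simp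
  have h' : (T (iterY Y w m (f - f')), iterY Y w m (f - f'))
      = (T (iterY Y w m f), iterY Y w m f) - (T (iterY Y w m f'), iterY Y w m f') := by simp
  rw [algWeyl, h, h', map_sub, algWeyl, algWeyl]
  module

lemma regCoeff_X_zero (a : A) (W : A × A) :
    regCoeff Y N (w + 1) m P Q (X a) (X.prodMap X W - (m : ℝ) • (iterY Y w (m - 1) a, 0)) 0
      = X.prodMap X (regCoeff Y N w m P Q a W 0) := by
  rcases Nat.eq_zero_or_pos m with rfl | hm
  · have h := regCoeff_add (Y := Y) (N := N) (m := 0) (P := P) (Q := Q) (w := w) (f := a) (W := W) 0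
    have h' := regCoeff_add (Y := Y) (N := N) (m := 0) (P := P) (Q := Q) (w := w + 1) (f := X a)
      (W := X.prodMap X W - ((0 : ℕ) : ℝ) • (iterY Y w (0 - 1) a, 0)) 0
    rw [add_zero] at h h'
    rw [h, h', iterY_zero, iterY_zero, iterY_zero, iterY_zero]
    simp
  · rw [regCoeff_lt hm, regCoeff_lt hm, iterY_zero, iterY_zero]
    simp

/-- The quotient by `x` of the effect of a change of the auxiliary scale. -/
def scaleChangeCoeff (Y : ℝ → A →ₗ[ℝ] A) (w : ℝ) (m : ℕ) (Q : ℕ → ℝ) (v : A) (k : ℕ) : A :=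
  if m ≤ k then Q (k - m) • iterY Y (w - m - 1) (k - m) v else 0

lemma regCoeff_scale_change_zero (v : A) :
    regCoeff Y N w m P Q 0 (X v, 0) 0 = (X (scaleChangeCoeff Y w m Q v 0), 0) := by
  simp only [regCoeff, scaleChangeCoeff, map_zero, smul_zero, Nat.zero_sub, iterY_zero]
  split_ifs <;> simp

/-- A change of scale enters only through the first component of the datum, so `N` plays no role and
the kernel recurrence alone makes the differences telescope. -/
lemma LogRecurrence.regCoeff_scale_change (hR : LogRecurrence m P Q L) (hA : ScaleAlgebra d X 0 Y)
    (hw : d + 2 * w = m + 1) (v : A) (k : ℕ) :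
    regCoeff Y N w m P Q 0 (X v, 0) (k + 1)
      = (X (scaleChangeCoeff Y w m Q v (k + 1)) - scaleChangeCoeff Y w m Q v k, 0) := by
  simp only [regCoeff, scaleChangeCoeff, map_zero, smul_zero, iterY_pair_inl]
  rcases lt_trichotomy (k + 1) m with hk | hk | hk
  · rw [if_neg (by omega), if_neg (by omega), if_neg (by omega)]
    simp
  · subst hk
    rw [if_pos le_rfl, if_pos le_rfl, if_neg (by omega), Nat.sub_self, iterY_zero, iterY_zero]
    simp
  · obtain ⟨j, rfl⟩ := Nat.exists_eq_add_of_le (by omega : m ≤ k)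
    rw [if_pos (by omega), if_pos (by omega), if_pos (by omega), add_assoc m j 1,
      Nat.add_sub_cancel_left, Nat.add_sub_cancel_left, ← hR.iterY_scale_change hA hw v j]
    simp

lemma algWeyl_scale_change (hA : ScaleAlgebra d X 0 Y) (hw : d + 2 * w = m + 1)
    {T T' : A →ₗ[ℝ] A} (hT : ∀ a, ∃ v, T a - T' a = X v) (f : A) :
    ∃ v, algWeyl Y N T w m f - algWeyl Y N T' w m f = (X v, 0) := by
  obtain ⟨v₁, h₁⟩ := hT (iterY Y w m f)
  obtain ⟨v₂, h₂⟩ := hT f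
  have hX : iterY Y w m (X v₂) = X (iterY Y (w - 1) m v₂) := by
    cases m with
    | zero => rfl
    | succ k =>
      have h := hA.iterY_X (w - 1) k v₂
      rw [sub_add_cancel] at h
      -- This is the weight at which `y^m` commutes with `x`, so both orderings in the Weyl average
      -- change by a multiple of `x`.
      have hz : d + 2 * (w - 1) - k = 0 := by push_cast at hw; linarith
      rw [h, hz]
      simp
  have h3 : ((T f, f) : A × A) - (T' f, f) = (X v₂, 0) := by rw [← h₂]; simp
  have h4 : ((T (iterY Y w m f), iterY Y w m f) : A × A) - (T' (iterY Y w m f), iterY Y w m f)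
      = (X v₁, 0) := by rw [← h₁]; simp
  refine ⟨(1 / 2 : ℝ) • (v₁ + iterY Y (w - 1) m v₂), ?_⟩
  rw [algWeyl, algWeyl, ← smul_sub, add_sub_add_comm, h4, ← map_sub, h3, iterY_pair_inl, hX]
  simp

end CoefficientDifferences

/-! ### Telescoping formal series -/

section FormalSeries

variable {E : Type*} [NormedAddCommGroup E] [NormedSpace ℝ E] [FiniteDimensional ℝ E]
  {H : Type*} [TopologicalSpace H] {I : ModelWithCorners ℝ E H}
  {M : Type*} [TopologicalSpace M] [ChartedSpace H M] [IsManifold I ∞ M] [T2Space M]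
  {σ : M → ℝ}
  {F : Type*} [NormedAddCommGroup F] [NormedSpace ℝ F]
  {V : M → Type*} [TopologicalSpace (TotalSpace F V)]
  [∀ x, AddCommGroup (V x)] [∀ x, Module ℝ (V x)] [∀ x, TopologicalSpace (V x)]
  [∀ x, IsTopologicalAddGroup (V x)] [∀ x, ContinuousSMul ℝ (V x)]
  [FiberBundle F V] [VectorBundle ℝ F V]

/-- `log σ` is singular on `Σ`. Since the operators are local, a global smooth function with the
same germ can replace it at points with `σ > 0`. -/
lemma exists_smooth_log (hσ : CMDiff ∞ σ) {x : M} (hx : 0 < σ x) :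
    ∃ L : M → ℝ, CMDiff ∞ L ∧ L =ᶠ[𝓝 x] fun y => Real.log (σ y) := by
  have hu : {y | 0 < σ y} ∈ 𝓝 x := hσ.continuous.continuousAt.eventually (lt_mem_nhds hx)
  obtain ⟨L, hL, h⟩ := exists_global_eventuallyEq (I := I) (F := ℝ) (V := Bundle.Trivial M ℝ) hu
    (s := fun y => Real.log (σ y)) fun y hy => by
      refine ContMDiffAt.contMDiffWithinAt ((Bundle.contMDiffAt_section _).mpr ?_)
      have hlog : ContMDiffAt 𝓘(ℝ, ℝ) 𝓘(ℝ, ℝ) ∞ Real.log (σ y) :=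
        (Real.contDiffAt_log.mpr (ne_of_gt hy)).contMDiffAt
      exact hlog.comp y (hσ y)
  exact ⟨L, contMDiff_trivial_iff.mp hL, h⟩

lemma FormallyEqual.trans {u v u' : LogSeries V} (h : FormallyEqual I F σ u v)
    (h' : FormallyEqual I F σ v u') : FormallyEqual I F σ u u' := fun n => by
  obtain ⟨p, q, hp, hq, e⟩ := h n
  obtain ⟨p', q', hp', hq', e'⟩ := h' n
  refine ⟨p + p', q + q', ContMDiff.add_section hp hp', ContMDiff.add_section hq hq',
    fun x hx => ?_⟩
  rw [← sub_add_sub_cancel _ (v.partialSum σ n x), e x hx, e' x hx, Pi.add_apply, Pi.add_apply]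
  module

/-- Formal series whose difference telescopes are equal. -/
lemma formallyEqual_of_telescope {u v : LogSeries V} (e b : ℕ → smoothSections I F V)
    (he0 : ∀ x, (u.reg 0 x).1 - (v.reg 0 x).1 = σ x • (e 0).1 x)
    (he : ∀ k x, (u.reg (k + 1) x).1 - (v.reg (k + 1) x).1 = σ x • (e (k + 1)).1 x - (e k).1 x)
    (hb0 : ∀ x, u.logx 0 x - v.logx 0 x = σ x • (b 0).1 x)
    (hb : ∀ k x, u.logx (k + 1) x - v.logx (k + 1) x = σ x • (b (k + 1)).1 x - (b k).1 x) :
    FormallyEqual I F σ u v := fun n => by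
  refine ⟨(e n).1, (b n).1, (e n).2, (b n).2, fun x _ => ?_⟩
  simp only [LogSeries.partialSum]
  induction n with
  | zero =>
    have h1 := he0 x
    have h2 := hb0 x
    rw [sub_eq_iff_eq_add] at h1 h2
    simp only [zero_add, Finset.sum_range_one, h1, h2]
    module
  | succ n ih =>
    have h1 := he n x
    have h2 := hb n x
    rw [sub_eq_iff_eq_add] at h1 h2
    rw [Finset.sum_range_succ, Finset.sum_range_succ _ (n + 1), add_sub_add_comm, ih, h1, h2]
    match_scalars <;> ring

end FormalSeries

/-! ### The residual of the truncations and independence of choices -/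

section Solutions

variable {E : Type*} [NormedAddCommGroup E] [NormedSpace ℝ E] [FiniteDimensional ℝ E]
  {H : Type*} [TopologicalSpace H] {I : ModelWithCorners ℝ E H}
  {M : Type*} [TopologicalSpace M] [ChartedSpace H M] [IsManifold I ∞ M] [T2Space M]
  (g : PseudoMetric I M) {σ : M → ℝ}
  {F : Type*} [NormedAddCommGroup F] [NormedSpace ℝ F]
  {V : M → Type*} [TopologicalSpace (TotalSpace F V)]
  [∀ x, AddCommGroup (V x)] [∀ x, Module ℝ (V x)] [∀ x, TopologicalSpace (V x)]
  [∀ x, IsTopologicalAddGroup (V x)] [∀ x, ContinuousSMul ℝ (V x)]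
  [FiberBundle F V] [VectorBundle ℝ F V]
  {cov : (∀ x, V x) → ∀ x, TangentSpace I x →L[ℝ] V x}

lemma weightOf_spec (m : ℕ) : dimR g + 2 * weightOf g (m + 1) = m + 1 := by
  rw [weightOf]; push_cast; ring

namespace IsSmoothConnection

variable (hcov : IsSmoothConnection F cov) (hd : dimR g ≠ 0) (hσ : CMDiff ∞ σ)
  (hI : ∀ x, scaleNormSq g σ x ≠ 0) {m : ℕ} {P Q L : ℕ → ℝ}

/-- The smooth coefficients of the solution with respect to the powers of `σ`. -/
def freeCoeff (T : smoothSections I F V →ₗ[ℝ] smoothSections I F V) (w : ℝ) (m : ℕ)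
    (P Q L : ℕ → ℝ) (f : smoothSections I F V)
    (W : smoothSections I F V × smoothSections I F V) (k : ℕ) : smoothSections I F V :=
  (regCoeff (hcov.ySection g hd hσ hI) (hcov.ySectionDeriv g hd hσ hI) w m P Q f W k).1
    + T (logCoeff (hcov.ySection g hd hσ hI) w L f k)

lemma shift_logCoeff (hR : LogRecurrence m P Q L) (w : ℝ) (f : smoothSections I F V) (k : ℕ) :
    shift m (fun j => (logCoeff (hcov.ySection g hd hσ hI) w L f (m + j)).1) k
      = (logCoeff (hcov.ySection g hd hσ hI) w L f k).1 := by
  rw [shift]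
  split_ifs with hk
  · rw [Nat.add_sub_cancel' hk]
  · rw [logCoeff, hR.below k (by omega), zero_smul]
    rfl

lemma algSeries_hasForm (hR : LogRecurrence m P Q L) {τ : M → ℝ}
    (hτ : CMDiff ∞ (fun x => Real.log (τ x))) (w : ℝ) {f : smoothSections I F V}
    {W : smoothSections I F V × smoothSections I F V}
    (hW : W.2 = iterY (hcov.ySection g hd hσ hI) w m f) :
    (hcov.algSeries g hd hσ hI w m P Q L f W).HasForm (m + 1) τ
      (fun k => (hcov.freeCoeff g hd hσ hI (mulSection hτ) w m P Q L f W k).1)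
      (fun j => (logCoeff (hcov.ySection g hd hσ hI) w L f (m + j)).1) := by
  refine ⟨fun k => ?_, fun k => ?_⟩
  · rw [Nat.add_sub_cancel, hcov.shift_logCoeff g hd hσ hI hR]
    funext x
    refine Prod.ext ?_ ?_
    · simp only [algSeries, pairSection, ofDensity, logMul, freeCoeff, Pi.sub_apply, Prod.fst_sub,
        Submodule.coe_add, Pi.add_apply, mulSection_apply]
      module
    · simp only [algSeries, pairSection, ofDensity, logMul, Pi.sub_apply, Prod.snd_sub,
        hR.regCoeff_snd hW]
      rw [zero_sub]
      rfl
  · rw [Nat.add_sub_cancel, hcov.shift_logCoeff g hd hσ hI hR]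
    rfl

omit [T2Space M] [IsManifold I ∞ M] [FiniteDimensional ℝ E]
  [∀ x, IsTopologicalAddGroup (V x)] [∀ x, ContinuousSMul ℝ (V x)] hcov in
lemma coe_sum_apply {ι : Type*} (t : Finset ι) (s : ι → smoothSections I F V) (x : M) :
    (∑ i ∈ t, s i).1 x = ∑ i ∈ t, (s i).1 x := by
  rw [Submodule.coe_sum, Finset.sum_apply]

/-- The residual of the truncated series. -/
lemma IdotD_truncation (hR : LogRecurrence m P Q L) {τ : M → ℝ}
    (hτ : CMDiff ∞ (fun x => Real.log (τ x))) {w : ℝ} (hw : dimR g + 2 * w = m + 1)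
    {f : smoothSections I F V} {W : smoothSections I F V × smoothSections I F V}
    (hW : W.2 = iterY (hcov.ySection g hd hσ hI) w m f) (n : ℕ) {x : M} (hx : 0 < σ x) :
    IdotD g σ cov (weight w) (truncation σ (m + 1) τ
      (fun k => (hcov.freeCoeff g hd hσ hI (mulSection hτ) w m P Q L f W k).1)
      (fun j => (logCoeff (hcov.ySection g hd hσ hI) w L f (m + j)).1) n) x
      = σ x ^ n • (-(scaleNormSq g σ x •
          (pairY (hcov.ySection g hd hσ hI) (hcov.ySectionDeriv g hd hσ hI) (w - n)
            (regCoeff (hcov.ySection g hd hσ hI) (hcov.ySectionDeriv g hd hσ hI) w m P Q f W n)).1.1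
              x))
        + (σ x ^ n * Real.log (σ x)) • (-(scaleNormSq g σ x •
          (hcov.ySection g hd hσ hI (w - n) (logCoeff (hcov.ySection g hd hσ hI) w L f n)).1 x)) := by
  obtain ⟨l, hl, hlog⟩ := exists_smooth_log hσ hx
  have hsum₁ := hR.sum_pairY_regCoeff (hcov.scaleAlgebra g hd hσ hI)
    (hcov.ySectionDeriv_comm g hd hσ hI) hw hW n
  have hsum₂ := hR.sum_Y_logCoeff (hcov.scaleAlgebra g hd hσ hI) hw f n
  have hsnd := fun k => hR.regCoeff_snd (P := P) (N := hcov.ySectionDeriv g hd hσ hI) hW k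
  set Y := hcov.ySection g hd hσ hI with hY
  set N := hcov.ySectionDeriv g hd hσ hI with hN
  set X := mulSection (F := F) (V := V) hσ with hX
  set a := regCoeff Y N w m P Q f W with ha
  set b := logCoeff Y w L f with hb
  let R₁ : smoothSections I F V := ∑ k ∈ Finset.range (n + 1), (X ^ k) (a k).1
  let R₂ : smoothSections I F V := ∑ k ∈ Finset.range (n + 1), (X ^ k) (b k)
  let S₂ : smoothSections I F V := ∑ k ∈ Finset.range n, (X ^ k) (b (k + 1))
  have hgerm : ∀ᶠ y in 𝓝 x, truncation σ (m + 1) τ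
      (fun k => (hcov.freeCoeff g hd hσ hI (mulSection hτ) w m P Q L f W k).1)
      (fun j => (b (m + j)).1) n y = (R₁.1 + l • R₂.1) y := by
    filter_upwards [hlog] with y hy
    rw [truncation, Nat.add_sub_cancel, Pi.add_apply, Pi.smul_apply', coe_sum_apply, coe_sum_apply,
      Finset.smul_sum, ← Finset.sum_add_distrib]
    refine Finset.sum_congr rfl fun k _ => ?_
    rw [hcov.shift_logCoeff g hd hσ hI hR, ← hY, ← hb, mulSection_pow_apply, mulSection_pow_apply,
      freeCoeff, ← hY, ← hN, ← ha, ← hb, Submodule.coe_add, Pi.add_apply, mulSection_apply, hy]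
    module
  have hlR : SmoothSection I F (l • R₂.1) := hl.smul_section R₂.2
  rw [hcov.IdotD_congr_germ g w (s' := R₁.1 + l • R₂.1)
      (ContMDiff.add_section R₁.2 hlR) hgerm,
    hcov.IdotD_add g hd hσ w R₁.2 hlR, Pi.add_apply, hcov.IdotD_log_smul g hd hσ w hl R₂.2 hx hlog]
  -- After multiplication by `m`, the logarithmic part is divisible by `x`: its order-zero term
  -- vanishes if `m > 0`, and the factor is zero if `m = 0`. This absorbs the `1/σ` from the
  -- commutator with `log σ`.
  have hm : (m : ℝ) • R₂ = (m : ℝ) • X S₂ := by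
    have h0 : (m : ℝ) • b 0 = 0 := by
      rcases Nat.eq_zero_or_pos m with h | h
      · rw [h]; simp
      · rw [hb, logCoeff, hR.below 0 h]; simp
    have h1 : X S₂ = ∑ k ∈ Finset.range n, (X ^ (k + 1)) (b (k + 1)) := by
      rw [map_sum]
      exact Finset.sum_congr rfl fun k _ => by rw [pow_succ', Module.End.mul_apply]
    change (m : ℝ) • ∑ k ∈ Finset.range (n + 1), (X ^ k) (b k) = _
    rw [Finset.sum_range_succ', smul_add, h1, pow_zero, Module.End.one_apply, h0, add_zero]
  -- The first component of the telescoped sum: the second components of the pairs are the negatives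
  -- of the log coefficients, whence `-N w R₂`, which also arises from the commutator with `log σ`.
  have h₁ : Y w R₁ - N w R₂ = (X ^ n) (pairY Y N (w - n) (a n)).1 + (m : ℝ) • S₂ := by
    have h := congrArg Prod.fst hsum₁
    rw [Prod.fst_sum, Prod.fst_add, prodMap_pow_apply, Prod.smul_fst, Prod.fst_sum] at h
    rw [← h, map_sum, map_sum, ← Finset.sum_sub_distrib]
    refine Finset.sum_congr rfl fun k _ => ?_
    rw [pairY_apply, prodMap_pow_apply, hsnd, map_neg, map_neg, sub_eq_add_neg]
  have h₂ : Y w R₂ = (X ^ n) (Y (w - n) (b n)) := by rw [← hsum₂, map_sum]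
  have hne := hI x
  have hy₁ : IdotD g σ cov (weight w) R₁.1 x = -(scaleNormSq g σ x • (Y w R₁).1 x) := by
    rw [hY, ySection_apply]
    match_scalars
    field_simp
  have hy₂ : IdotD g σ cov (weight w) R₂.1 x = -(scaleNormSq g σ x • (Y w R₂).1 x) := by
    rw [hY, ySection_apply]
    match_scalars
    field_simp
  have hn₂ : IdotDWeightDeriv g σ cov w R₂.1 x = -(scaleNormSq g σ x • (N w R₂).1 x) := by
    rw [hN, ySectionDeriv_apply]
    match_scalars
    field_simp
  have h₁x : (Y w R₁).1 x = (N w R₂).1 x + σ x ^ n • (pairY Y N (w - n) (a n)).1.1 x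
      + (m : ℝ) • S₂.1 x := by
    rw [sub_eq_iff_eq_add] at h₁
    rw [h₁, Submodule.coe_add, Submodule.coe_add, Submodule.coe_smul, Pi.add_apply, Pi.add_apply,
      Pi.smul_apply, mulSection_pow_apply]
    abel
  have h₂x : (Y w R₂).1 x = σ x ^ n • (Y (w - n) (b n)).1 x := by
    rw [h₂, mulSection_pow_apply]
  have hmx : (m : ℝ) • R₂.1 x = (m : ℝ) • σ x • S₂.1 x := congrArg (fun s => s.1 x) hm
  have hmx' : (scaleNormSq g σ x * (dimR g + 2 * w - 1) * (σ x)⁻¹) • R₂.1 x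
      = (scaleNormSq g σ x * m) • S₂.1 x := by
    rw [hw, add_sub_cancel_right, mul_right_comm, mul_smul _ (m : ℝ), hmx]
    match_scalars
    field_simp
  rw [hy₁, hy₂, hn₂, hmx', h₁x, h₂x, hlog.self_of_nhds]
  module

lemma algSeries_isInfiniteOrderSolution (hR : LogRecurrence m P Q L) {τ : M → ℝ}
    (hτ : CMDiff ∞ (fun x => Real.log (τ x))) {f : smoothSections I F V}
    {W : smoothSections I F V × smoothSections I F V}
    (hW : W.2 = iterY (hcov.ySection g hd hσ hI) (weightOf g (m + 1)) m f) :
    IsInfiniteOrderSolution F g σ cov (m + 1) τ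
      (fun k => (hcov.freeCoeff g hd hσ hI (mulSection hτ) (weightOf g (m + 1)) m P Q L f W k).1)
      (fun j => (logCoeff (hcov.ySection g hd hσ hI) (weightOf g (m + 1)) L f (m + j)).1) := by
  refine ⟨fun k => Subtype.property _, fun j => Subtype.property _, fun n => ?_⟩
  have hN := contMDiff_scaleNormSq g hd hσ
  refine ⟨_, _, ?_, ?_, ?_, fun x hx => hcov.IdotD_truncation g hd hσ hI hR hτ (weightOf_spec g m)
    hW n hx⟩
  · exact (-(mulSection hN _) : smoothSections I F V).2
  · exact (-(mulSection hN _) : smoothSections I F V).2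
  · intro hn
    rw [Nat.add_sub_cancel] at hn
    funext x
    rw [logCoeff, hR.below n hn, zero_smul, map_zero]
    simp

/-- Changing the leading datum by a multiple of `σ` and the auxiliary scale accordingly does not
change the formal series. -/
lemma algSeries_formallyEqual (hR : LogRecurrence m P Q L) {τ τ' : M → ℝ}
    (hτ : CMDiff ∞ (fun x => Real.log (τ x))) (hτ' : CMDiff ∞ (fun x => Real.log (τ' x)))
    (hdiff : ∀ s : smoothSections I F V, ∃ v, mulSection hτ s - mulSection hτ' s = mulSection hσ v)
    {f f' : smoothSections I F V} {v : smoothSections I F V} (hf : f - f' = mulSection hσ v) :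
    FormallyEqual I F σ
      (hcov.algSeries g hd hσ hI (weightOf g (m + 1)) m P Q L f
        (algWeyl (hcov.ySection g hd hσ hI) (hcov.ySectionDeriv g hd hσ hI) (mulSection hτ)
          (weightOf g (m + 1)) m f))
      (hcov.algSeries g hd hσ hI (weightOf g (m + 1)) m P Q L f'
        (algWeyl (hcov.ySection g hd hσ hI) (hcov.ySectionDeriv g hd hσ hI) (mulSection hτ')
          (weightOf g (m + 1)) m f')) := by
  have hA := hcov.scaleAlgebra g hd hσ hI
  have hC := hcov.ySectionDeriv_comm g hd hσ hI
  have hw := weightOf_spec g m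
  generalize weightOf g (m + 1) = w at *
  have hw' : dimR g + 2 * (w - 1) = m - 1 := by linarith
  -- The leading datum is changed first, with the scale fixed, and then the scale.
  refine FormallyEqual.trans (v := hcov.algSeries g hd hσ hI w m P Q L f'
    (algWeyl (hcov.ySection g hd hσ hI) (hcov.ySectionDeriv g hd hσ hI) (mulSection hτ) w m f'))
    ?_ ?_
  · simp only [algSeries]
    set Y := hcov.ySection g hd hσ hI
    set N := hcov.ySectionDeriv g hd hσ hI
    set T := mulSection (F := F) (V := V) hτ
    have hWX := algWeyl_X hA hC (T := T) (fun s => Subtype.ext (smul_comm _ _ s.1)) hw' v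
    rw [sub_add_cancel, ← hf, algWeyl_sub] at hWX
    have hsnd := algWeyl_snd (Y := Y) (N := N) T (w - 1) m v
    have hreg0 := regCoeff_X_zero (Y := Y) (N := N) (X := mulSection hσ) (w := w - 1) (m := m)
      (P := P) (Q := Q) v (algWeyl Y N T (w - 1) m v)
    have hreg := hR.regCoeff_X (N := N) hA hC hw' hsnd
    have hlog := hR.logCoeff_X hA hw' v
    rw [sub_add_cancel, ← hf, ← hWX, regCoeff_sub] at hreg0
    simp only [sub_add_cancel, ← hf, ← hWX, regCoeff_sub] at hreg
    simp only [sub_add_cancel, ← hf, logCoeff_sub] at hlog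
    have hlog0 : logCoeff Y w L f 0 - logCoeff Y w L f' 0
        = mulSection hσ (logCoeff Y (w - 1) L v 0) := by
      rw [← logCoeff_sub, hf, logCoeff, logCoeff, iterY_zero, iterY_zero, map_smul]
    exact formallyEqual_of_telescope
      (fun k => (regCoeff Y N (w - 1) m P Q v (algWeyl Y N T (w - 1) m v) k).1)
      (fun k => logCoeff Y (w - 1) L v k)
      (fun x => congrArg (fun p => p.1.1 x) hreg0) (fun k x => congrArg (fun p => p.1.1 x) (hreg k))
      (fun x => congrArg (fun p => p.1 x) hlog0) (fun k x => congrArg (fun p => p.1 x) (hlog k))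
  · simp only [algSeries]
    set Y := hcov.ySection g hd hσ hI
    set N := hcov.ySectionDeriv g hd hσ hI
    obtain ⟨v', hv'⟩ := algWeyl_scale_change (N := N) hA hw hdiff f'
    have hkey : ∀ k, regCoeff Y N w m P Q f' (algWeyl Y N (mulSection hτ) w m f') k
        - regCoeff Y N w m P Q f' (algWeyl Y N (mulSection hτ') w m f') k
          = regCoeff Y N w m P Q 0 (mulSection hσ v', 0) k := fun k => by
      rw [← regCoeff_sub, hv', sub_self]
    have hreg0 := (hkey 0).trans (regCoeff_scale_change_zero v')
    have hreg := fun k => (hkey (k + 1)).trans (hR.regCoeff_scale_change hA hw v' k)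
    refine formallyEqual_of_telescope (fun k => scaleChangeCoeff Y w m Q v' k) (fun _ => 0)
      (fun x => congrArg (fun p => p.1.1 x) hreg0) (fun k x => congrArg (fun p => p.1.1 x) (hreg k))
      (fun x => ?_) fun k x => ?_
    · simp
    · simp

end IsSmoothConnection

end Solutions

/-! ### Data agreeing on the boundary -/

section Boundary

variable {d : ℕ} [NeZero d] {M : Type*} [TopologicalSpace M] [T2Space M] [SecondCountableTopology M]
  [ChartedSpace (EuclideanHalfSpace d) M] [IsManifold (𝓡∂ d) ∞ M]
  {g : PseudoMetric (𝓡∂ d) M} {σ : M → ℝ}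
  {F : Type*} [NormedAddCommGroup F] [NormedSpace ℝ F] [FiniteDimensional ℝ F]
  {V : M → Type*} [TopologicalSpace (TotalSpace F V)]
  [∀ x, AddCommGroup (V x)] [∀ x, Module ℝ (V x)] [∀ x, TopologicalSpace (V x)]
  [∀ x, IsTopologicalAddGroup (V x)] [∀ x, ContinuousSMul ℝ (V x)]
  [FiberBundle F V] [VectorBundle ℝ F V] [ContMDiffVectorBundle ∞ F V (𝓡∂ d)]

lemma dimR_eq (g : PseudoMetric (𝓡∂ d) M) : dimR g = d := by
  rw [dimR, finrank_euclideanSpace_fin]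

lemma dimR_ne_zero (g : PseudoMetric (𝓡∂ d) M) : dimR g ≠ 0 := by
  rw [dimR_eq]
  exact_mod_cast NeZero.ne d

/-- Where `σ = 0`, `I²` reduces to `|dσ|²`; this is what makes `σ` usable as a divisor. -/
lemma mvfderiv_ne_zero_of_scaleNormSq (hσ : ContMDiff (𝓡∂ d) 𝓘(ℝ, ℝ) ∞ σ)
    (hI : ∀ x, scaleNormSq g σ x ≠ 0) (x : M) (hx : σ x = 0) : mvfderiv (𝓡∂ d) σ x ≠ 0 := by
  intro h
  refine hI x ?_
  rw [scaleNormSq_eq g (dimR_ne_zero g) ((hσ x).mdifferentiableAt (by simp)), h, hx]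
  simp

lemma contMDiff_log {τ : M → ℝ} (hτ : ContMDiff (𝓡∂ d) 𝓘(ℝ, ℝ) ∞ τ) (hpos : ∀ x, 0 < τ x) :
    ContMDiff (𝓡∂ d) 𝓘(ℝ, ℝ) ∞ (fun x => Real.log (τ x)) := fun x =>
  ((Real.contDiffAt_log.mpr (hpos x).ne').contMDiffAt).comp x (hτ x)

lemma CovariantDerivative.isSmoothConnection (cov : CovariantDerivative (𝓡∂ d) F V)
    [h : CovariantDerivative.ContMDiffCovariantDerivative cov ∞] :
    IsSmoothConnection F cov.toFun where
  isCov := cov.isCovariantDerivativeOnUniv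
  smooth s hs := contMDiffOn_univ.mp (h.contMDiff.contMDiff (σ := s) hs.contMDiffOn)

/-- Sections which agree on the boundary differ by a multiple of a defining function. -/
lemma exists_section_sub_eq (hσ : ContMDiff (𝓡∂ d) 𝓘(ℝ, ℝ) ∞ σ) (hσ_nonneg : ∀ x, 0 ≤ σ x)
    (hσ_zero : ∀ x, σ x = 0 ↔ (𝓡∂ d).IsBoundaryPoint x) (hI : ∀ x, scaleNormSq g σ x ≠ 0)
    {s s' : smoothSections (𝓡∂ d) F V} (h : ∀ x, σ x = 0 → s.1 x = s'.1 x) :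
    ∃ v, s - s' = mulSection hσ v := by
  obtain ⟨v, hv, e⟩ := exists_section_quotient (F := F) (V := V) hσ hσ_nonneg hσ_zero
    (mvfderiv_ne_zero_of_scaleNormSq hσ hI) (s - s').2 fun x hx => by
      rw [Submodule.coe_sub, Pi.sub_apply, h x hx, sub_self]
  exact ⟨⟨v, hv⟩, Subtype.ext e⟩

lemma exists_log_sub_eq (hσ : ContMDiff (𝓡∂ d) 𝓘(ℝ, ℝ) ∞ σ) (hσ_nonneg : ∀ x, 0 ≤ σ x)
    (hσ_zero : ∀ x, σ x = 0 ↔ (𝓡∂ d).IsBoundaryPoint x) (hI : ∀ x, scaleNormSq g σ x ≠ 0)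
    {τ τ' : M → ℝ} (hτ : ContMDiff (𝓡∂ d) 𝓘(ℝ, ℝ) ∞ (fun x => Real.log (τ x)))
    (hτ' : ContMDiff (𝓡∂ d) 𝓘(ℝ, ℝ) ∞ (fun x => Real.log (τ' x)))
    (h : ∀ x, σ x = 0 → τ x = τ' x) (s : smoothSections (𝓡∂ d) F V) :
    ∃ v, mulSection hτ s - mulSection hτ' s = mulSection hσ v :=
  exists_section_sub_eq hσ hσ_nonneg hσ_zero hI fun x hx => by
    rw [mulSection_apply, mulSection_apply, h x hx]

end Boundary

end

end TractorCalculus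

/-! ### The theorem -/

open TractorCalculus in
theorem theorem5p8
    -- a manifold with boundary of dimension `d ≥ 3`, and a metric `g` of the conformal class
    (d : ℕ) [NeZero d] (hd : 3 ≤ d)
    {M : Type*} [TopologicalSpace M] [T2Space M] [SecondCountableTopology M]
    [ChartedSpace (EuclideanHalfSpace d) M] [IsManifold (𝓡∂ d) ∞ M]
    (g : PseudoMetric (𝓡∂ d) M)
    -- the defining density `σ ≥ 0` of `Σ = ∂M`, with `I²` nowhere zero
    (σ : M → ℝ) (hσ : ContMDiff (𝓡∂ d) 𝓘(ℝ, ℝ) ∞ σ) (hσ_nonneg : ∀ x, 0 ≤ σ x)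
    (hσ_zero : ∀ x, σ x = 0 ↔ (𝓡∂ d).IsBoundaryPoint x)
    (hI : ∀ x, scaleNormSq g σ x ≠ 0)
    -- a tractor bundle with its tractor connection
    {F : Type*} [NormedAddCommGroup F] [NormedSpace ℝ F] [FiniteDimensional ℝ F]
    {V : M → Type*} [TopologicalSpace (TotalSpace F V)]
    [∀ x, AddCommGroup (V x)] [∀ x, Module ℝ (V x)] [∀ x, TopologicalSpace (V x)]
    [∀ x, IsTopologicalAddGroup (V x)] [∀ x, ContinuousSMul ℝ (V x)]
    [FiberBundle F V] [VectorBundle ℝ F V] [ContMDiffVectorBundle ∞ F V (𝓡∂ d)]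
    (cov : CovariantDerivative (𝓡∂ d) F V)
    [CovariantDerivative.ContMDiffCovariantDerivative cov ∞]
    (hV : IsTractorBundle F g cov) :
    -- the case `h₀ ≥ 2`
    (∀ h : ℕ, 2 ≤ h →
      (∀ (f₀ : ∀ x, V x) (τ : M → ℝ), SmoothSection (𝓡∂ d) F f₀ →
        ContMDiff (𝓡∂ d) 𝓘(ℝ, ℝ) ∞ τ → (∀ x, 0 < τ x) →
        ∃ f fbar : ℕ → ∀ x, V x,
          (solO g σ cov h τ f₀).HasForm h τ f fbar ∧
          IsInfiniteOrderSolution F g σ cov h τ f fbar ∧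
          f 0 = f₀ ∧
          -- no free term of order `h - 1`: only the logarithmic terms of `𝒪` contribute there
          (solO g σ cov h τ f₀).reg (h - 1)
            = (1 / (((h - 1).factorial : ℝ) * ((h - 2).factorial : ℝ))) •
                weylAverage g σ cov (weightOf g h) τ (h - 1) f₀ ∧
          fbar 0 = -((1 / (((h - 1).factorial : ℝ) * ((h - 2).factorial : ℝ))) •
                yPow g σ cov (weight (weightOf g h)) (h - 1) f₀)) ∧
      (∀ (f₀ f₀' : ∀ x, V x) (τ τ' : M → ℝ),
        SmoothSection (𝓡∂ d) F f₀ → SmoothSection (𝓡∂ d) F f₀' →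
        ContMDiff (𝓡∂ d) 𝓘(ℝ, ℝ) ∞ τ → (∀ x, 0 < τ x) →
        ContMDiff (𝓡∂ d) 𝓘(ℝ, ℝ) ∞ τ' → (∀ x, 0 < τ' x) →
        (∀ x, σ x = 0 → f₀ x = f₀' x) → (∀ x, σ x = 0 → τ x = τ' x) →
        FormallyEqual (𝓡∂ d) F σ (solO g σ cov h τ f₀) (solO g σ cov h τ' f₀'))) ∧
    -- the case `h₀ = 1`
    (∀ (f₀ : ∀ x, V x) (τ : M → ℝ), SmoothSection (𝓡∂ d) F f₀ →
      ContMDiff (𝓡∂ d) 𝓘(ℝ, ℝ) ∞ τ → (∀ x, 0 < τ x) →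
      ∃ f fbar : ℕ → ∀ x, V x,
        (solObar g σ cov τ f₀).HasForm 1 τ f fbar ∧
        IsInfiniteOrderSolution F g σ cov 1 τ f fbar ∧
        f 0 = 0 ∧ fbar 0 = f₀) ∧
    (∀ (f₀ f₀' : ∀ x, V x) (τ τ' : M → ℝ),
      SmoothSection (𝓡∂ d) F f₀ → SmoothSection (𝓡∂ d) F f₀' →
      ContMDiff (𝓡∂ d) 𝓘(ℝ, ℝ) ∞ τ → (∀ x, 0 < τ x) →
      ContMDiff (𝓡∂ d) 𝓘(ℝ, ℝ) ∞ τ' → (∀ x, 0 < τ' x) →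
      (∀ x, σ x = 0 → f₀ x = f₀' x) → (∀ x, σ x = 0 → τ x = τ' x) →
      FormallyEqual (𝓡∂ d) F σ (solObar g σ cov τ f₀) (solObar g σ cov τ' f₀')) := by
  have hd0 := dimR_ne_zero g
  have hcov := CovariantDerivative.isSmoothConnection cov
  refine ⟨fun h hh => ?_, fun f₀ τ hf hτ hpos => ?_, fun f₀ f₀' τ τ' hf hf' hτ hpos hτ' hpos' e e' => ?_⟩
  · obtain ⟨m, rfl⟩ : ∃ m, h = m + 1 := ⟨h - 1, by omega⟩
    have hm : 1 ≤ m := by omega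
    have hR := logRecurrence_regSeq hm
    rw [show m + 1 - 2 = m - 1 by omega, Nat.add_sub_cancel]
    refine ⟨fun f₀ τ hf hτ hpos => ?_, fun f₀ f₀' τ τ' hf hf' hτ hpos hτ' hpos' e e' => ?_⟩
    · have hl := contMDiff_log hτ hpos
      have hs := hcov.solO_eq g hd0 hσ hI hl m ⟨f₀, hf⟩
      have hW := algWeyl_snd (Y := hcov.ySection g hd0 hσ hI) (N := hcov.ySectionDeriv g hd0 hσ hI)
        (mulSection hl) (weightOf g (m + 1)) m ⟨f₀, hf⟩
      have hA := hcov.weylAverage_eq g hd0 hσ hI hl (weightOf g (m + 1)) m ⟨f₀, hf⟩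
      have hy := hcov.yPow_eq g hd0 hσ hI (weightOf g (m + 1)) m ⟨f₀, hf⟩
      dsimp only at hs hA hy
      rw [hs, hA, hy]
      refine ⟨_, _, hcov.algSeries_hasForm g hd0 hσ hI hR hl _ hW,
        hcov.algSeries_isInfiniteOrderSolution g hd0 hσ hI hR hl hW, ?_, ?_, ?_⟩
      · have h0 : regSeq m (1 / ((m.factorial : ℝ) * ((m - 1).factorial : ℝ))) 0 = 1 := by
          simp only [regSeq, coeff_polyF, coeff_X_pow_mul_seriesH]
          rw [if_pos (by omega), if_neg (by omega)]
          simp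
        rw [IsSmoothConnection.freeCoeff, regCoeff_lt hm, logCoeff, hR.below 0 hm, zero_smul,
          map_zero, add_zero, iterY_zero, h0, one_smul]
      · have h0 := regCoeff_add (Y := hcov.ySection g hd0 hσ hI)
          (N := hcov.ySectionDeriv g hd0 hσ hI) (m := m)
          (P := regSeq m (1 / ((m.factorial : ℝ) * ((m - 1).factorial : ℝ))))
          (Q := fun j => 1 / ((m.factorial : ℝ) * ((m - 1).factorial : ℝ)) * kernelCoeff m j)
          (w := weightOf g (m + 1)) (f := ⟨f₀, hf⟩)
          (W := algWeyl (hcov.ySection g hd0 hσ hI) (hcov.ySectionDeriv g hd0 hσ hI)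
            (mulSection hl) (weightOf g (m + 1)) m ⟨f₀, hf⟩) 0
        -- `F` has degree `m - 1` and `z^h H` starts at order `m + 1`, so neither contributes at
        -- order `m`.
        have hP : regSeq m (1 / ((m.factorial : ℝ) * ((m - 1).factorial : ℝ))) m = 0 := by
          simp only [regSeq, coeff_polyF, coeff_X_pow_mul_seriesH]
          rw [if_neg (by omega), if_neg (by omega)]
          simp
        rw [add_zero, hP, zero_smul, iterY_zero, kernelCoeff_zero, mul_one] at h0
        change pairSection (regCoeff _ _ _ _ _ _ _ _ m) = _
        rw [h0]
        funext x
        exact Prod.ext (zero_add _) (zero_add _)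
      · have h0 := hR.above 0
        rw [add_zero, kernelCoeff_zero, mul_one] at h0
        rw [add_zero, logCoeff, h0, neg_smul]
        rfl
    · have hl := contMDiff_log hτ hpos
      have hl' := contMDiff_log hτ' hpos'
      obtain ⟨v, hv⟩ := exists_section_sub_eq (s := (⟨f₀, hf⟩ : smoothSections (𝓡∂ d) F V))
        (s' := ⟨f₀', hf'⟩) hσ hσ_nonneg hσ_zero hI e
      have hs := hcov.solO_eq g hd0 hσ hI hl m ⟨f₀, hf⟩
      have hs' := hcov.solO_eq g hd0 hσ hI hl' m ⟨f₀', hf'⟩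
      dsimp only at hs hs'
      rw [hs, hs']
      exact hcov.algSeries_formallyEqual g hd0 hσ hI hR hl hl'
        (exists_log_sub_eq hσ hσ_nonneg hσ_zero hI hl hl' e') hv
  · have hl := contMDiff_log hτ hpos
    have hR := logRecurrence_one
    have hs := hcov.solBar_eq g hd0 hσ hI hl ⟨f₀, hf⟩
    have hW := algWeyl_snd (Y := hcov.ySection g hd0 hσ hI) (N := hcov.ySectionDeriv g hd0 hσ hI)
      (mulSection hl) (weightOf g 1) 0 ⟨f₀, hf⟩
    have hf0 : logCoeff (hcov.ySection g hd0 hσ hI) (weightOf g 1) (logSeq 0 (-1)) ⟨f₀, hf⟩ 0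
        = ⟨f₀, hf⟩ := by
      have h0 := hR.above 0
      rw [add_zero, kernelCoeff_zero] at h0
      rw [logCoeff, iterY_zero, h0]
      simp
    dsimp only at hs
    rw [hs]
    refine ⟨_, _, hcov.algSeries_hasForm g hd0 hσ hI hR hl _ hW,
      hcov.algSeries_isInfiniteOrderSolution g hd0 hσ hI hR hl hW, ?_, ?_⟩
    · have h0 := regCoeff_add (Y := hcov.ySection g hd0 hσ hI)
        (N := hcov.ySectionDeriv g hd0 hσ hI) (m := 0)
        (P := fun k => PowerSeries.coeff k (PowerSeries.X * seriesH 1))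
        (Q := fun j => -1 * kernelCoeff 0 j)
        (w := weightOf g 1) (f := ⟨f₀, hf⟩)
        (W := algWeyl (hcov.ySection g hd0 hσ hI) (hcov.ySectionDeriv g hd0 hσ hI)
          (mulSection hl) (weightOf g 1) 0 ⟨f₀, hf⟩) 0
      have hA : (algWeyl (hcov.ySection g hd0 hσ hI) (hcov.ySectionDeriv g hd0 hσ hI)
          (mulSection hl) (weightOf g 1) 0 ⟨f₀, hf⟩).1 = mulSection hl ⟨f₀, hf⟩ := by
        simp only [algWeyl, iterY_zero, Prod.smul_fst, Prod.fst_add]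
        module
      -- The order-zero regular term is `-log τ f₀`, which cancels against the `log τ` contributed
      -- by rewriting in terms of `log σ - log τ`.
      change (IsSmoothConnection.freeCoeff _ _ _ _ _ _ _ _ _ _ _ _ _ _).1 = _
      rw [IsSmoothConnection.freeCoeff]
      rw [add_zero] at h0
      rw [hf0, h0, iterY_zero, iterY_zero, kernelCoeff_zero, Prod.fst_add, Prod.smul_fst, hA]
      simp
    · exact congrArg Subtype.val hf0
  · have hl := contMDiff_log hτ hpos
    have hl' := contMDiff_log hτ' hpos'
    obtain ⟨v, hv⟩ := exists_section_sub_eq (s := (⟨f₀, hf⟩ : smoothSections (𝓡∂ d) F V))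
      (s' := ⟨f₀', hf'⟩) hσ hσ_nonneg hσ_zero hI e
    have hs := hcov.solBar_eq g hd0 hσ hI hl ⟨f₀, hf⟩
    have hs' := hcov.solBar_eq g hd0 hσ hI hl' ⟨f₀', hf'⟩
    dsimp only at hs hs'
    rw [hs, hs']
    exact hcov.algSeries_formallyEqual g hd0 hσ hI logRecurrence_one hl hl'
      (exists_log_sub_eq hσ hσ_nonneg hσ_zero hI hl hl' e') hv
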